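/- **The categories.** Let $t\in\mathbb C$. For $k,l\in\mathbb N$ let $P_{even}(k,l)$ be the set of partitions of a set of $k$ lower points $1,\dots,k$ and $l$ upper points $1',\dots,l'$ all of whose blocks have an even number of elements. The category $\underline{\mathrm{Rep}}_0(H_t)$ has objects $[n]$, $n\in\mathbb N$, and $\mathrm{Hom}([k],[l])=\mathbb C P_{even}(k,l)$. Composition is the bilinear extension of $q\circ p:=t^{\ell(q,p)}\,qp$ for $p\in P_{even}(k,l)$, $q\in P_{even}(l,m)$, where $qp$ is the vertical concatenation ($q$ on top of $p$: identify the upper points of $p$ with the lower points of $q$, join blocks that meet, and restrict to the two outer rows) and $\ell(q,p)$ is the number of the joined blocks that lie entirely in the middle row. It is a strict $\mathbb C$-linear symmetric monoidal category with $[k]\otimes[l]=[k+l]$, horizontal concatenation as tensor product of morphisms, and the crossings as symmetry. $\underline{\mathrm{Rep}}(H_t)$ is its Karoubian envelope, that is, the idempotent completion of its additive envelope, with the embedding $\iota_G:\underline{\mathrm{Rep}}_0(H_t)\to\underline{\mathrm{Rep}}(H_t)$ and with the induced $\mathbb C$-linear symmetric monoidal structure. A $\mathbb C$-linear category is called Karoubi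 if it has finite biproducts and all its idempotents split. **Theorem.** Let $t\in\mathbb C$, let $\mathcal C$ be a $\mathbb C$-linear symmetric monoidal category and let $A\in\mathcal C$ be a $t$-dimensional self-dual rigid object with neutralizer, that is, an object with morphisms $\alpha:A\otimes A\to A\otimes A$ (neutralizer), $\beta:A\otimes A\to\mathbf 1$ (evaluation) and $\delta:\mathbf 1\to A\otimes A$ (coevaluation) such that, with $\gamma:A\otimes A\to A\otimes A$ the swap and with associators and unitors suppressed: 1. $(\mathrm{id}_A\otimes\beta)\circ(\delta\otimes\mathrm{id}_A)=\mathrm{id}_A=(\beta\otimes\mathrm{id}_A)\circ(\mathrm{id}_A\otimes\delta)$; 2. $\beta\circ\delta=t\cdot\mathrm{id}_{\mathbf 1}$; 3. $\alpha\circ\alpha=\alpha$, $\ (\mathrm{id}_A\otimes\alpha)\circ(\alpha\otimes\mathrm{id}_A)=(\alpha\otimes\mathrm{id}_A)\circ(\mathrm{id}_A\otimes\alpha)$, $\ \alpha\circ\gamma=\alpha$; 4. $\alpha\circ\delta=\delta$, $\ \beta\circ\alpha=\beta$, $\ (\mathrm{id}_A\otimes\alpha)\circ(\delta\otimes\mathrm{id}_A)=(\alpha\otimes\mathrm{id}_A)\circ(\mathrm{id}_A\otimes\delta)$,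 $\ (\beta\otimes\mathrm{id}_A)\circ(\mathrm{id}_A\otimes\alpha)=(\mathrm{id}_A\otimes\beta)\circ(\alpha\otimes\mathrm{id}_A)$. Then there is a unique strict $\mathbb C$-linear symmetric monoidal functor $\mathcal G':\underline{\mathrm{Rep}}_0(H_t)\to\mathcal C$ with $\mathcal G'([k])=A^{\otimes k}$ for all $k\in\mathbb N$ that sends the partition $\{\{1,2,1',2'\}\}:[2]\to[2]$ to $\alpha$, the partition $\{\{1,2\}\}:[2]\to[0]$ to $\beta$, the partition $\{\{1',2'\}\}:[0]\to[2]$ to $\delta$ and the crossing $\{\{1,2'\},\{2,1'\}\}:[2]\to[2]$ to $\gamma$. (If $\mathcal C$ is not strict, then $A^{\otimes 0}=\mathbf 1$, $A^{\otimes 1}=A$, $A^{\otimes(k+1)}=A^{\otimes k}\otimes A$ for $k\ge 1$, and "strict" means that the structure isomorphisms of $\mathcal G'$ are $\mathrm{id}_{\mathbf 1}$ and the canonical isomorphisms $A^{\otimes k}\otimes A^{\otimes l}\cong A^{\otimes(k+l)}$ composed of associators and unitors.) Furthermore, if $\mathcal C$ is Karoubi, then there is a $\mathbb C$-linear symmetric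 monoidal functor $\mathcal G:\underline{\mathrm{Rep}}(H_t)\to\mathcal C$ with $\mathcal G'=\mathcal G\circ\iota_G$, and any two such functors are isomorphic through a monoidal natural isomorphism. -/

import Mathlib

open CategoryTheory MonoidalCategory Limits

set_option linter.unusedSectionVars false

universe v u

noncomputable section

namespace KarEnv

section Karoubi
open Idempotents
variable {D : Type u} [Category.{v} D]

instance karoubiLinear [Preadditive D] [Linear ℂ D] : Linear ℂ (Karoubi D) where
  homModule P Q :=
    { smul := fun r f => ⟨r • f.f, by
        rw [Linear.smul_comp, Linear.comp_smul, f.comm]⟩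
      one_smul := fun f => Karoubi.hom_ext _ _ (one_smul ℂ f.f)
      mul_smul := fun r s f => Karoubi.hom_ext _ _ (mul_smul r s f.f)
      smul_zero := fun r => Karoubi.hom_ext _ _ (smul_zero r)
      smul_add := fun r f g => Karoubi.hom_ext _ _ (smul_add r f.f g.f)
      add_smul := fun r s f => Karoubi.hom_ext _ _ (add_smul r s f.f)
      zero_smul := fun f => Karoubi.hom_ext _ _ (zero_smul ℂ f.f) }
  smul_comp _ _ _ r f g := Karoubi.hom_ext _ _ (Linear.smul_comp _ _ _ r f.f g.f)
  comp_smul _ _ _ f r g := Karoubi.hom_ext _ _ (Linear.comp_smul _ _ _ f.f r g.f)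

/-- A morphism of `D` that intertwines the idempotents, cut down to the summands. -/
abbrev karHom {P Q : Karoubi D} (e : P.X ⟶ Q.X) (h : P.p ≫ e = e ≫ Q.p) : P ⟶ Q :=
  ⟨P.p ≫ e, by rw [Category.assoc, ← h, ← Category.assoc, ← Category.assoc, P.idem, P.idem]⟩

lemma karHom_comp {P Q R : Karoubi D} {e : P.X ⟶ Q.X} (h : P.p ≫ e = e ≫ Q.p)
    {e' : Q.X ⟶ R.X} (h' : Q.p ≫ e' = e' ≫ R.p) :
    karHom e h ≫ karHom e' h' =
      karHom (e ≫ e') (by rw [← Category.assoc, h, Category.assoc, h', Category.assoc]) :=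
  Karoubi.hom_ext _ _ (by
    have : (P.p ≫ e) ≫ Q.p ≫ e' = P.p ≫ e ≫ e' := by
      rw [Category.assoc, ← Category.assoc e, ← h, Category.assoc, ← Category.assoc, P.idem]
    exact this)

lemma karHom_id (P : Karoubi D) : 𝟙 P = karHom (𝟙 P.X) (by simp) :=
  Karoubi.hom_ext _ _ (Category.comp_id P.p).symm

lemma karHom_congr {P Q : Karoubi D} {e e' : P.X ⟶ Q.X} (h : P.p ≫ e = e ≫ Q.p)
    (h' : P.p ≫ e' = e' ≫ Q.p) (w : e = e') : karHom e h = karHom e' h' := by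
  subst w; rfl

/-- An isomorphism of `D` that intertwines the idempotents gives one between the summands. -/
abbrev karIso {P Q : Karoubi D} (e : P.X ≅ Q.X) (h : P.p ≫ e.hom = e.hom ≫ Q.p) : P ≅ Q where
  hom := karHom e.hom h
  inv := karHom e.inv (by rw [Iso.eq_inv_comp, ← Category.assoc, ← h]; simp)
  hom_inv_id := by rw [karHom_comp, karHom_id]; exact karHom_congr _ _ e.hom_inv_id
  inv_hom_id := by rw [karHom_comp, karHom_id]; exact karHom_congr _ _ e.inv_hom_id

variable [MonoidalCategory D]

/-- `(X, p) ⊗ (Y, q) = (X ⊗ Y, p ⊗ q)`. -/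
abbrev karTensorObj (P Q : Karoubi D) : Karoubi D :=
  ⟨P.X ⊗ Q.X, P.p ⊗ₘ Q.p, by rw [tensorHom_comp_tensorHom, P.idem, Q.idem]⟩

/-- The tensor product of morphisms is computed in `D`. -/
abbrev karTensorHom {P P' Q Q' : Karoubi D} (f : P ⟶ P') (g : Q ⟶ Q') :
    karTensorObj P Q ⟶ karTensorObj P' Q' :=
  ⟨f.f ⊗ₘ g.f, by
    rw [tensorHom_comp_tensorHom, tensorHom_comp_tensorHom, f.comm, g.comm]⟩

instance karoubiMonoidalStruct : MonoidalCategoryStruct (Karoubi D) where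
  tensorObj := karTensorObj
  tensorHom := karTensorHom
  whiskerLeft P _ _ f := karTensorHom (𝟙 P) f
  whiskerRight f Q := karTensorHom f (𝟙 Q)
  tensorUnit := ⟨𝟙_ D, 𝟙 _, Category.comp_id _⟩
  associator P Q R := karIso (α_ P.X Q.X R.X) (associator_naturality _ _ _)
  leftUnitor P := karIso (λ_ P.X) (by simp)
  rightUnitor P := karIso (ρ_ P.X) (by simp)

lemma kar_tensor_karHom {P Q P' Q' : Karoubi D} {e : P.X ⟶ Q.X} (h : P.p ≫ e = e ≫ Q.p)
    {e' : P'.X ⟶ Q'.X} (h' : P'.p ≫ e' = e' ≫ Q'.p) :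
    karHom e h ⊗ₘ karHom e' h' =
      karHom (P := P ⊗ P') (Q := Q ⊗ Q') (e ⊗ₘ e') (by
        change (P.p ⊗ₘ P'.p) ≫ _ = _ ≫ (Q.p ⊗ₘ Q'.p)
        rw [tensorHom_comp_tensorHom, h, h', tensorHom_comp_tensorHom]) :=
  Karoubi.hom_ext _ _ (tensorHom_comp_tensorHom _ _ _ _).symm

lemma kar_whiskerRight_eq {P Q : Karoubi D} (f : P ⟶ Q) (R : Karoubi D) :
    f ▷ R = f ⊗ₘ 𝟙 R := rfl

lemma kar_whiskerLeft_eq {P Q : Karoubi D} (f : P ⟶ Q) (R : Karoubi D) :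
    R ◁ f = 𝟙 R ⊗ₘ f := rfl

lemma kar_assoc_eq (P Q R : Karoubi D) : (α_ P Q R).hom =
    karHom (P := (P ⊗ Q) ⊗ R) (Q := P ⊗ Q ⊗ R) (α_ P.X Q.X R.X).hom
      (associator_naturality _ _ _) := rfl

lemma kar_assoc_inv_eq (P Q R : Karoubi D) : (α_ P Q R).inv =
    karHom (P := P ⊗ Q ⊗ R) (Q := (P ⊗ Q) ⊗ R) (α_ P.X Q.X R.X).inv
      (associator_inv_naturality _ _ _) := rfl

lemma kar_left_eq (P : Karoubi D) : (λ_ P).hom =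
    karHom (P := 𝟙_ (Karoubi D) ⊗ P) (Q := P) (λ_ P.X).hom
      (by change (𝟙 (𝟙_ D) ⊗ₘ P.p) ≫ _ = _; simp) := rfl

lemma kar_right_eq (P : Karoubi D) : (ρ_ P).hom =
    karHom (P := P ⊗ 𝟙_ (Karoubi D)) (Q := P) (ρ_ P.X).hom
      (by change (P.p ⊗ₘ 𝟙 (𝟙_ D)) ≫ _ = _; simp) := rfl

@[simp] lemma kar_tensorObj_X (P Q : Karoubi D) : (P ⊗ Q).X = P.X ⊗ Q.X := rfl
@[simp] lemma kar_tensorObj_p (P Q : Karoubi D) : (P ⊗ Q).p = P.p ⊗ₘ Q.p := rfl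
@[simp] lemma kar_tensorHom_f {P P' Q Q' : Karoubi D} (f : P ⟶ P') (g : Q ⟶ Q') :
    (f ⊗ₘ g).f = f.f ⊗ₘ g.f := rfl
@[simp] lemma kar_whiskerLeft_f (P : Karoubi D) {Q Q' : Karoubi D} (g : Q ⟶ Q') :
    (P ◁ g).f = P.p ⊗ₘ g.f := rfl
@[simp] lemma kar_whiskerRight_f {P P' : Karoubi D} (f : P ⟶ P') (Q : Karoubi D) :
    (f ▷ Q).f = f.f ⊗ₘ Q.p := rfl
@[simp] lemma kar_unit_X : (𝟙_ (Karoubi D)).X = 𝟙_ D := rfl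
@[simp] lemma kar_unit_p : (𝟙_ (Karoubi D)).p = 𝟙 (𝟙_ D) := rfl
@[simp] lemma kar_assoc_hom (P Q R : Karoubi D) :
    (α_ P Q R).hom.f = ((P.p ⊗ₘ Q.p) ⊗ₘ R.p) ≫ (α_ P.X Q.X R.X).hom := rfl
@[simp] lemma kar_assoc_inv (P Q R : Karoubi D) :
    (α_ P Q R).inv.f = (P.p ⊗ₘ (Q.p ⊗ₘ R.p)) ≫ (α_ P.X Q.X R.X).inv := rfl
@[simp] lemma kar_left_hom (P : Karoubi D) :
    (λ_ P).hom.f = (𝟙 (𝟙_ D) ⊗ₘ P.p) ≫ (λ_ P.X).hom := rfl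
@[simp] lemma kar_right_hom (P : Karoubi D) :
    (ρ_ P).hom.f = (P.p ⊗ₘ 𝟙 (𝟙_ D)) ≫ (ρ_ P.X).hom := rfl

instance karoubiMonoidal : MonoidalCategory (Karoubi D) :=
  MonoidalCategory.ofTensorHom
    (id_tensorHom_id := fun _ _ => rfl)
    (id_tensorHom := fun _ _ _ _ => rfl)
    (tensorHom_id := fun _ _ => rfl)
    (tensorHom_comp_tensorHom := fun f₁ f₂ g₁ g₂ =>
      Karoubi.hom_ext _ _ (tensorHom_comp_tensorHom f₁.f f₂.f g₁.f g₂.f))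
    (associator_naturality := fun f g h => Karoubi.hom_ext _ _ (by
      have := f.comm
      simp only [Karoubi.comp_f, kar_tensorHom_f, kar_assoc_hom]
      rw [← Category.assoc, tensorHom_comp_tensorHom, tensorHom_comp_tensorHom, Karoubi.comp_p,
        Karoubi.comp_p, Karoubi.comp_p, Category.assoc, ← associator_naturality,
        ← Category.assoc, tensorHom_comp_tensorHom, tensorHom_comp_tensorHom, Karoubi.p_comp,
        Karoubi.p_comp, Karoubi.p_comp]))
    (leftUnitor_naturality := fun f => Karoubi.hom_ext _ _ (by simp))
    (rightUnitor_naturality := fun f => Karoubi.hom_ext _ _ (by simp))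
    (pentagon := fun W X Y Z => by
      simp only [karHom_id, kar_assoc_eq, kar_tensor_karHom, karHom_comp]
      exact karHom_congr _ _ (by simp))
    (triangle := fun X Y => by
      simp only [karHom_id, kar_assoc_eq, kar_left_eq, kar_right_eq, kar_tensor_karHom, karHom_comp]
      exact karHom_congr _ _ (by simp))

instance karoubiMonoidalPreadditive [Preadditive D] [MonoidalPreadditive D] :
    MonoidalPreadditive (Karoubi D) where
  whiskerLeft_zero := Karoubi.hom_ext _ _ (MonoidalPreadditive.tensor_zero _)
  zero_whiskerRight := Karoubi.hom_ext _ _ (MonoidalPreadditive.zero_tensor _)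
  whiskerLeft_add f g := Karoubi.hom_ext _ _ (MonoidalPreadditive.tensor_add _ f.f g.f)
  add_whiskerRight f g := Karoubi.hom_ext _ _ (MonoidalPreadditive.add_tensor f.f g.f _)

instance karoubiMonoidalLinear [Preadditive D] [Linear ℂ D] [MonoidalPreadditive D]
    [MonoidalLinear ℂ D] : MonoidalLinear ℂ (Karoubi D) where
  whiskerLeft_smul P _ _ r f := Karoubi.hom_ext _ _ (by
    have : P.p ⊗ₘ (r • f.f) = r • (P.p ⊗ₘ f.f) := by simp [MonoidalCategory.tensorHom_def]
    exact this)
  smul_whiskerRight r _ _ f P := Karoubi.hom_ext _ _ (by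
    have : (r • f.f) ⊗ₘ P.p = r • (f.f ⊗ₘ P.p) := by simp [MonoidalCategory.tensorHom_def]
    exact this)

instance karoubiBraided [BraidedCategory D] : BraidedCategory (Karoubi D) :=
  let b : ∀ P Q : Karoubi D, P ⊗ Q ≅ Q ⊗ P := fun P Q =>
    karIso (P := P ⊗ Q) (Q := Q ⊗ P) (β_ P.X Q.X) (BraidedCategory.braiding_naturality _ _)
  have hb : ∀ P Q, (b P Q).hom = karHom (P := P ⊗ Q) (Q := Q ⊗ P) (β_ P.X Q.X).hom
    (BraidedCategory.braiding_naturality _ _) := fun _ _ => rfl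
  { braiding := b
    braiding_naturality_right := fun P _ _ f => Karoubi.hom_ext _ _ (by
      change (P.p ⊗ₘ f.f) ≫ (_ ⊗ₘ _) ≫ (β_ _ _).hom = ((_ ⊗ₘ _) ≫ (β_ _ _).hom) ≫ (f.f ⊗ₘ P.p)
      rw [Category.assoc, ← BraidedCategory.braiding_naturality, tensorHom_comp_tensorHom_assoc,
        tensorHom_comp_tensorHom_assoc, Karoubi.p_comp, Karoubi.comp_p])
    braiding_naturality_left := fun f P => Karoubi.hom_ext _ _ (by
      change (f.f ⊗ₘ P.p) ≫ (_ ⊗ₘ _) ≫ (β_ _ _).hom = ((_ ⊗ₘ _) ≫ (β_ _ _).hom) ≫ (P.p ⊗ₘ f.f)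
      rw [Category.assoc, ← BraidedCategory.braiding_naturality, tensorHom_comp_tensorHom_assoc,
        tensorHom_comp_tensorHom_assoc, Karoubi.p_comp, Karoubi.comp_p])
    hexagon_forward := fun X Y Z => by
      simp only [kar_whiskerRight_eq, kar_whiskerLeft_eq, hb, karHom_id, kar_assoc_eq,
        kar_tensor_karHom, karHom_comp]
      exact karHom_congr _ _ (by simp)
    hexagon_reverse := fun X Y Z => by
      simp only [kar_whiskerRight_eq, kar_whiskerLeft_eq, hb, karHom_id, kar_assoc_inv_eq,
        kar_tensor_karHom, karHom_comp]
      exact karHom_congr _ _ (by simp) }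

lemma kar_braiding_eq [BraidedCategory D] (P Q : Karoubi D) : (β_ P Q).hom =
    karHom (P := P ⊗ Q) (Q := Q ⊗ P) (β_ P.X Q.X).hom
      (BraidedCategory.braiding_naturality _ _) := rfl

instance karoubiSymmetric [SymmetricCategory D] : SymmetricCategory (Karoubi D) where
  symmetry X Y := by
    rw [kar_braiding_eq, kar_braiding_eq, karHom_comp, karHom_id]
    exact karHom_congr _ _ (SymmetricCategory.symmetry _ _)

instance toKaroubiLinear [Preadditive D] [Linear ℂ D] : (toKaroubi D).Linear ℂ where
  map_smul _ _ := rfl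

/-- The structure constraints of the embedding are identities. -/
instance toKaroubiBraided [BraidedCategory D] : (toKaroubi D).Braided where
  toMonoidal := Functor.CoreMonoidal.toMonoidal
    { εIso := karIso (P := 𝟙_ (Karoubi D)) (Q := (toKaroubi D).obj (𝟙_ D)) (Iso.refl _) rfl
      μIso := fun X Y => karIso (P := (toKaroubi D).obj X ⊗ (toKaroubi D).obj Y)
        (Q := (toKaroubi D).obj (X ⊗ Y)) (Iso.refl _) (by simp)
      μIso_hom_natural_left := fun f X => Karoubi.hom_ext _ _ (by simp)
      μIso_hom_natural_right := fun f X => Karoubi.hom_ext _ _ (by simp)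
      associativity := fun X Y Z => Karoubi.hom_ext _ _ (by simp)
      left_unitality := fun X => Karoubi.hom_ext _ _ (by simp)
      right_unitality := fun X => Karoubi.hom_ext _ _ (by simp) }
  braided X Y := Karoubi.hom_ext _ _ (by
    change ((𝟙 X ⊗ₘ 𝟙 Y) ≫ 𝟙 _) ≫ (β_ X Y).hom = ((𝟙 X ⊗ₘ 𝟙 Y) ≫ (β_ X Y).hom) ≫
      ((𝟙 Y ⊗ₘ 𝟙 X) ≫ 𝟙 _)
    simp)
end Karoubi
end KarEnv


namespace KarEnv
section Mat
variable {D : Type u} [Category.{v} D] [Preadditive D]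

/-- The matrix with the given entries, as a morphism. -/
def mkMat {M N : Mat_ D} (m : ∀ (i : M.ι) (j : N.ι), M.X i ⟶ N.X j) : M ⟶ N := m

/-- The entries of a morphism. -/
def entry {M N : Mat_ D} (f : M ⟶ N) (i : M.ι) (j : N.ι) : M.X i ⟶ N.X j := f i j

@[simp] lemma entry_mkMat {M N : Mat_ D} (m : ∀ (i : M.ι) (j : N.ι), M.X i ⟶ N.X j) (i j) :
    entry (mkMat m) i j = m i j := rfl

lemma mat_ext {M N : Mat_ D} {f g : M ⟶ N} (h : ∀ i j, entry f i j = entry g i j) : f = g :=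
  Mat_.hom_ext _ _ h

lemma entry_comp {M N K : Mat_ D} (f : M ⟶ N) (g : N ⟶ K) (i k) :
    entry (f ≫ g) i k = ∑ j, entry f i j ≫ entry g j k := rfl

lemma entry_id_self (M : Mat_ D) (i : M.ι) : entry (𝟙 M) i i = 𝟙 (M.X i) :=
  Mat_.id_apply_self M i

lemma entry_id_ne (M : Mat_ D) {i j : M.ι} (h : i ≠ j) : entry (𝟙 M) i j = 0 :=
  Mat_.id_apply_of_ne M i j h

lemma entry_add {M N : Mat_ D} (f g : M ⟶ N) (i j) :
    entry (f + g) i j = entry f i j + entry g i j := rfl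

lemma entry_zero {M N : Mat_ D} (i : M.ι) (j : N.ι) : entry (0 : M ⟶ N) i j = 0 := rfl

instance matLinear [Linear ℂ D] : Linear ℂ (Mat_ D) where
  homModule M N := inferInstanceAs (Module ℂ (∀ i j, M.X i ⟶ N.X j))
  smul_comp _ _ _ r f g := mat_ext fun i k => by
    have : (∑ j, (r • entry f i j) ≫ entry g j k) = r • ∑ j, entry f i j ≫ entry g j k := by
      rw [Finset.smul_sum]; simp
    exact this
  comp_smul _ _ _ f r g := mat_ext fun i k => by
    have : (∑ j, entry f i j ≫ (r • entry g j k)) = r • ∑ j, entry f i j ≫ entry g j k := by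
      rw [Finset.smul_sum]; simp
    exact this

lemma entry_smul [Linear ℂ D] {M N : Mat_ D} (r : ℂ) (f : M ⟶ N) (i j) :
    entry (r • f) i j = r • entry f i j := rfl

open scoped Classical in
/-- The generalized permutation matrix of a map `e` of index sets, with entries `φ`. -/
def permMat {M N : Mat_ D} (e : M.ι → N.ι) (φ : ∀ i, M.X i ⟶ N.X (e i)) : M ⟶ N :=
  mkMat fun i j => if h : e i = j then φ i ≫ eqToHom (congrArg N.X h) else 0

lemma permMat_self {M N : Mat_ D} (e : M.ι → N.ι) (φ : ∀ i, M.X i ⟶ N.X (e i)) (i : M.ι) :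
    entry (permMat e φ) i (e i) = φ i := by
  simp [permMat]

lemma permMat_ne {M N : Mat_ D} (e : M.ι → N.ι) (φ : ∀ i, M.X i ⟶ N.X (e i)) {i : M.ι} {j : N.ι}
    (h : e i ≠ j) : entry (permMat e φ) i j = 0 := by
  simp [permMat, h]

lemma permMat_comp {M N K : Mat_ D} (e : M.ι → N.ι) (φ : ∀ i, M.X i ⟶ N.X (e i)) (f : N ⟶ K)
    (i : M.ι) (k : K.ι) : entry (permMat e φ ≫ f) i k = φ i ≫ entry f (e i) k := by
  classical
  rw [entry_comp, Finset.sum_eq_single (e i)]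
  · rw [permMat_self]
  · intro j _ hj
    rw [permMat_ne e φ (Ne.symm hj), zero_comp]
  · simp

lemma comp_permMat {M N K : Mat_ D} (f : M ⟶ N) (e : N.ι → K.ι) (φ : ∀ i, N.X i ⟶ K.X (e i))
    (he : Function.Injective e) (i : M.ι) (j : N.ι) :
    entry (f ≫ permMat e φ) i (e j) = entry f i j ≫ φ j := by
  classical
  rw [entry_comp, Finset.sum_eq_single j]
  · rw [permMat_self]
  · intro j' _ hj
    rw [permMat_ne _ _ (he.ne hj), comp_zero]
  · simp

lemma eq_permMat {M N : Mat_ D} (f : M ⟶ N) (e : M.ι → N.ι) (φ : ∀ i, M.X i ⟶ N.X (e i))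
    (h : ∀ i, entry f i (e i) = φ i) (h0 : ∀ i j, e i ≠ j → entry f i j = 0) :
    f = permMat e φ :=
  mat_ext fun i j => by
    by_cases hij : e i = j
    · subst hij; rw [h, permMat_self]
    · rw [h0 _ _ hij, permMat_ne _ _ hij]

lemma permMat_comp_permMat {M N K : Mat_ D} (e : M.ι → N.ι) (φ : ∀ i, M.X i ⟶ N.X (e i))
    (e' : N.ι → K.ι) (φ' : ∀ i, N.X i ⟶ K.X (e' i)) :
    permMat e φ ≫ permMat e' φ' =
      permMat (M := M) (N := K) (fun i => e' (e i)) (fun i => φ i ≫ φ' (e i)) :=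
  eq_permMat _ _ _
    (fun i => by rw [permMat_comp, permMat_self])
    (fun i j h => by rw [permMat_comp, permMat_ne _ _ h, comp_zero])

lemma permMat_id (M : Mat_ D) :
    𝟙 M = permMat (M := M) (N := M) (fun i => i) (fun i => 𝟙 (M.X i)) :=
  eq_permMat _ _ _ (fun i => entry_id_self M i) (fun _ _ h => entry_id_ne M h)

lemma permMat_congr {M N : Mat_ D} {e : M.ι → N.ι} {φ φ' : ∀ i, M.X i ⟶ N.X (e i)}
    (h : ∀ i, φ i = φ' i) : permMat e φ = permMat e φ' := by
  rw [funext h]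

/-- The isomorphism given by mutually inverse generalized permutation matrices. -/
abbrev permMatIso {M N : Mat_ D} (e : M.ι → N.ι) (e' : N.ι → M.ι) (h : ∀ i, e' (e i) = i)
    (h' : ∀ j, e (e' j) = j) (φ : ∀ i, M.X i ⟶ N.X (e i)) (ψ : ∀ j, N.X j ⟶ M.X (e' j))
    (w : ∀ i, φ i ≫ ψ (e i) = eqToHom (congrArg M.X (h i).symm))
    (w' : ∀ j, ψ j ≫ φ (e' j) = eqToHom (congrArg N.X (h' j).symm)) : M ≅ N where
  hom := permMat e φ
  inv := permMat e' ψ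
  hom_inv_id := by
    rw [permMat_comp_permMat]
    refine (eq_permMat _ _ _ (fun i => ?_) (fun i j hij => ?_)).symm
    · rw [w]
      exact (Mat_.id_apply M i (e' (e i))).trans (dif_pos (h i).symm)
    · exact entry_id_ne M (fun hh => hij ((h i).trans hh))
  inv_hom_id := by
    rw [permMat_comp_permMat]
    refine (eq_permMat _ _ _ (fun i => ?_) (fun i j hij => ?_)).symm
    · rw [w']
      exact (Mat_.id_apply N i (e (e' i))).trans (dif_pos (h' i).symm)
    · exact entry_id_ne N (fun hh => hij ((h' i).trans hh))

variable [MonoidalCategory D]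

/-- The tensor product of two finite families, indexed by the product of the index sets. -/
abbrev matTensorObj (M N : Mat_ D) : Mat_ D := ⟨M.ι × N.ι, fun p => M.X p.1 ⊗ N.X p.2⟩

/-- The unit object of `D` as a one-element family. -/
abbrev matUnit : Mat_ D := ⟨PUnit, fun _ => 𝟙_ D⟩

/-- The Kronecker product of matrices. -/
def matTensorHom {M M' N N' : Mat_ D} (f : M ⟶ M') (g : N ⟶ N') :
    matTensorObj M N ⟶ matTensorObj M' N' :=
  mkMat fun p q => entry f p.1 q.1 ⊗ₘ entry g p.2 q.2

lemma entry_matTensorHom {M M' N N' : Mat_ D} (f : M ⟶ M') (g : N ⟶ N') (p q) :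
    entry (matTensorHom f g) p q = entry f p.1 q.1 ⊗ₘ entry g p.2 q.2 := rfl

/-- The associator, entrywise given by that of `D`. -/
def matAssoc (P Q R : Mat_ D) :
    matTensorObj (matTensorObj P Q) R ≅ matTensorObj P (matTensorObj Q R) :=
  permMatIso (fun i => (i.1.1, (i.1.2, i.2))) (fun i => ((i.1, i.2.1), i.2.2))
    (fun _ => rfl) (fun _ => rfl)
    (fun i => (α_ (P.X i.1.1) (Q.X i.1.2) (R.X i.2)).hom)
    (fun i => (α_ (P.X i.1) (Q.X i.2.1) (R.X i.2.2)).inv)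
    (fun i => by simp) (fun i => by simp)

/-- The left unitor, entrywise given by that of `D`. -/
def matLeft (P : Mat_ D) : matTensorObj matUnit P ≅ P :=
  permMatIso (fun i => i.2) (fun i => (PUnit.unit, i)) (fun _ => rfl) (fun _ => rfl)
    (fun i => (λ_ (P.X i.2)).hom) (fun i => (λ_ (P.X i)).inv)
    (fun i => by simp) (fun i => by simp)

/-- The right unitor, entrywise given by that of `D`. -/
def matRight (P : Mat_ D) : matTensorObj P matUnit ≅ P :=
  permMatIso (fun i => i.1) (fun i => (i, PUnit.unit)) (fun _ => rfl) (fun _ => rfl)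
    (fun i => (ρ_ (P.X i.1)).hom) (fun i => (ρ_ (P.X i)).inv)
    (fun i => by simp) (fun i => by simp)

/-- The braiding, entrywise given by that of `D`. -/
def matBraid [BraidedCategory D] (P Q : Mat_ D) : matTensorObj P Q ≅ matTensorObj Q P :=
  permMatIso (fun i => (i.2, i.1)) (fun i => (i.2, i.1)) (fun _ => rfl) (fun _ => rfl)
    (fun i => (β_ (P.X i.1) (Q.X i.2)).hom) (fun i => (β_ (P.X i.2) (Q.X i.1)).inv)
    (fun i => by simp) (fun i => by simp)

variable [MonoidalPreadditive D]

lemma matTensor_permMat {M M' N N' : Mat_ D} (e : M.ι → M'.ι) (φ : ∀ i, M.X i ⟶ M'.X (e i))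
    (e' : N.ι → N'.ι) (φ' : ∀ i, N.X i ⟶ N'.X (e' i)) :
    matTensorHom (permMat e φ) (permMat e' φ') =
      permMat (M := matTensorObj M N) (N := matTensorObj M' N') (fun p => (e p.1, e' p.2))
        (fun p => φ p.1 ⊗ₘ φ' p.2) :=
  eq_permMat _ _ _ (fun p => by
    rw [entry_matTensorHom, permMat_self, permMat_self]) (fun p q h => by
    rw [entry_matTensorHom]
    by_cases h1 : e p.1 = q.1
    · have h2 : e' p.2 ≠ q.2 := fun h2 => h (Prod.ext h1 h2)
      rw [permMat_ne e' φ' h2, MonoidalPreadditive.tensor_zero]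
    · rw [permMat_ne e φ h1, MonoidalPreadditive.zero_tensor])

lemma matTensor_id (M N : Mat_ D) : matTensorHom (𝟙 M) (𝟙 N) = 𝟙 (matTensorObj M N) := by
  rw [permMat_id, permMat_id, permMat_id, matTensor_permMat]
  exact permMat_congr (fun i => id_tensorHom_id _ _)

lemma matTensor_comp {M M' M'' N N' N'' : Mat_ D} (f : M ⟶ M') (g : N ⟶ N')
    (f' : M' ⟶ M'') (g' : N' ⟶ N'') :
    matTensorHom f g ≫ matTensorHom f' g' = matTensorHom (f ≫ f') (g ≫ g') :=
  mat_ext fun p q => by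
    simp only [entry_comp, entry_matTensorHom]
    rw [sum_tensor, Fintype.sum_prod_type]
    refine Finset.sum_congr rfl fun r _ => ?_
    rw [tensor_sum]
    refine Finset.sum_congr rfl fun r _ => ?_
    rw [tensorHom_comp_tensorHom]

lemma matAssoc_naturality {P P' Q Q' R R' : Mat_ D} (f : P ⟶ P') (g : Q ⟶ Q') (h : R ⟶ R') :
    matTensorHom (matTensorHom f g) h ≫ (matAssoc P' Q' R').hom =
      (matAssoc P Q R).hom ≫ matTensorHom f (matTensorHom g h) :=
  mat_ext fun p q => by
    dsimp only [matAssoc]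
    rw [permMat_comp]
    exact (comp_permMat (N := matTensorObj (matTensorObj P' Q') R')
      (K := matTensorObj P' (matTensorObj Q' R')) _ (fun i => (i.1.1, (i.1.2, i.2))) _
      (fun _ _ h => by
        simp only [Prod.mk.injEq] at h
        exact Prod.ext (Prod.ext h.1 h.2.1) h.2.2) p ((q.1, q.2.1), q.2.2)).trans
      (associator_naturality _ _ _)

lemma matLeft_naturality {P P' : Mat_ D} (f : P ⟶ P') :
    matTensorHom (𝟙 matUnit) f ≫ (matLeft P').hom = (matLeft P).hom ≫ f :=
  mat_ext fun p q => by
    dsimp only [matLeft]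
    rw [permMat_comp]
    refine (comp_permMat (N := matTensorObj matUnit P') (K := P') _ (fun i => i.2) _
      (fun _ _ h => Prod.ext rfl h) p (PUnit.unit, q)).trans ?_
    rw [entry_matTensorHom, entry_id_self, id_tensorHom, leftUnitor_naturality]

lemma matRight_naturality {P P' : Mat_ D} (f : P ⟶ P') :
    matTensorHom f (𝟙 matUnit) ≫ (matRight P').hom = (matRight P).hom ≫ f :=
  mat_ext fun p q => by
    dsimp only [matRight]
    rw [permMat_comp]
    refine (comp_permMat (N := matTensorObj P' matUnit) (K := P') _ (fun i => i.1) _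
      (fun _ _ h => Prod.ext h rfl) p (q, PUnit.unit)).trans ?_
    rw [entry_matTensorHom, entry_id_self, tensorHom_id, rightUnitor_naturality]

lemma mat_pentagon (W X Y Z : Mat_ D) :
    matTensorHom (matAssoc W X Y).hom (𝟙 Z) ≫ (matAssoc W (matTensorObj X Y) Z).hom ≫
      matTensorHom (𝟙 W) (matAssoc X Y Z).hom =
    (matAssoc (matTensorObj W X) Y Z).hom ≫ (matAssoc W X (matTensorObj Y Z)).hom := by
  simp only [matAssoc, permMatIso, permMat_id, matTensor_permMat, permMat_comp_permMat]
  exact permMat_congr (fun i => by simp)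

lemma mat_triangle (X Y : Mat_ D) :
    (matAssoc X matUnit Y).hom ≫ matTensorHom (𝟙 X) (matLeft Y).hom =
      matTensorHom (matRight X).hom (𝟙 Y) := by
  simp only [matAssoc, matLeft, matRight, permMatIso, permMat_id, matTensor_permMat,
    permMat_comp_permMat]
  exact permMat_congr (fun i => by simp)

instance matMonoidalStruct : MonoidalCategoryStruct (Mat_ D) where
  tensorObj := matTensorObj
  tensorHom := matTensorHom
  whiskerLeft P _ _ f := matTensorHom (𝟙 P) f
  whiskerRight f Q := matTensorHom f (𝟙 Q)
  tensorUnit := matUnit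
  associator := matAssoc
  leftUnitor := matLeft
  rightUnitor := matRight

instance matMonoidal : MonoidalCategory (Mat_ D) :=
  MonoidalCategory.ofTensorHom
    (id_tensorHom_id := matTensor_id)
    (id_tensorHom := fun _ _ _ _ => rfl)
    (tensorHom_id := fun _ _ => rfl)
    (tensorHom_comp_tensorHom := matTensor_comp)
    (associator_naturality := matAssoc_naturality)
    (leftUnitor_naturality := matLeft_naturality)
    (rightUnitor_naturality := matRight_naturality)
    (pentagon := mat_pentagon)
    (triangle := mat_triangle)

instance matMonoidalPreadditive : MonoidalPreadditive (Mat_ D) where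
  whiskerLeft_zero := mat_ext fun _ _ => MonoidalPreadditive.tensor_zero _
  zero_whiskerRight := mat_ext fun _ _ => MonoidalPreadditive.zero_tensor _
  whiskerLeft_add _ _ := mat_ext fun _ _ => MonoidalPreadditive.tensor_add _ _ _
  add_whiskerRight _ _ := mat_ext fun _ _ => MonoidalPreadditive.add_tensor _ _ _

lemma tensor_smul' [Linear ℂ D] [MonoidalLinear ℂ D] {X Y X' Y' : D} (f : X ⟶ Y) (r : ℂ)
    (g : X' ⟶ Y') : f ⊗ₘ (r • g) = r • (f ⊗ₘ g) := by
  simp [MonoidalCategory.tensorHom_def]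

lemma smul_tensor' [Linear ℂ D] [MonoidalLinear ℂ D] {X Y X' Y' : D} (f : X ⟶ Y) (r : ℂ)
    (g : X' ⟶ Y') : (r • f) ⊗ₘ g = r • (f ⊗ₘ g) := by
  simp [MonoidalCategory.tensorHom_def]

instance matMonoidalLinear [Linear ℂ D] [MonoidalLinear ℂ D] : MonoidalLinear ℂ (Mat_ D) where
  whiskerLeft_smul _ _ _ _ _ := mat_ext fun _ _ => tensor_smul' _ _ _
  smul_whiskerRight _ _ _ _ _ := mat_ext fun _ _ => smul_tensor' _ _ _

lemma matBraid_naturality [BraidedCategory D] {P P' Q Q' : Mat_ D} (f : P ⟶ P') (g : Q ⟶ Q') :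
    matTensorHom f g ≫ (matBraid P' Q').hom = (matBraid P Q).hom ≫ matTensorHom g f :=
  mat_ext fun p q => by
    dsimp only [matBraid]
    rw [permMat_comp]
    exact (comp_permMat (N := matTensorObj P' Q') (K := matTensorObj Q' P') _
      (fun i => (i.2, i.1)) _ (fun _ _ h => by
        simp only [Prod.mk.injEq] at h
        exact Prod.ext h.2 h.1) p (q.2, q.1)).trans
      (BraidedCategory.braiding_naturality _ _)

lemma mat_hexagon_forward [BraidedCategory D] (X Y Z : Mat_ D) :
    (matAssoc X Y Z).hom ≫ (matBraid X (matTensorObj Y Z)).hom ≫ (matAssoc Y Z X).hom =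
      matTensorHom (matBraid X Y).hom (𝟙 Z) ≫ (matAssoc Y X Z).hom ≫
        matTensorHom (𝟙 Y) (matBraid X Z).hom := by
  simp only [matAssoc, matBraid, permMatIso, permMat_id, matTensor_permMat, permMat_comp_permMat]
  exact permMat_congr (fun i => by simp)

lemma mat_hexagon_reverse [BraidedCategory D] (X Y Z : Mat_ D) :
    (matAssoc X Y Z).inv ≫ (matBraid (matTensorObj X Y) Z).hom ≫ (matAssoc Z X Y).inv =
      matTensorHom (𝟙 X) (matBraid Y Z).hom ≫ (matAssoc X Z Y).inv ≫
        matTensorHom (matBraid X Z).hom (𝟙 Y) := by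
  simp only [matAssoc, matBraid, permMatIso, permMat_id, matTensor_permMat,
    permMat_comp_permMat]
  exact permMat_congr (fun i => by simp)

instance matBraided [BraidedCategory D] : BraidedCategory (Mat_ D) where
  braiding := matBraid
  braiding_naturality_right _ _ _ _ := matBraid_naturality _ _
  braiding_naturality_left _ _ := matBraid_naturality _ _
  hexagon_forward := mat_hexagon_forward
  hexagon_reverse := mat_hexagon_reverse

lemma mat_symmetry [SymmetricCategory D] (X Y : Mat_ D) :
    (matBraid X Y).hom ≫ (matBraid Y X).hom = 𝟙 (matTensorObj X Y) := by
  simp only [matBraid, permMatIso, permMat_id, permMat_comp_permMat]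
  exact permMat_congr (fun i => SymmetricCategory.symmetry _ _)

instance matSymmetric [SymmetricCategory D] : SymmetricCategory (Mat_ D) where
  symmetry := mat_symmetry

instance matEmbeddingLinear [Linear ℂ D] : (Mat_.embedding D).Linear ℂ where
  map_smul _ _ := rfl

/-- A one-element family. -/
abbrev matOne (X : D) : Mat_ D := ⟨PUnit, fun _ => X⟩

/-- A one-by-one matrix. -/
def matOneMap {X Y : D} (f : X ⟶ Y) : matOne X ⟶ matOne Y := mkMat fun _ _ => f

lemma matOneMap_eq {X Y : D} (f : X ⟶ Y) : matOneMap f =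
    permMat (M := matOne X) (N := matOne Y) (fun i => i) (fun _ => f) :=
  eq_permMat _ _ _ (fun _ => rfl) (fun _ _ h => (h rfl).elim)

/-- The tensor product of two one-element families is a one-element family. -/
def matOneμ (X Y : D) : matTensorObj (matOne X) (matOne Y) ≅ matOne (X ⊗ Y) :=
  permMatIso (fun _ => PUnit.unit) (fun _ => (PUnit.unit, PUnit.unit)) (fun _ => rfl)
    (fun _ => rfl) (fun _ => 𝟙 _) (fun _ => 𝟙 _) (fun _ => by simp) (fun _ => by simp)

lemma matOneμ_natural_left {X Y : D} (f : X ⟶ Y) (Z : D) :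
    matTensorHom (matOneMap f) (𝟙 (matOne Z)) ≫ (matOneμ Y Z).hom =
      (matOneμ X Z).hom ≫ matOneMap (f ▷ Z) := by
  simp only [matOneMap_eq, matOneμ, permMat_id, matTensor_permMat, permMat_comp_permMat]
  exact permMat_congr fun _ => by simp

lemma matOneμ_natural_right {X Y : D} (Z : D) (f : X ⟶ Y) :
    matTensorHom (𝟙 (matOne Z)) (matOneMap f) ≫ (matOneμ Z Y).hom =
      (matOneμ Z X).hom ≫ matOneMap (Z ◁ f) := by
  simp only [matOneMap_eq, matOneμ, permMat_id, matTensor_permMat, permMat_comp_permMat]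
  exact permMat_congr fun _ => by simp

lemma matOneμ_assoc (X Y Z : D) :
    matTensorHom (matOneμ X Y).hom (𝟙 (matOne Z)) ≫ (matOneμ (X ⊗ Y) Z).hom ≫
        matOneMap (α_ X Y Z).hom =
      (matAssoc (matOne X) (matOne Y) (matOne Z)).hom ≫
        matTensorHom (𝟙 (matOne X)) (matOneμ Y Z).hom ≫ (matOneμ X (Y ⊗ Z)).hom := by
  simp only [matOneMap_eq, matOneμ, matAssoc, permMat_id, matTensor_permMat,
    permMat_comp_permMat]
  exact permMat_congr fun _ => by simp

lemma matOneμ_left (X : D) :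
    (matLeft (matOne X)).hom =
      matTensorHom (𝟙 (matOne (𝟙_ D))) (𝟙 (matOne X)) ≫ (matOneμ (𝟙_ D) X).hom ≫
        matOneMap (λ_ X).hom := by
  simp only [matOneMap_eq, matOneμ, matLeft, permMat_id, matTensor_permMat,
    permMat_comp_permMat]
  exact permMat_congr fun _ => by simp

lemma matOneμ_right (X : D) :
    (matRight (matOne X)).hom =
      matTensorHom (𝟙 (matOne X)) (𝟙 (matOne (𝟙_ D))) ≫ (matOneμ X (𝟙_ D)).hom ≫
        matOneMap (ρ_ X).hom := by
  simp only [matOneMap_eq, matOneμ, matRight, permMat_id, matTensor_permMat,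
    permMat_comp_permMat]
  exact permMat_congr fun _ => by simp

lemma matOneμ_braided [BraidedCategory D] (X Y : D) :
    (matOneμ X Y).hom ≫ matOneMap (β_ X Y).hom =
      (matBraid (matOne X) (matOne Y)).hom ≫ (matOneμ Y X).hom := by
  simp only [matOneMap_eq, matOneμ, matBraid, permMat_comp_permMat]
  exact permMat_congr fun _ => by simp

/-- The embedding as one-element families is a braided monoidal functor. -/
instance matEmbeddingBraided [BraidedCategory D] : (Mat_.embedding D).Braided where
  toMonoidal := Functor.CoreMonoidal.toMonoidal
    { εIso := Iso.refl _
      μIso := matOneμ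
      μIso_hom_natural_left := matOneμ_natural_left
      μIso_hom_natural_right := matOneμ_natural_right
      associativity := matOneμ_assoc
      left_unitality := matOneμ_left
      right_unitality := matOneμ_right }
  braided := matOneμ_braided

end Mat
end KarEnv


namespace PartCat

/-- Every block of the partition has an even number of elements. -/
def IsEven {X : Type*} (p : Setoid X) : Prop := ∀ c ∈ p.classes, Even c.ncard

section Stack
variable {A B C E : Type*}

/-- The inclusions of the rows of a stack of two diagrams. -/
abbrev lowerPart : A ⊕ B → A ⊕ B ⊕ C := Sum.map id Sum.inl
/-- The inclusion of the middle and the last row. -/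
abbrev upperPart : B ⊕ C → A ⊕ B ⊕ C := Sum.inr
/-- The inclusion of the outer rows. -/
abbrev outerPart : A ⊕ C → A ⊕ B ⊕ C := Sum.map id Sum.inr

/-- The partition of all three rows that is generated by the blocks of `p` and those of `q`. -/
def stack (p : Setoid (A ⊕ B)) (q : Setoid (B ⊕ C)) : Setoid (A ⊕ B ⊕ C) :=
  Relation.EqvGen.setoid fun x y =>
    (∃ a b, p a b ∧ lowerPart a = x ∧ lowerPart b = y) ∨
    (∃ a b, q a b ∧ upperPart a = x ∧ upperPart b = y)

/-- The vertical concatenation `q ⋆ p`: restrict the stack to the two outer rows. -/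
def vcomp (p : Setoid (A ⊕ B)) (q : Setoid (B ⊕ C)) : Setoid (A ⊕ C) :=
  (stack p q).comap outerPart

/-- A component of the stack that lies entirely in the middle row. -/
abbrev Loop (p : Setoid (A ⊕ B)) (q : Setoid (B ⊕ C)) : Type _ :=
  {c : Quotient (stack p q) // ∀ x : A ⊕ C, c ≠ Quotient.mk _ (outerPart x)}

/-- The number of loops. -/
def loops (p : Setoid (A ⊕ B)) (q : Setoid (B ⊕ C)) : ℕ := Nat.card (Loop p q)

/-- The partition that joins each `a` to `e a`. -/
def ofEquiv (e : A ≃ B) : Setoid (A ⊕ B) := Setoid.ker (Sum.elim e id)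

/-- The disjoint union of two partitions. -/
def sumSetoid {X Y : Type*} (p : Setoid X) (q : Setoid Y) : Setoid (X ⊕ Y) where
  r := Sum.LiftRel p q
  iseqv :=
    ⟨fun x => by
      cases x with
      | inl x => exact Sum.LiftRel.inl (p.refl x)
      | inr x => exact Sum.LiftRel.inr (q.refl x),
     fun h => by
      cases h with
      | inl h => exact Sum.LiftRel.inl (p.symm h)
      | inr h => exact Sum.LiftRel.inr (q.symm h),
     fun h h' => by
      cases h with
      | inl h => cases h' with | inl h' => exact Sum.LiftRel.inl (p.trans h h')
      | inr h => cases h' with | inr h' => exact Sum.LiftRel.inr (q.trans h h')⟩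

/-- Two-valued labelings that are constant on blocks. -/
def Resp {X : Type*} (p : Setoid X) (f : X → Bool) : Prop := ∀ x y, p x y → f x = f y

lemma setoid_ext {X : Type*} {p q : Setoid X} (h : ∀ f, Resp p f ↔ Resp q f) : p = q := by
  classical
  have key : ∀ {p q : Setoid X}, (∀ f, Resp q f → Resp p f) → p ≤ q := by
    intro p q h x y hxy
    have := h (fun z => decide (q x z)) (fun a b hab => by
      simp only [decide_eq_decide]
      exact ⟨fun h => q.trans h hab, fun h => q.trans h (q.symm hab)⟩) x y hxy
    simpa [q.refl x] using this
  exact le_antisymm (key fun f => (h f).2) (key fun f => (h f).1)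

lemma resp_stack (p : Setoid (A ⊕ B)) (q : Setoid (B ⊕ C)) (i : A → Bool) (j : B → Bool)
    (k : C → Bool) :
    Resp (stack p q) (Sum.elim i (Sum.elim j k)) ↔
      Resp p (Sum.elim i j) ∧ Resp q (Sum.elim j k) := by
  constructor
  · intro h
    refine ⟨fun x y hxy => ?_, fun x y hxy => ?_⟩
    · have := h _ _ (Relation.EqvGen.rel _ _ (Or.inl ⟨x, y, hxy, rfl, rfl⟩))
      rcases x with x | x <;> rcases y with y | y <;> simpa using this
    · have := h _ _ (Relation.EqvGen.rel _ _ (Or.inr ⟨x, y, hxy, rfl, rfl⟩))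
      simpa using this
  · rintro ⟨h1, h2⟩ x y hxy
    induction hxy with
    | rel x y h =>
      rcases h with ⟨a, b, h, rfl, rfl⟩ | ⟨a, b, h, rfl, rfl⟩
      · have := h1 _ _ h
        rcases a with a | a <;> rcases b with b | b <;> simpa using this
      · simpa using h2 _ _ h
    | refl => rfl
    | symm _ _ _ ih => exact ih.symm
    | trans _ _ _ _ _ ih ih' => exact ih.trans ih'

/-- The middle labelings that are compatible with given outer labelings. -/
abbrev Mid (p : Setoid (A ⊕ B)) (q : Setoid (B ⊕ C)) (i : A → Bool) (k : C → Bool) : Type _ :=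
  {j : B → Bool // Resp p (Sum.elim i j) ∧ Resp q (Sum.elim j k)}

lemma resp_vcomp (p : Setoid (A ⊕ B)) (q : Setoid (B ⊕ C)) (i : A → Bool) (k : C → Bool) :
    Resp (vcomp p q) (Sum.elim i k) ↔ Nonempty (Mid p q i k) := by
  classical
  constructor
  · intro h
    let g : A ⊕ B ⊕ C → Bool := fun x =>
      if hx : ∃ y : A ⊕ C, stack p q x (outerPart y) then Sum.elim i k hx.choose else false
    have hg : Resp (stack p q) g := by
      intro x y hxy
      by_cases hx : ∃ z : A ⊕ C, stack p q x (outerPart z)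
      · have hy : ∃ z : A ⊕ C, stack p q y (outerPart z) :=
          ⟨hx.choose, (stack p q).trans ((stack p q).symm hxy) hx.choose_spec⟩
        simp only [g, dif_pos hx, dif_pos hy]
        exact h _ _ ((stack p q).trans ((stack p q).symm hx.choose_spec)
          ((stack p q).trans hxy hy.choose_spec))
      · have hy : ¬ ∃ z : A ⊕ C, stack p q y (outerPart z) := fun ⟨z, hz⟩ =>
          hx ⟨z, (stack p q).trans hxy hz⟩
        simp only [g, dif_neg hx, dif_neg hy]
    have ho : ∀ y : A ⊕ C, g (outerPart y) = Sum.elim i k y := by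
      intro y
      have hx : ∃ z : A ⊕ C, stack p q (outerPart y) (outerPart z) := ⟨y, (stack p q).refl _⟩
      simp only [g, dif_pos hx]
      exact h _ _ ((stack p q).symm hx.choose_spec)
    have e : g = Sum.elim i (Sum.elim (fun b => g (Sum.inr (Sum.inl b))) k) := by
      funext x
      rcases x with a | b | c
      · exact ho (Sum.inl a)
      · rfl
      · exact ho (Sum.inr c)
    rw [e] at hg
    exact ⟨⟨_, (resp_stack _ _ _ _ _).1 hg⟩⟩
  · rintro ⟨j, hj⟩ x y hxy
    have := (resp_stack _ _ _ _ _).2 hj _ _ hxy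
    rcases x with x | x <;> rcases y with y | y <;> simpa using this

lemma card_mid [Finite A] [Finite B] [Finite C] (p : Setoid (A ⊕ B)) (q : Setoid (B ⊕ C))
    (i : A → Bool) (k : C → Bool) (h : Resp (vcomp p q) (Sum.elim i k)) :
    Nat.card (Mid p q i k) = 2 ^ loops p q := by
  classical
  obtain ⟨j0, hj0⟩ := (resp_vcomp p q i k).1 h
  have h0 := (resp_stack _ _ _ _ _).2 hj0
  have e : Mid p q i k ≃ (Loop p q → Bool) :=
    { toFun := fun j c => Quotient.lift (s := stack p q) _ ((resp_stack _ _ _ _ _).2 j.2) c.1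
      invFun := fun u => by
        let g : A ⊕ B ⊕ C → Bool := fun x =>
          if hx : ∀ y : A ⊕ C, Quotient.mk (stack p q) x ≠ Quotient.mk _ (outerPart y)
          then u ⟨_, hx⟩ else Sum.elim i (Sum.elim j0 k) x
        refine ⟨fun b => g (Sum.inr (Sum.inl b)), ?_⟩
        have hg : Resp (stack p q) g := by
          intro x y hxy
          have e : Quotient.mk (stack p q) x = Quotient.mk (stack p q) y := Quotient.sound hxy
          simp only [g, e, h0 x y hxy]
        have ho : ∀ y : A ⊕ C, g (outerPart y) = Sum.elim i (Sum.elim j0 k) (outerPart y) := by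
          intro y
          exact dif_neg (fun h => h y rfl)
        rw [← resp_stack]
        convert hg using 1
        funext x
        rcases x with a | b | c
        · exact (ho (Sum.inl a)).symm
        · rfl
        · exact (ho (Sum.inr c)).symm
      left_inv := fun j => Subtype.ext (by
        funext b
        dsimp only
        split_ifs with hx
        · rfl
        · push Not at hx
          obtain ⟨y, hy⟩ := hx
          have hy' := Quotient.exact hy
          have a1 := (resp_stack _ _ _ _ _).2 j.2 _ _ hy'
          have a2 := h0 _ _ hy'
          rw [a2]
          change _ = Sum.elim i (Sum.elim j.1 k) (Sum.inr (Sum.inl b))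
          rw [a1]
          rcases y with y | y <;> rfl)
      right_inv := fun u => by
        funext ⟨c, hc⟩
        induction c using Quotient.inductionOn with
        | h x =>
          rcases x with a | b | c
          · exact (hc (Sum.inl a) rfl).elim
          · exact dif_pos hc
          · exact (hc (Sum.inr c) rfl).elim }
  rw [Nat.card_congr e, loops, Nat.card_fun]
  simp

lemma resp_const {X : Type*} (p : Setoid X) : Resp p (fun _ => true) := fun _ _ _ => rfl

lemma resp_const_sum (p : Setoid (A ⊕ B)) :
    Resp p (Sum.elim (fun _ => true) (fun _ => true)) := by
  convert resp_const p
  rename_i x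
  cases x <;> rfl

lemma loops_eq_zero [Finite A] [Finite B] [Finite C] (p : Setoid (A ⊕ B)) (q : Setoid (B ⊕ C))
    (h : Subsingleton (Mid p q (fun _ => true) (fun _ => true))) : loops p q = 0 := by
  have h1 := card_mid p q _ _ (resp_const_sum _)
  have h2 : Nat.card (Mid p q (fun _ => true) (fun _ => true)) ≤ 1 := Finite.card_le_one_iff_subsingleton.2 h
  by_contra h3
  have := Nat.one_lt_two_pow h3
  omega

lemma vcomp_assoc (p : Setoid (A ⊕ B)) (q : Setoid (B ⊕ C)) (r : Setoid (C ⊕ E)) :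
    vcomp (vcomp p q) r = vcomp p (vcomp q r) :=
  setoid_ext fun f => by
    rw [← Sum.elim_comp_inl_inr f, resp_vcomp, resp_vcomp]
    constructor
    · rintro ⟨k, hk, hr⟩
      obtain ⟨j, hp, hq⟩ := (resp_vcomp _ _ _ _).1 hk
      exact ⟨j, hp, (resp_vcomp _ _ _ _).2 ⟨k, hq, hr⟩⟩
    · rintro ⟨j, hp, hj⟩
      obtain ⟨k, hq, hr⟩ := (resp_vcomp _ _ _ _).1 hj
      exact ⟨k, (resp_vcomp _ _ _ _).2 ⟨j, hp, hq⟩, hr⟩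

lemma loops_assoc [Finite A] [Finite B] [Finite C] [Finite E]
    (p : Setoid (A ⊕ B)) (q : Setoid (B ⊕ C)) (r : Setoid (C ⊕ E)) :
    loops p q + loops (vcomp p q) r = loops q r + loops p (vcomp q r) := by
  let T := {x : (B → Bool) × (C → Bool) // Resp p (Sum.elim (fun _ => true) x.1) ∧
    Resp q (Sum.elim x.1 x.2) ∧ Resp r (Sum.elim x.2 (fun _ => true))}
  have e1 : T ≃ Σ k : Mid (vcomp p q) r (fun _ => true) (fun _ => true),
      Mid p q (fun _ => true) k.1 :=
    { toFun := fun x => ⟨⟨x.1.2, (resp_vcomp _ _ _ _).2 ⟨x.1.1, x.2.1, x.2.2.1⟩, x.2.2.2⟩,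
        ⟨x.1.1, x.2.1, x.2.2.1⟩⟩
      invFun := fun y => ⟨(y.2.1, y.1.1), y.2.2.1, y.2.2.2, y.1.2.2⟩
      left_inv := fun _ => rfl
      right_inv := fun _ => rfl }
  have e2 : T ≃ Σ j : Mid p (vcomp q r) (fun _ => true) (fun _ => true),
      Mid q r j.1 (fun _ => true) :=
    { toFun := fun x => ⟨⟨x.1.1, x.2.1, (resp_vcomp _ _ _ _).2 ⟨x.1.2, x.2.2.1, x.2.2.2⟩⟩,
        ⟨x.1.2, x.2.2.1, x.2.2.2⟩⟩
      invFun := fun y => ⟨(y.1.1, y.2.1), y.1.2.1, y.2.2.1, y.2.2.2⟩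
      left_inv := fun _ => rfl
      right_inv := fun _ => rfl }
  have h1 : Nat.card T = 2 ^ loops (vcomp p q) r * 2 ^ loops p q := by
    have := Fintype.ofFinite (Mid (vcomp p q) r (fun _ => true) (fun _ => true))
    rw [Nat.card_congr e1, Nat.card_sigma,
      ← card_mid (vcomp p q) r (fun _ => true) (fun _ => true) (resp_const_sum _)]
    rw [Finset.sum_congr rfl fun k _ => card_mid p q _ k.1 k.2.1]
    simp
  have h2 : Nat.card T = 2 ^ loops p (vcomp q r) * 2 ^ loops q r := by
    have := Fintype.ofFinite (Mid p (vcomp q r) (fun _ => true) (fun _ => true))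
    rw [Nat.card_congr e2, Nat.card_sigma,
      ← card_mid p (vcomp q r) (fun _ => true) (fun _ => true) (resp_const_sum _)]
    rw [Finset.sum_congr rfl fun k _ => card_mid q r k.1 _ k.2.2]
    simp
  rw [h1, ← pow_add, ← pow_add] at h2
  have := Nat.pow_right_injective (le_refl 2) h2
  omega

lemma resp_ofEquiv (e : A ≃ B) (i : A → Bool) (j : B → Bool) :
    Resp (ofEquiv e) (Sum.elim i j) ↔ i = fun a => j (e a) := by
  constructor
  · intro h
    funext a
    exact h (Sum.inl a) (Sum.inr (e a)) rfl
  · rintro rfl x y hxy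
    have hxy : Sum.elim e id x = Sum.elim e id y := hxy
    have key : ∀ x, Sum.elim (fun a => j (e a)) j x = j (Sum.elim e id x) := by
      rintro (x | x) <;> rfl
    rw [key, key, hxy]

lemma ofEquiv_vcomp_resp (e : A ≃ B) (q : Setoid (B ⊕ C)) (i : A → Bool) (k : C → Bool) :
    Resp (vcomp (ofEquiv e) q) (Sum.elim i k) ↔ Resp q (Sum.elim (fun b => i (e.symm b)) k) := by
  rw [resp_vcomp]
  constructor
  · rintro ⟨j, h1, h2⟩
    rw [resp_ofEquiv] at h1
    subst h1
    simpa using h2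
  · intro h
    exact ⟨_, (resp_ofEquiv _ _ _).2 (by simp), h⟩

lemma vcomp_ofEquiv_resp (p : Setoid (A ⊕ B)) (e : B ≃ C) (i : A → Bool) (k : C → Bool) :
    Resp (vcomp p (ofEquiv e)) (Sum.elim i k) ↔ Resp p (Sum.elim i (fun b => k (e b))) := by
  rw [resp_vcomp]
  constructor
  · rintro ⟨j, h1, h2⟩
    rw [resp_ofEquiv] at h2
    subst h2
    exact h1
  · intro h
    exact ⟨_, h, (resp_ofEquiv _ _ _).2 rfl⟩

lemma loops_ofEquiv_left [Finite A] [Finite B] [Finite C] (e : A ≃ B) (q : Setoid (B ⊕ C)) :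
    loops (ofEquiv e) q = 0 :=
  loops_eq_zero _ _ ⟨fun x y => Subtype.ext (by
    have hx := (resp_ofEquiv _ _ _).1 x.2.1
    have hy := (resp_ofEquiv _ _ _).1 y.2.1
    funext b
    have := congrFun (hx.symm.trans hy) (e.symm b)
    simpa using this)⟩

lemma loops_ofEquiv_right [Finite A] [Finite B] [Finite C] (p : Setoid (A ⊕ B)) (e : B ≃ C) :
    loops p (ofEquiv e) = 0 :=
  loops_eq_zero _ _ ⟨fun x y => Subtype.ext (by
    rw [(resp_ofEquiv _ _ _).1 x.2.2, (resp_ofEquiv _ _ _).1 y.2.2])⟩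

lemma ofEquiv_vcomp_ofEquiv (e : A ≃ B) (e' : B ≃ C) :
    vcomp (ofEquiv e) (ofEquiv e') = ofEquiv (e.trans e') :=
  setoid_ext fun f => by
    rw [← Sum.elim_comp_inl_inr f, vcomp_ofEquiv_resp, resp_ofEquiv, resp_ofEquiv]
    rfl

lemma ofEquiv_refl_vcomp (q : Setoid (A ⊕ C)) : vcomp (ofEquiv (Equiv.refl A)) q = q :=
  setoid_ext fun f => by
    rw [← Sum.elim_comp_inl_inr f, ofEquiv_vcomp_resp]
    rfl

lemma vcomp_ofEquiv_refl (q : Setoid (A ⊕ C)) : vcomp q (ofEquiv (Equiv.refl C)) = q :=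
  setoid_ext fun f => by
    rw [← Sum.elim_comp_inl_inr f, vcomp_ofEquiv_resp]
    rfl

/-- The number of elements with label `true`. -/
def cnt {X : Type*} [Fintype X] (f : X → Bool) : ℕ := ∑ x, (f x).toNat

lemma cnt_elim [Fintype A] [Fintype B] (i : A → Bool) (j : B → Bool) :
    cnt (Sum.elim i j) = cnt i + cnt j := by
  simp [cnt]

lemma isEven_iff {X : Type*} [Fintype X] (p : Setoid X) :
    IsEven p ↔ ∀ f, Resp p f → Even (cnt f) := by
  classical
  constructor
  · intro h f hf
    rw [cnt, Finset.sum_partition p]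
    refine Finset.even_sum _ fun c _ => ?_
    induction c using Quotient.inductionOn with
    | h x =>
      have h1 : ∀ y ∈ Finset.univ.filter (fun y => Quotient.mk p y = Quotient.mk p x),
          (f y).toNat = (f x).toNat := by
        intro y hy
        rw [hf y x (Quotient.exact (Finset.mem_filter.1 hy).2)]
      have h2 := h _ (p.mem_classes x)
      rw [Set.ncard_eq_toFinset_card'] at h2
      have h3 : {y | p y x}.toFinset =
          Finset.univ.filter (fun y => Quotient.mk p y = Quotient.mk p x) := by
        ext y
        simp only [Set.mem_toFinset, Set.mem_ofPred_eq, Finset.mem_filter, Finset.mem_univ,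
          true_and]
        exact Quotient.eq.symm
      rw [h3] at h2
      refine (Finset.sum_congr rfl h1).symm ▸ ?_
      rw [Finset.sum_const, smul_eq_mul]
      exact h2.mul_right _
  · rintro h c ⟨x, rfl⟩
    have := h (fun y => decide (p y x)) (fun a b hab => by
      simp only [decide_eq_decide]
      exact ⟨fun h => p.trans (p.symm hab) h, fun h => p.trans hab h⟩)
    rw [Set.ncard_eq_toFinset_card']
    convert this
    simp only [cnt, Set.toFinset_ofPred, Finset.card_filter]
    refine Finset.sum_congr rfl fun y _ => ?_
    by_cases hy : p y x <;> simp [hy]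

lemma isEven_vcomp [Fintype A] [Fintype B] [Fintype C] {p : Setoid (A ⊕ B)} {q : Setoid (B ⊕ C)}
    (hp : IsEven p) (hq : IsEven q) : IsEven (vcomp p q) := by
  rw [isEven_iff] at *
  intro f hf
  rw [← Sum.elim_comp_inl_inr f] at hf ⊢
  obtain ⟨j, h1, h2⟩ := (resp_vcomp _ _ _ _).1 hf
  have h3 := hp _ h1
  have h4 := hq _ h2
  rw [cnt_elim] at *
  grind

lemma isEven_ofEquiv [Fintype A] [Fintype B] (e : A ≃ B) : IsEven (ofEquiv e) := by
  rw [isEven_iff]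
  intro f hf
  rw [← Sum.elim_comp_inl_inr f, resp_ofEquiv] at hf
  rw [← Sum.elim_comp_inl_inr f, cnt_elim, hf]
  have : cnt (fun a => (f ∘ Sum.inr) (e a)) = cnt (f ∘ Sum.inr) :=
    Equiv.sum_comp e (fun b => ((f ∘ Sum.inr) b).toNat)
  rw [this]
  exact Even.add_self _

end Stack

section Fin

/-- The diagram of `k + k'` lower and `l + l'` upper vertices as the disjoint union of one with
`k` lower and `l` upper vertices, and one with `k'` lower and `l'` upper vertices. -/
def splitEquiv (k l k' l' : ℕ) :
    Fin (k + k') ⊕ Fin (l + l') ≃ (Fin k ⊕ Fin l) ⊕ (Fin k' ⊕ Fin l') :=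
  (Equiv.sumCongr finSumFinEquiv.symm finSumFinEquiv.symm).trans (Equiv.sumSumSumComm _ _ _ _)

/-- Horizontal concatenation: `p` to the left of `q`. -/
def hcomp {k l k' l' : ℕ} (p : Setoid (Fin k ⊕ Fin l)) (q : Setoid (Fin k' ⊕ Fin l')) :
    Setoid (Fin (k + k') ⊕ Fin (l + l')) :=
  (sumSetoid p q).comap (splitEquiv k l k' l')

/-- The first `k` labels. -/
abbrev lft {k k' : ℕ} (f : Fin (k + k') → Bool) : Fin k → Bool := fun x => f (Fin.castAdd k' x)
/-- The last `k'` labels. -/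
abbrev rgt {k k' : ℕ} (f : Fin (k + k') → Bool) : Fin k' → Bool := fun x => f (Fin.natAdd k x)

lemma lft_rgt_ext {k k' : ℕ} {f g : Fin (k + k') → Bool} (h : lft f = lft g) (h' : rgt f = rgt g) :
    f = g := by
  funext x
  induction x using Fin.addCases with
  | left x => exact congrFun h x
  | right x => exact congrFun h' x

lemma lft_append {k k' : ℕ} (j : Fin k → Bool) (j' : Fin k' → Bool) :
    lft (Fin.append j j') = j := by
  funext x; simp

lemma rgt_append {k k' : ℕ} (j : Fin k → Bool) (j' : Fin k' → Bool) :
    rgt (Fin.append j j') = j' := by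
  funext x; simp

lemma resp_hcomp {k l k' l' : ℕ} (p : Setoid (Fin k ⊕ Fin l)) (q : Setoid (Fin k' ⊕ Fin l'))
    (i : Fin (k + k') → Bool) (j : Fin (l + l') → Bool) :
    Resp (hcomp p q) (Sum.elim i j) ↔
      Resp p (Sum.elim (lft i) (lft j)) ∧ Resp q (Sum.elim (rgt i) (rgt j)) := by
  have key : ∀ z, Sum.elim i j ((splitEquiv k l k' l').symm z) =
      Sum.elim (Sum.elim (lft i) (lft j)) (Sum.elim (rgt i) (rgt j)) z := by
    rintro ((z | z) | (z | z)) <;> simp [splitEquiv, Equiv.sumSumSumComm]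
  constructor
  · intro h
    have h' : ∀ x y, sumSetoid p q x y →
        Sum.elim i j ((splitEquiv k l k' l').symm x) =
          Sum.elim i j ((splitEquiv k l k' l').symm y) := by
      intro x y hxy
      refine h _ _ ?_
      change sumSetoid p q _ _
      simpa using hxy
    refine ⟨fun x y hxy => ?_, fun x y hxy => ?_⟩
    · have := h' (Sum.inl x) (Sum.inl y) (Sum.LiftRel.inl hxy)
      rw [key, key] at this
      exact this
    · have := h' (Sum.inr x) (Sum.inr y) (Sum.LiftRel.inr hxy)
      rw [key, key] at this
      exact this
  · rintro ⟨h1, h2⟩ x y hxy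
    obtain ⟨x, rfl⟩ := (splitEquiv k l k' l').symm.surjective x
    obtain ⟨y, rfl⟩ := (splitEquiv k l k' l').symm.surjective y
    have hxy : sumSetoid p q _ _ := hxy
    rw [Equiv.apply_symm_apply, Equiv.apply_symm_apply] at hxy
    rw [key, key]
    cases hxy with
    | inl h => exact h1 _ _ h
    | inr h => exact h2 _ _ h

lemma cnt_lft_rgt {k k' : ℕ} (f : Fin (k + k') → Bool) : cnt f = cnt (lft f) + cnt (rgt f) := by
  simp [cnt, Fin.sum_univ_add]

lemma isEven_hcomp {k l k' l' : ℕ} {p : Setoid (Fin k ⊕ Fin l)} {q : Setoid (Fin k' ⊕ Fin l')}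
    (hp : IsEven p) (hq : IsEven q) : IsEven (hcomp p q) := by
  rw [isEven_iff] at *
  intro f hf
  rw [← Sum.elim_comp_inl_inr f] at hf ⊢
  obtain ⟨h1, h2⟩ := (resp_hcomp _ _ _ _).1 hf
  have h3 := hp _ h1
  have h4 := hq _ h2
  rw [cnt_elim] at *
  rw [cnt_lft_rgt (f ∘ Sum.inl), cnt_lft_rgt (f ∘ Sum.inr)]
  grind

lemma vcomp_hcomp {k l m k' l' m' : ℕ} (p : Setoid (Fin k ⊕ Fin l)) (q : Setoid (Fin l ⊕ Fin m))
    (p' : Setoid (Fin k' ⊕ Fin l')) (q' : Setoid (Fin l' ⊕ Fin m')) :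
    vcomp (hcomp p p') (hcomp q q') = hcomp (vcomp p q) (vcomp p' q') :=
  setoid_ext fun f => by
    rw [← Sum.elim_comp_inl_inr f, resp_vcomp, resp_hcomp, resp_vcomp, resp_vcomp]
    constructor
    · rintro ⟨j, h1, h2⟩
      rw [resp_hcomp] at h1 h2
      exact ⟨⟨_, h1.1, h2.1⟩, ⟨_, h1.2, h2.2⟩⟩
    · rintro ⟨⟨j, h1, h2⟩, ⟨j', h1', h2'⟩⟩
      refine ⟨Fin.append j j', (resp_hcomp _ _ _ _).2 ?_, (resp_hcomp _ _ _ _).2 ?_⟩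
      · rw [lft_append, rgt_append]; exact ⟨h1, h1'⟩
      · rw [lft_append, rgt_append]; exact ⟨h2, h2'⟩

lemma loops_hcomp {k l m k' l' m' : ℕ} (p : Setoid (Fin k ⊕ Fin l)) (q : Setoid (Fin l ⊕ Fin m))
    (p' : Setoid (Fin k' ⊕ Fin l')) (q' : Setoid (Fin l' ⊕ Fin m')) :
    loops (hcomp p p') (hcomp q q') = loops p q + loops p' q' := by
  have h := card_mid (hcomp p p') (hcomp q q') _ _ (resp_const_sum _)
  have h1 := card_mid p q _ _ (resp_const_sum _)
  have h2 := card_mid p' q' _ _ (resp_const_sum _)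
  have e : Mid (hcomp p p') (hcomp q q') (fun _ => true) (fun _ => true) ≃
      Mid p q (fun _ => true) (fun _ => true) × Mid p' q' (fun _ => true) (fun _ => true) :=
    { toFun := fun j => (⟨lft j.1, ((resp_hcomp _ _ _ _).1 j.2.1).1,
          ((resp_hcomp _ _ _ _).1 j.2.2).1⟩,
        ⟨rgt j.1, ((resp_hcomp _ _ _ _).1 j.2.1).2, ((resp_hcomp _ _ _ _).1 j.2.2).2⟩)
      invFun := fun x => ⟨Fin.append x.1.1 x.2.1, (resp_hcomp _ _ _ _).2 (by
          rw [lft_append, rgt_append]; exact ⟨x.1.2.1, x.2.2.1⟩), (resp_hcomp _ _ _ _).2 (by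
          rw [lft_append, rgt_append]; exact ⟨x.1.2.2, x.2.2.2⟩)⟩
      left_inv := fun j => Subtype.ext (lft_rgt_ext (lft_append _ _) (rgt_append _ _))
      right_inv := fun x => by
        refine Prod.ext (Subtype.ext ?_) (Subtype.ext ?_)
        · exact lft_append _ _
        · exact rgt_append _ _ }
  rw [Nat.card_congr e, Nat.card_prod, h1, h2, ← pow_add] at h
  exact (Nat.pow_right_injective (le_refl 2) h).symm

lemma hcomp_ofEquiv {k l k' l' : ℕ} (e : Fin k ≃ Fin l) (e' : Fin k' ≃ Fin l') :
    hcomp (ofEquiv e) (ofEquiv e') =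
      ofEquiv ((finSumFinEquiv.symm.trans (Equiv.sumCongr e e')).trans finSumFinEquiv) :=
  setoid_ext fun f => by
    rw [← Sum.elim_comp_inl_inr f, resp_hcomp, resp_ofEquiv, resp_ofEquiv, resp_ofEquiv]
    constructor
    · rintro ⟨h1, h2⟩
      refine lft_rgt_ext ?_ ?_
      · rw [h1]; funext x; simp [lft]
      · rw [h2]; funext x; simp [rgt]
    · intro h
      rw [h]
      constructor
      · funext x; simp [lft]
      · funext x; simp [rgt]

end Fin

section Bilin
variable {P Q R : Type}

/-- The bilinear extension of `(p, q) ↦ w p q • m p q` to formal linear combinations. -/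
def bilin (w : P → Q → ℂ) (m : P → Q → R) : (P →₀ ℂ) →ₗ[ℂ] (Q →₀ ℂ) →ₗ[ℂ] (R →₀ ℂ) :=
  Finsupp.linearCombination ℂ fun p =>
    Finsupp.linearCombination ℂ fun q => Finsupp.single (m p q) (w p q)

lemma bilin_single (w : P → Q → ℂ) (m : P → Q → R) (p : P) (q : Q) (a b : ℂ) :
    bilin w m (Finsupp.single p a) (Finsupp.single q b) =
      Finsupp.single (m p q) (a * (b * w p q)) := by
  simp only [bilin, Finsupp.linearCombination_single, LinearMap.smul_apply, Finsupp.smul_single,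
    smul_eq_mul]

lemma bilin_add_left (w : P → Q → ℂ) (m : P → Q → R) (f f' : P →₀ ℂ) (g : Q →₀ ℂ) :
    bilin w m (f + f') g = bilin w m f g + bilin w m f' g := by
  rw [map_add, LinearMap.add_apply]

lemma bilin_smul_left (w : P → Q → ℂ) (m : P → Q → R) (r : ℂ) (f : P →₀ ℂ) (g : Q →₀ ℂ) :
    bilin w m (r • f) g = r • bilin w m f g := by
  rw [map_smul, LinearMap.smul_apply]

lemma bilin_zero_left (w : P → Q → ℂ) (m : P → Q → R) (g : Q →₀ ℂ) : bilin w m 0 g = 0 := by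
  rw [map_zero, LinearMap.zero_apply]

lemma bilin_add_right (w : P → Q → ℂ) (m : P → Q → R) (f : P →₀ ℂ) (g g' : Q →₀ ℂ) :
    bilin w m f (g + g') = bilin w m f g + bilin w m f g' :=
  map_add _ _ _

lemma bilin_smul_right (w : P → Q → ℂ) (m : P → Q → R) (r : ℂ) (f : P →₀ ℂ) (g : Q →₀ ℂ) :
    bilin w m f (r • g) = r • bilin w m f g :=
  map_smul _ _ _

lemma bilin_zero_right (w : P → Q → ℂ) (m : P → Q → R) (f : P →₀ ℂ) : bilin w m f 0 = 0 :=
  map_zero _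

end Bilin

/-- The even partitions of `k` lower and `l` upper points. -/
abbrev EvenPart (k l : ℕ) : Type := {p : Setoid (Fin k ⊕ Fin l) // IsEven p}

end PartCat

open PartCat

/-- The objects `[n]`, `n ∈ ℕ`, of the category `Rep₀(H_t)`. -/
@[ext]
structure Rep0 (t : ℂ) where
  /-- The number of points. -/
  n : ℕ

namespace Rep0

/-- Morphisms are linear combinations of even partitions. The composite of two partitions is the
vertical concatenation, multiplied by `t` to the number of the loops that are removed. -/
instance category (t : ℂ) : Category (Rep0 t) where
  Hom X Y := EvenPart X.n Y.n →₀ ℂ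
  id X := Finsupp.single ⟨ofEquiv (Equiv.refl (Fin X.n)), isEven_ofEquiv _⟩ 1
  comp f g := bilin (fun p q => t ^ loops p.1 q.1)
    (fun p q => (⟨vcomp p.1 q.1, isEven_vcomp p.2 q.2⟩ : EvenPart _ _)) f g
  id_comp f := by
    induction f using Finsupp.induction_linear with
    | zero => exact map_zero _
    | add f g hf hg => rw [map_add, hf, hg]
    | single p a =>
      rw [bilin_single]
      simp [loops_ofEquiv_left, ofEquiv_refl_vcomp]
  comp_id f := by
    induction f using Finsupp.induction_linear with
    | zero => rw [map_zero]; rfl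
    | add f g hf hg => rw [map_add, LinearMap.add_apply, hf, hg]
    | single p a =>
      rw [bilin_single]
      simp [loops_ofEquiv_right, vcomp_ofEquiv_refl]
  assoc f g h := by
    induction f using Finsupp.induction_linear with
    | zero => simp only [map_zero, LinearMap.zero_apply]
    | add f f' hf hf' => simp only [map_add, LinearMap.add_apply, hf, hf']
    | single p a =>
      induction g using Finsupp.induction_linear with
      | zero => simp only [map_zero, LinearMap.zero_apply]
      | add f f' hf hf' => simp only [map_add, LinearMap.add_apply, hf, hf']
      | single q b =>
        induction h using Finsupp.induction_linear with
        | zero => simp only [map_zero]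
        | add f f' hf hf' => simp only [map_add, hf, hf']
        | single r c =>
          simp only [bilin_single, vcomp_assoc]
          congr 1
          have h1 := loops_assoc p.1 q.1 r.1
          have h2 : t ^ loops p.1 q.1 * t ^ loops (vcomp p.1 q.1) r.1 =
              t ^ loops q.1 r.1 * t ^ loops p.1 (vcomp q.1 r.1) := by
            rw [← pow_add, ← pow_add, h1]
          linear_combination a * b * c * h2

variable {t : ℂ}

instance preadditive : Preadditive (Rep0 t) where
  homGroup X Y := inferInstanceAs (AddCommGroup (EvenPart X.n Y.n →₀ ℂ))
  add_comp _ _ _ f f' g := bilin_add_left _ _ f f' g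
  comp_add _ _ _ f g g' := bilin_add_right _ _ f g g'

instance linear : Linear ℂ (Rep0 t) where
  homModule X Y := inferInstanceAs (Module ℂ (EvenPart X.n Y.n →₀ ℂ))
  smul_comp _ _ _ r f g := bilin_smul_left _ _ r f g
  comp_smul _ _ _ f r g := bilin_smul_right _ _ r f g

/-- An even partition as a morphism. -/
def diag {X Y : Rep0 t} (p : EvenPart X.n Y.n) : X ⟶ Y := Finsupp.single p 1

lemma diag_comp {X Y Z : Rep0 t} (p : EvenPart X.n Y.n) (q : EvenPart Y.n Z.n) :
    (diag p : X ⟶ Y) ≫ (diag q : Y ⟶ Z) =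
      t ^ loops p.1 q.1 • (diag ⟨vcomp p.1 q.1, isEven_vcomp p.2 q.2⟩ : X ⟶ Z) := by
  refine (bilin_single _ _ _ _ _ _).trans (Eq.trans ?_ (Finsupp.smul_single _ _ _).symm)
  simp

@[elab_as_elim]
lemma hom_ind {X Y : Rep0 t} {M : (X ⟶ Y) → Prop} (f : X ⟶ Y) (h0 : M 0)
    (ha : ∀ f g, M f → M g → M (f + g)) (hs : ∀ (a : ℂ) p, M (a • diag p)) : M f := by
  refine Finsupp.induction_linear (motive := M) f h0 ha fun p a => ?_
  have : (Finsupp.single p a : EvenPart X.n Y.n →₀ ℂ) = a • Finsupp.single p 1 := by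
    rw [Finsupp.smul_single]; simp
  rw [this]
  exact hs a p

/-- The horizontal concatenation, extended bilinearly. -/
def tens {X Y X' Y' : Rep0 t} (f : X ⟶ Y) (g : X' ⟶ Y') :
    (⟨X.n + X'.n⟩ : Rep0 t) ⟶ ⟨Y.n + Y'.n⟩ :=
  bilin (fun _ _ => 1)
    (fun p q => (⟨hcomp p.1 q.1, isEven_hcomp p.2 q.2⟩ :
      EvenPart (X.n + X'.n) (Y.n + Y'.n))) f g

section Tens
variable {X Y Z X' Y' Z' : Rep0 t}

lemma tens_diag (p : EvenPart X.n Y.n) (q : EvenPart X'.n Y'.n) :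
    tens (diag p : X ⟶ Y) (diag q : X' ⟶ Y') = diag ⟨hcomp p.1 q.1, isEven_hcomp p.2 q.2⟩ := by
  refine (bilin_single _ _ _ _ _ _).trans ?_
  simp [diag]

lemma tens_add (f : X ⟶ Y) (g g' : X' ⟶ Y') : tens f (g + g') = tens f g + tens f g' :=
  bilin_add_right _ _ f g g'

lemma add_tens (f f' : X ⟶ Y) (g : X' ⟶ Y') : tens (f + f') g = tens f g + tens f' g :=
  bilin_add_left _ _ f f' g

lemma tens_smul (r : ℂ) (f : X ⟶ Y) (g : X' ⟶ Y') : tens f (r • g) = r • tens f g :=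
  bilin_smul_right _ _ r f g

lemma smul_tens (r : ℂ) (f : X ⟶ Y) (g : X' ⟶ Y') : tens (r • f) g = r • tens f g :=
  bilin_smul_left _ _ r f g

lemma tens_zero (f : X ⟶ Y) : tens f (0 : X' ⟶ Y') = 0 :=
  bilin_zero_right _ _ f

lemma zero_tens (g : X' ⟶ Y') : tens (0 : X ⟶ Y) g = 0 :=
  bilin_zero_left _ _ g

lemma tens_comp (f : X ⟶ Y) (f' : X' ⟶ Y') (g : Y ⟶ Z) (g' : Y' ⟶ Z') :
    tens f f' ≫ tens g g' = tens (f ≫ g) (f' ≫ g') := by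
  refine hom_ind f ?_ (fun a b ha hb => ?_) fun a p => ?_
  · simp only [zero_tens, zero_comp]
  · simp only [add_tens, Preadditive.add_comp, ha, hb]
  refine hom_ind f' ?_ (fun a b ha hb => ?_) fun a' p' => ?_
  · simp only [tens_zero, zero_comp]
  · simp only [tens_add, Preadditive.add_comp, ha, hb]
  refine hom_ind g ?_ (fun a b ha hb => ?_) fun b q => ?_
  · simp only [zero_tens, comp_zero]
  · simp only [add_tens, Preadditive.comp_add, ha, hb]
  refine hom_ind g' ?_ (fun a b ha hb => ?_) fun b' q' => ?_
  · simp only [tens_zero, comp_zero]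
  · simp only [tens_add, Preadditive.comp_add, ha, hb]
  simp only [smul_tens, tens_smul, Linear.smul_comp, Linear.comp_smul, tens_diag]
  rw [diag_comp, diag_comp, diag_comp]
  simp only [smul_tens, tens_smul, tens_diag, vcomp_hcomp, loops_hcomp, pow_add, mul_smul]
  rw [smul_comm b a', smul_comm (t ^ loops p.1 q.1) (t ^ loops p'.1 q'.1)]

end Tens

/-- The morphism given by a bijection of the points. -/
def perm {X Y : Rep0 t} (e : Fin X.n ≃ Fin Y.n) : X ⟶ Y := diag ⟨ofEquiv e, isEven_ofEquiv e⟩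

/-- The disjoint union of two bijections. -/
def sumPerm {k l k' l' : ℕ} (e : Fin k ≃ Fin l) (e' : Fin k' ≃ Fin l') :
    Fin (k + k') ≃ Fin (l + l') :=
  (finSumFinEquiv.symm.trans (Equiv.sumCongr e e')).trans finSumFinEquiv

section Perm
variable {X Y Z X' Y' : Rep0 t}

lemma id_eq_perm (X : Rep0 t) : 𝟙 X = perm (Equiv.refl _) := rfl

lemma diag_comp_perm (p : EvenPart X.n Y.n) (e : Fin Y.n ≃ Fin Z.n) :
    (diag p : X ⟶ Y) ≫ (perm e : Y ⟶ Z) =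
      diag ⟨vcomp p.1 (ofEquiv e), isEven_vcomp p.2 (isEven_ofEquiv e)⟩ := by
  rw [perm, diag_comp, loops_ofEquiv_right]
  simp

lemma perm_comp_diag (e : Fin X.n ≃ Fin Y.n) (p : EvenPart Y.n Z.n) :
    (perm e : X ⟶ Y) ≫ (diag p : Y ⟶ Z) =
      diag ⟨vcomp (ofEquiv e) p.1, isEven_vcomp (isEven_ofEquiv e) p.2⟩ := by
  rw [perm, diag_comp, loops_ofEquiv_left]
  simp

lemma perm_comp_perm (e : Fin X.n ≃ Fin Y.n) (e' : Fin Y.n ≃ Fin Z.n) :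
    (perm e : X ⟶ Y) ≫ (perm e' : Y ⟶ Z) = perm (e.trans e') := by
  rw [perm, diag_comp_perm]
  simp only [ofEquiv_vcomp_ofEquiv]
  rfl

lemma tens_perm (e : Fin X.n ≃ Fin Y.n) (e' : Fin X'.n ≃ Fin Y'.n) :
    tens (perm e : X ⟶ Y) (perm e' : X' ⟶ Y') =
      perm (X := ⟨X.n + X'.n⟩) (Y := ⟨Y.n + Y'.n⟩) (sumPerm e e') := by
  rw [perm, perm, tens_diag]
  simp only [hcomp_ofEquiv]
  rfl

/-- The isomorphism given by a bijection of the points. -/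
@[simps]
def permIso (e : Fin X.n ≃ Fin Y.n) : X ≅ Y where
  hom := perm e
  inv := perm e.symm
  hom_inv_id := by rw [perm_comp_perm, id_eq_perm]; simp
  inv_hom_id := by rw [perm_comp_perm, id_eq_perm]; simp

end Perm

@[simp] lemma sumPerm_castAdd {k l k' l' : ℕ} (e : Fin k ≃ Fin l) (e' : Fin k' ≃ Fin l')
    (x : Fin k) : sumPerm e e' (Fin.castAdd k' x) = Fin.castAdd l' (e x) := by
  simp [sumPerm]

@[simp] lemma sumPerm_natAdd {k l k' l' : ℕ} (e : Fin k ≃ Fin l) (e' : Fin k' ≃ Fin l')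
    (x : Fin k') : sumPerm e e' (Fin.natAdd k x) = Fin.natAdd l (e' x) := by
  simp [sumPerm]

lemma sumPerm_finCongr {k l k' l' : ℕ} (h : k = l) (h' : k' = l') :
    sumPerm (finCongr h) (finCongr h') = finCongr (by rw [h, h']) := by
  subst h h'
  ext x
  induction x using Fin.addCases <;> simp

lemma refl_eq_finCongr (k : ℕ) : Equiv.refl (Fin k) = finCongr rfl := rfl

/-- The monoidal structure: `[n] ⊗ [m] = [n + m]` and horizontal concatenation. The associators
and unitors are identities up to the equalities `(k + l) + m = k + (l + m)`, `0 + k = k`. -/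
instance monoidalStruct : MonoidalCategoryStruct (Rep0 t) where
  tensorObj X Y := ⟨X.n + Y.n⟩
  tensorHom f g := tens f g
  whiskerLeft X _ _ f := tens (𝟙 X) f
  whiskerRight f X := tens f (𝟙 X)
  tensorUnit := ⟨0⟩
  associator X Y Z := permIso (X := ⟨X.n + Y.n + Z.n⟩) (Y := ⟨X.n + (Y.n + Z.n)⟩)
    (finCongr (Nat.add_assoc _ _ _))
  leftUnitor X := permIso (X := ⟨0 + X.n⟩) (Y := X) (finCongr (Nat.zero_add _))
  rightUnitor X := permIso (X := ⟨X.n + 0⟩) (Y := X) (finCongr (Nat.add_zero _))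

lemma left_natural {X Y : Rep0 t} (f : X ⟶ Y) :
    tens (𝟙 (⟨0⟩ : Rep0 t)) f ≫ perm (Y := Y) (finCongr (Nat.zero_add _)) =
      perm (Y := X) (finCongr (Nat.zero_add _)) ≫ f := by
  refine hom_ind f ?_ (fun a b ha hb => ?_) fun a p => ?_
  · simp only [tens_zero, zero_comp, comp_zero]
  · simp only [tens_add, Preadditive.add_comp, Preadditive.comp_add, ha, hb]
  simp only [tens_smul, Linear.smul_comp, Linear.comp_smul, id_eq_perm]
  rw [perm, tens_diag, diag_comp_perm, perm_comp_diag]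
  congr 2
  refine Subtype.ext (setoid_ext fun f => ?_)
  rw [← Sum.elim_comp_inl_inr f, vcomp_ofEquiv_resp, ofEquiv_vcomp_resp, resp_hcomp, resp_ofEquiv]
  have h1 : ∀ {k : ℕ} (i : Fin k → Bool),
      rgt (fun x => i (finCongr (Nat.zero_add k) x)) = i := by
    intro k i; funext x; exact congrArg i (Fin.ext (by simp))
  have h2 : ∀ {k : ℕ} (i : Fin (0 + k) → Bool),
      rgt i = fun x => i ((finCongr (Nat.zero_add k)).symm x) := by
    intro k i; funext x; exact congrArg i (Fin.ext (by simp))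
  rw [h1, h2]
  exact ⟨fun h => h.2, fun h => ⟨Subsingleton.elim _ _, h⟩⟩

lemma right_natural {X Y : Rep0 t} (f : X ⟶ Y) :
    tens f (𝟙 (⟨0⟩ : Rep0 t)) ≫ perm (Y := Y) (finCongr (Nat.add_zero _)) =
      perm (Y := X) (finCongr (Nat.add_zero _)) ≫ f := by
  refine hom_ind f ?_ (fun a b ha hb => ?_) fun a p => ?_
  · simp only [zero_tens, zero_comp, comp_zero]
  · simp only [add_tens, Preadditive.add_comp, Preadditive.comp_add, ha, hb]
  simp only [smul_tens, Linear.smul_comp, Linear.comp_smul, id_eq_perm]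
  rw [perm, tens_diag, diag_comp_perm, perm_comp_diag]
  congr 2
  refine Subtype.ext (setoid_ext fun f => ?_)
  rw [← Sum.elim_comp_inl_inr f, vcomp_ofEquiv_resp, ofEquiv_vcomp_resp, resp_hcomp, resp_ofEquiv]
  exact ⟨fun h => h.1, fun h => ⟨h, Subsingleton.elim _ _⟩⟩

lemma assoc_natural {X Y Z X' Y' Z' : Rep0 t} (f : X ⟶ X') (g : Y ⟶ Y') (h : Z ⟶ Z') :
    tens (tens f g) h ≫ perm (Y := ⟨X'.n + (Y'.n + Z'.n)⟩) (finCongr (Nat.add_assoc _ _ _)) =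
      perm (Y := ⟨X.n + (Y.n + Z.n)⟩) (finCongr (Nat.add_assoc _ _ _)) ≫ tens f (tens g h) := by
  refine hom_ind f ?_ (fun a b ha hb => ?_) fun a p => ?_
  · simp only [zero_tens, zero_comp, comp_zero]
  · simp only [add_tens, Preadditive.add_comp, Preadditive.comp_add, ha, hb]
  refine hom_ind g ?_ (fun a b ha hb => ?_) fun b q => ?_
  · simp only [zero_tens, tens_zero, zero_comp, comp_zero]
  · simp only [add_tens, tens_add, Preadditive.add_comp, Preadditive.comp_add, ha, hb]
  refine hom_ind h ?_ (fun a b ha hb => ?_) fun c r => ?_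
  · simp only [tens_zero, zero_comp, comp_zero]
  · simp only [tens_add, Preadditive.add_comp, Preadditive.comp_add, ha, hb]
  simp only [smul_tens, tens_smul, Linear.smul_comp, Linear.comp_smul]
  congr 3
  rw [tens_diag, tens_diag, tens_diag, tens_diag, diag_comp_perm, perm_comp_diag]
  congr 1
  refine Subtype.ext (setoid_ext fun f => ?_)
  rw [← Sum.elim_comp_inl_inr f, vcomp_ofEquiv_resp, ofEquiv_vcomp_resp, resp_hcomp, resp_hcomp,
    resp_hcomp, resp_hcomp]
  generalize f ∘ Sum.inl = i
  generalize f ∘ Sum.inr = j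
  have h1 : ∀ {k l m : ℕ} (i : Fin (k + (l + m)) → Bool),
      lft (lft fun x => i (finCongr (Nat.add_assoc k l m) x)) = lft i := by
    intro k l m i; funext x; exact congrArg i (Fin.ext (by simp))
  have h2 : ∀ {k l m : ℕ} (i : Fin (k + (l + m)) → Bool),
      rgt (lft fun x => i (finCongr (Nat.add_assoc k l m) x)) = lft (rgt i) := by
    intro k l m i; funext x; exact congrArg i (Fin.ext (by simp))
  have h3 : ∀ {k l m : ℕ} (i : Fin (k + (l + m)) → Bool),
      (rgt fun x => i (finCongr (Nat.add_assoc k l m) x)) = rgt (rgt i) := by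
    intro k l m i; funext x; exact congrArg i (Fin.ext (by simp [Nat.add_assoc]))
  have h4 : ∀ {k l m : ℕ} (i : Fin (k + l + m) → Bool),
      (lft fun x => i ((finCongr (Nat.add_assoc k l m)).symm x)) = lft (lft i) := by
    intro k l m i; funext x; exact congrArg i (Fin.ext (by simp))
  have h5 : ∀ {k l m : ℕ} (i : Fin (k + l + m) → Bool),
      (lft (rgt fun x => i ((finCongr (Nat.add_assoc k l m)).symm x))) = rgt (lft i) := by
    intro k l m i; funext x; exact congrArg i (Fin.ext (by simp))
  have h6 : ∀ {k l m : ℕ} (i : Fin (k + l + m) → Bool),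
      (rgt (rgt fun x => i ((finCongr (Nat.add_assoc k l m)).symm x))) = rgt i := by
    intro k l m i; funext x; exact congrArg i (Fin.ext (by simp [Nat.add_assoc]))
  rw [h1, h2, h3, h4, h5, h6, and_assoc]

instance monoidal : MonoidalCategory (Rep0 t) :=
  MonoidalCategory.ofTensorHom
    (id_tensorHom_id := fun X Y => by
      refine (tens_perm (X := X) (Y := X) (X' := Y) (Y' := Y) (Equiv.refl _)
        (Equiv.refl _)).trans ?_
      exact congrArg perm (sumPerm_finCongr rfl rfl))
    (id_tensorHom := fun _ _ _ _ => rfl)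
    (tensorHom_id := fun _ _ => rfl)
    (tensorHom_comp_tensorHom := tens_comp)
    (associator_naturality := assoc_natural)
    (leftUnitor_naturality := left_natural)
    (rightUnitor_naturality := right_natural)
    (pentagon := fun W X Y Z => by
      change tens (perm _) (perm (Equiv.refl _)) ≫ perm _ ≫ tens (perm (Equiv.refl _)) (perm _) =
        perm _ ≫ perm _
      simp only [tens_perm, perm_comp_perm, refl_eq_finCongr, sumPerm_finCongr]
      rfl)
    (triangle := fun X Y => by
      change perm _ ≫ tens (perm (Equiv.refl _)) (perm _) = tens (perm _) (perm (Equiv.refl _))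
      simp only [tens_perm, perm_comp_perm, refl_eq_finCongr, sumPerm_finCongr]
      rfl)

instance monoidalPreadditive : MonoidalPreadditive (Rep0 t) where
  whiskerLeft_zero := tens_zero _
  zero_whiskerRight := zero_tens _
  whiskerLeft_add _ _ := tens_add _ _ _
  add_whiskerRight _ _ := add_tens _ _ _

instance monoidalLinear : MonoidalLinear ℂ (Rep0 t) where
  whiskerLeft_smul _ _ _ _ _ := tens_smul _ _ _
  smul_whiskerRight _ _ _ _ _ := smul_tens _ _ _

lemma braid_natural {X Y X' Y' : Rep0 t} (f : X ⟶ X') (g : Y ⟶ Y') :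
    tens f g ≫ perm (Y := ⟨Y'.n + X'.n⟩) finAddFlip =
      perm (Y := ⟨Y.n + X.n⟩) finAddFlip ≫ tens g f := by
  refine hom_ind f ?_ (fun a b ha hb => ?_) fun a p => ?_
  · simp only [zero_tens, tens_zero, zero_comp, comp_zero]
  · simp only [add_tens, tens_add, Preadditive.add_comp, Preadditive.comp_add, ha, hb]
  refine hom_ind g ?_ (fun a b ha hb => ?_) fun b q => ?_
  · simp only [zero_tens, tens_zero, zero_comp, comp_zero]
  · simp only [add_tens, tens_add, Preadditive.add_comp, Preadditive.comp_add, ha, hb]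
  simp only [smul_tens, tens_smul, Linear.smul_comp, Linear.comp_smul]
  rw [smul_comm]
  congr 2
  rw [tens_diag, tens_diag, diag_comp_perm, perm_comp_diag]
  congr 1
  refine Subtype.ext (setoid_ext fun f => ?_)
  rw [← Sum.elim_comp_inl_inr f, vcomp_ofEquiv_resp, ofEquiv_vcomp_resp, resp_hcomp, resp_hcomp]
  generalize f ∘ Sum.inl = i
  generalize f ∘ Sum.inr = j
  have h1 : ∀ {k l : ℕ} (i : Fin (l + k) → Bool),
      (lft fun x : Fin (k + l) => i (finAddFlip x)) = rgt i := by
    intro k l i; funext x; exact congrArg i (finAddFlip_apply_castAdd x l)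
  have h2 : ∀ {k l : ℕ} (i : Fin (l + k) → Bool),
      (rgt fun x : Fin (k + l) => i (finAddFlip x)) = lft i := by
    intro k l i; funext x; exact congrArg i (finAddFlip_apply_natAdd x k)
  have h3 : ∀ {k l : ℕ}, (finAddFlip : Fin (k + l) ≃ Fin (l + k)).symm = finAddFlip := by
    intro k l; rfl
  rw [h3, h1, h2, h1, h2, and_comm]

lemma hex_forward (k l m : ℕ) :
    ((finCongr (Nat.add_assoc k l m)).trans finAddFlip).trans (finCongr (Nat.add_assoc l m k)) =
      ((sumPerm finAddFlip (Equiv.refl _)).trans (finCongr (Nat.add_assoc l k m))).trans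
        (sumPerm (Equiv.refl _) finAddFlip) := by
  have a1 : ∀ {k l m : ℕ} (x : Fin k), Fin.cast (Nat.add_assoc k l m)
      (Fin.castAdd m (Fin.castAdd l x)) = Fin.castAdd (l + m) x := fun _ => rfl
  have a2 : ∀ {k l m : ℕ} (x : Fin l), Fin.cast (Nat.add_assoc k l m)
      (Fin.castAdd m (Fin.natAdd k x)) = Fin.natAdd k (Fin.castAdd m x) := fun _ => rfl
  have a3 : ∀ {k l m : ℕ} (x : Fin m), Fin.cast (Nat.add_assoc k l m)
      (Fin.natAdd (k + l) x) = Fin.natAdd k (Fin.natAdd l x) := fun _ =>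
    Fin.ext (Nat.add_assoc _ _ _)
  refine Equiv.ext fun x => ?_
  simp only [Equiv.trans_apply, finCongr_apply]
  induction x using Fin.addCases with
  | left x =>
    induction x using Fin.addCases with
    | left x =>
      rw [sumPerm_castAdd, finAddFlip_apply_castAdd, a1, a2, sumPerm_natAdd,
        finAddFlip_apply_castAdd, finAddFlip_apply_castAdd, a3]
    | right x =>
      rw [sumPerm_castAdd, finAddFlip_apply_natAdd, a1, a2, sumPerm_castAdd,
        finAddFlip_apply_natAdd, a1]
      rfl
  | right x =>
    rw [sumPerm_natAdd, a3, finAddFlip_apply_natAdd, a2, Equiv.refl_apply, a3, sumPerm_natAdd,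
      finAddFlip_apply_natAdd]

lemma hex_reverse (k l m : ℕ) :
    ((finCongr (Nat.add_assoc k l m).symm).trans finAddFlip).trans
        (finCongr (Nat.add_assoc m k l).symm) =
      ((sumPerm (Equiv.refl _) finAddFlip).trans (finCongr (Nat.add_assoc k m l).symm)).trans
        (sumPerm finAddFlip (Equiv.refl _)) := by
  have h := congrArg Equiv.symm (hex_forward m k l)
  exact h

/-- The symmetric braiding: the strands of `X` cross those of `Y`. -/
instance symmetric : SymmetricCategory (Rep0 t) where
  braiding X Y := permIso (X := ⟨X.n + Y.n⟩) (Y := ⟨Y.n + X.n⟩) finAddFlip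
  braiding_naturality_right _ _ _ _ := braid_natural _ _
  braiding_naturality_left _ _ := braid_natural _ _
  hexagon_forward X Y Z := by
    change perm _ ≫ perm _ ≫ perm _ =
      tens (perm _) (perm (Equiv.refl _)) ≫ perm _ ≫ tens (perm (Equiv.refl _)) (perm _)
    simp only [tens_perm, perm_comp_perm]
    exact congrArg perm (hex_forward _ _ _)
  hexagon_reverse X Y Z := by
    change perm _ ≫ perm _ ≫ perm _ =
      tens (perm (Equiv.refl _)) (perm _) ≫ perm _ ≫ tens (perm _) (perm (Equiv.refl _))
    simp only [tens_perm, perm_comp_perm]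
    exact congrArg perm (hex_reverse _ _ _)
  symmetry X Y := by
    change perm _ ≫ perm _ = _
    rw [perm_comp_perm, id_eq_perm]
    refine congrArg perm (Equiv.ext fun x => ?_)
    change finAddFlip (finAddFlip x) = x
    induction x using Fin.addCases with
    | left x => exact (congrArg _ (finAddFlip_apply_castAdd x _)).trans (finAddFlip_apply_natAdd _ _)
    | right x => exact (congrArg _ (finAddFlip_apply_natAdd x _)).trans (finAddFlip_apply_castAdd _ _)

end Rep0

open Idempotents

section LinSymFunctor
variable (D : Type*) [Category D] [Preadditive D] [Linear ℂ D] [MonoidalCategory D]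
  [BraidedCategory D]
variable (C : Type*) [Category C] [Preadditive C] [Linear ℂ C] [MonoidalCategory C]
  [BraidedCategory C]

/-- A `ℂ`-linear symmetric (strong) monoidal functor. -/
structure LinSymFunctor where
  /-- The underlying functor. -/
  toFunctor : D ⥤ C
  /-- It is additive. -/
  additive : toFunctor.Additive
  /-- It is `ℂ`-linear. -/
  linear : toFunctor.Linear ℂ
  /-- Its monoidal structure, compatible with the symmetries. -/
  braided : toFunctor.Braided

attribute [instance] LinSymFunctor.additive LinSymFunctor.linear LinSymFunctor.braided

variable {D C}

/-- Composition of `ℂ`-linear symmetric monoidal functors. -/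
def LinSymFunctor.comp {E : Type*} [Category E] [Preadditive E] [Linear ℂ E]
    [MonoidalCategory E] [BraidedCategory E] (F : LinSymFunctor D C) (G : LinSymFunctor C E) :
    LinSymFunctor D E where
  toFunctor := F.toFunctor ⋙ G.toFunctor
  additive := inferInstance
  linear := inferInstance
  braided := inferInstance

/-- Two symmetric monoidal functors are isomorphic if there is a monoidal natural isomorphism. -/
def LinSymFunctor.IsIso (F G : LinSymFunctor D C) : Prop :=
  ∃ e : F.toFunctor ≅ G.toFunctor, NatTrans.IsMonoidal e.hom

end LinSymFunctor

section Envelope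
variable (D : Type*) [Category D] [Preadditive D]

/-- The Karoubian envelope: the idempotent completion of the additive envelope. -/
abbrev KarEnvelope : Type _ := Karoubi (Mat_ D)

/-- The embedding of a `ℂ`-linear symmetric monoidal category into its Karoubian envelope. -/
def karEmbedding [Linear ℂ D] [MonoidalCategory D] [MonoidalPreadditive D]
    [MonoidalLinear ℂ D] [SymmetricCategory D] : LinSymFunctor D (KarEnvelope D) where
  toFunctor := Mat_.embedding D ⋙ toKaroubi (Mat_ D)
  additive := inferInstance
  linear := inferInstance
  braided := inferInstance

end Envelope

/-- The category `Rep(H_t)`. -/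
abbrev RepH (t : ℂ) : Type _ := KarEnvelope (Rep0 t)

namespace Rep0
variable (t : ℂ)

lemma isEven_top {X : Type*} (h : Even (Nat.card X)) : IsEven (⊤ : Setoid X) := by
  rintro c ⟨x, rfl⟩
  have : {y | (⊤ : Setoid X) y x} = Set.univ := Set.eq_univ_of_forall fun _ => trivial
  rw [this, Set.ncard_univ]
  exact h

/-- The partition `{{1, 2, 1', 2'}}`. -/
def fourLegs : (⟨2⟩ : Rep0 t) ⟶ ⟨2⟩ := diag ⟨⊤, isEven_top ⟨2, by simp⟩⟩

/-- The partition `{{1, 2}}` of two lower points. -/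
def cap : (⟨2⟩ : Rep0 t) ⟶ ⟨0⟩ := diag ⟨⊤, isEven_top (by simp)⟩

/-- The partition `{{1', 2'}}` of two upper points. -/
def cup : (⟨0⟩ : Rep0 t) ⟶ ⟨2⟩ := diag ⟨⊤, isEven_top (by simp)⟩

/-- The partition `{{1, 2'}, {2, 1'}}`. -/
def cross : (⟨2⟩ : Rep0 t) ⟶ ⟨2⟩ := perm (X := ⟨2⟩) (Y := ⟨2⟩) (Equiv.swap (0 : Fin 2) 1)

end Rep0

section TensorPowers
variable {C : Type u} [Category.{v} C] [MonoidalCategory C]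

/-- The tensor powers `𝟙, A, A ⊗ A, (A ⊗ A) ⊗ A, …`. -/
def tpow (A : C) : ℕ → C
  | 0 => 𝟙_ C
  | 1 => A
  | k + 2 => tpow A (k + 1) ⊗ A

/-- The canonical isomorphism `A^k ⊗ A ≅ A^(k+1)`. -/
def tpowSucc (A : C) : ∀ k, tpow A k ⊗ A ≅ tpow A (k + 1)
  | 0 => λ_ A
  | _ + 1 => Iso.refl _

/-- The canonical isomorphism `A^k ⊗ A^l ≅ A^(k+l)`, composed of associators and unitors. It is an
identity if `C` is strict. -/
def tpowAdd (A : C) (k : ℕ) : ∀ l, tpow A k ⊗ tpow A l ≅ tpow A (k + l)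
  | 0 => ρ_ (tpow A k)
  | 1 => tpowSucc A k
  | l + 2 => (α_ (tpow A k) (tpow A (l + 1)) A).symm ≪≫
      whiskerRightIso (tpowAdd A k (l + 1)) A ≪≫ tpowSucc A (k + (l + 1))

end TensorPowers

section Neutralizer
variable {C : Type u} [Category.{v} C] [Preadditive C] [Linear ℂ C] [MonoidalCategory C]
  [BraidedCategory C]

/-- `A` is a `t`-dimensional self-dual rigid object with evaluation `β`, coevaluation `δ` and
neutralizer `α`. -/
structure IsSelfDualWithNeutralizer (t : ℂ) (A : C) (α : A ⊗ A ⟶ A ⊗ A) (β : A ⊗ A ⟶ 𝟙_ C)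
    (δ : 𝟙_ C ⟶ A ⊗ A) : Prop where
  /-- `(id ⊗ β) ∘ (δ ⊗ id) = id` -/
  zigzag_left : (λ_ A).inv ≫ δ ▷ A ≫ (α_ A A A).hom ≫ A ◁ β ≫ (ρ_ A).hom = 𝟙 A
  /-- `(β ⊗ id) ∘ (id ⊗ δ) = id` -/
  zigzag_right : (ρ_ A).inv ≫ A ◁ δ ≫ (α_ A A A).inv ≫ β ▷ A ≫ (λ_ A).hom = 𝟙 A
  /-- `β ∘ δ = t` -/
  dim : δ ≫ β = t • 𝟙 (𝟙_ C)
  /-- `α ∘ α = α` -/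
  idem : α ≫ α = α
  /-- `(id ⊗ α) ∘ (α ⊗ id) = (α ⊗ id) ∘ (id ⊗ α)` -/
  commute : α ▷ A ≫ (α_ A A A).hom ≫ A ◁ α =
    (α_ A A A).hom ≫ A ◁ α ≫ (α_ A A A).inv ≫ α ▷ A ≫ (α_ A A A).hom
  /-- `α ∘ γ = α` for the swap `γ` -/
  swap : (β_ A A).hom ≫ α = α
  /-- `α ∘ δ = δ` -/
  coev_neutral : δ ≫ α = δ
  /-- `β ∘ α = β` -/
  ev_neutral : α ≫ β = β
  /-- `(id ⊗ α) ∘ (δ ⊗ id) = (α ⊗ id) ∘ (id ⊗ δ)` -/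
  coev_slide : (λ_ A).inv ≫ δ ▷ A ≫ (α_ A A A).hom ≫ A ◁ α =
    (ρ_ A).inv ≫ A ◁ δ ≫ (α_ A A A).inv ≫ α ▷ A ≫ (α_ A A A).hom
  /-- `(β ⊗ id) ∘ (id ⊗ α) = (id ⊗ β) ∘ (α ⊗ id)` -/
  ev_slide : A ◁ α ≫ (α_ A A A).inv ≫ β ▷ A ≫ (λ_ A).hom =
    (α_ A A A).inv ≫ α ▷ A ≫ (α_ A A A).hom ≫ A ◁ β ≫ (ρ_ A).hom

/-- The functor `F` sends `[k]` to `A^k`, it is strict, that is, its structure isomorphisms are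
the identity of `𝟙` and the canonical isomorphisms `A^k ⊗ A^l ≅ A^(k+l)`, and it sends the
generators to `α`, `β`, `δ` and the swap. -/
structure IsStrictRealization {t : ℂ} (A : C) (α : A ⊗ A ⟶ A ⊗ A) (β : A ⊗ A ⟶ 𝟙_ C)
    (δ : 𝟙_ C ⟶ A ⊗ A) (F : LinSymFunctor (Rep0 t) C) : Prop where
  obj_eq (k : ℕ) : F.toFunctor.obj ⟨k⟩ = tpow A k
  unit_eq : Functor.LaxMonoidal.ε F.toFunctor ≫ eqToHom (obj_eq 0) = 𝟙 (𝟙_ C)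
  tensor_eq (k l : ℕ) :
    Functor.LaxMonoidal.μ F.toFunctor (⟨k⟩ : Rep0 t) ⟨l⟩ ≫ eqToHom (obj_eq (k + l)) =
      (eqToHom (obj_eq k) ⊗ₘ eqToHom (obj_eq l)) ≫ (tpowAdd A k l).hom
  map_fourLegs : eqToHom (obj_eq 2).symm ≫ F.toFunctor.map (Rep0.fourLegs t) ≫
    eqToHom (obj_eq 2) = α
  map_cap : eqToHom (obj_eq 2).symm ≫ F.toFunctor.map (Rep0.cap t) ≫ eqToHom (obj_eq 0) = β
  map_cup : eqToHom (obj_eq 0).symm ≫ F.toFunctor.map (Rep0.cup t) ≫ eqToHom (obj_eq 2) = δ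
  map_cross : eqToHom (obj_eq 2).symm ≫ F.toFunctor.map (Rep0.cross t) ≫ eqToHom (obj_eq 2) =
    (β_ A A).hom

end Neutralizer

end

/-! Since `[1]` is self-dual, a morphism `[k] ⟶ [l]` can be bent into a morphism `[0] ⟶ [k + l]`. A
functor as required is therefore governed by one vector `𝟙 ⟶ A^n` for every even partition of `n`
points. Such a vector is built recursively: choose two points of one block, create them by a
coevaluation, link them by one neutralizer to the rest of the block if there is any, and permute the
strands. The content of the theorem is that the listed relations make this independent of the
choices and make the generators act on the vectors as they act on partitions.

The symmetry gives an action of the symmetric group on `A^n`. Let `al x y` be the neutralizer on the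
strands `x` and `y`. These are commuting idempotents (`al_comm`, `al_idem`), and after `al x y` the
strands `x` and `y` are interchangeable in every further vertex (`al_al`). Hence the pairs of
strands absorbed by a morphism form an equivalence relation, and the vector of `p` absorbs `al x y`
whenever `x` and `y` lie in one block. This gives independence of the choice of two points inside a
block; for two different blocks, the two coevaluations can be exchanged (`vecStep_perm`). It follows
that permutations relabel the points (`vec_perm`), that a vertex joins two blocks (`vec_al`), and
that an evaluation contracts two points, with the factor `t` exactly when these two points form a
block (`vec_b_loop`, `vec_b_of_rel`, `vec_b_of_not_rel`).

The interpretation is first a relation `Realizes`, generated by the elementary diagrams and closed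
under linear combinations and composition. Every morphism has a realization, by the recursion above
and by bending (`exists_realizes`). It has only one: the vectors define a linear map on `Hom([0],
[n])` that is compatible with composition by every realized pair (`Realizes.vecHom_comp`), bending
extends this to all sources (`Realizes.mapHom_comp`), and composing with the identity recovers the
realization (`Realizes.mapHom_eq`). A total, single-valued relation closed under composition is a
functor. For the tensor powers of `A`, its monoidality is checked on generators, compatibility with
the symmetries reduces to the pair `[1], [1]`, and uniqueness holds because the generators generate.

Every object of the Karoubian envelope is a summand of a finite sum of objects `[n]`, so its
identity is a finite sum of morphisms that factor through the embedding. This formula extends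
natural transformations and tensor constraints along the embedding. Functors extend by splitting the
idempotent matrices in `C`. As the embedding is injective on objects, the splittings can be chosen
so that the extension restricts to the given functor on the nose (`LinSymFunctor.exists_extension`).
-/

set_option linter.unusedSectionVars false

noncomputable section


/-! ### Extending homomorphisms from a symmetric group to the next one -/

section PermExtension
open Equiv
variable {α M : Type*} [DecidableEq α] [Monoid M]

/-- A homomorphism on the permutations of `α` and images of the transpositions `(none a)` that
satisfy the relations extend to the permutations of `Option α`. -/
lemma exists_permOption_hom (φ : Perm α →* M) (t : α → M) (h1 : ∀ a, t a * t a = 1)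
    (h2 : ∀ σ a, φ σ * t a = t (σ a) * φ σ)
    (h3 : ∀ a b, a ≠ b → t a * t b * t a = φ (swap a b)) :
    ∃ Φ : Perm (Option α) →* M, (∀ σ : Perm α, Φ σ.optionCongr = φ σ) ∧
      ∀ a, Φ (swap none (some a)) = t a := by
  -- Every permutation of `Option α` is uniquely `swap none i` times a permutation that fixes
  -- `none`, so the values of the extension are forced. The value `1` at `none` matches `swap none
  -- none = 1`.
  let T : Option α → M := fun i => i.elim 1 t
  let f : Perm (Option α) → M := fun σ => T (σ none) * φ (removeNone σ)
  have hf : ∀ i (σ : Perm α), f (swap none i * σ.optionCongr) = T i * φ σ := by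
    intro i σ
    have := Perm.decomposeOption.apply_symm_apply (i, σ)
    have h1 := congrArg Prod.fst this
    have h2 := congrArg Prod.snd this
    simp only [Perm.decomposeOption_symm_apply] at h1 h2
    change T ((swap none i * σ.optionCongr) none) * φ (removeNone (swap none i * σ.optionCongr)) = _
    exact congrArg₂ (fun a b => T a * φ b) h1 h2
  have hd : ∀ σ : Perm (Option α), ∃ i, ∃ σ' : Perm α, σ = swap none i * σ'.optionCongr :=
    fun σ => ⟨_, _, (Perm.decomposeOption.symm_apply_apply σ).symm⟩
  have hmv : ∀ (σ : Perm α) k, σ.optionCongr * swap none k = swap none (k.map σ) * σ.optionCongr := by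
    intro σ k
    rw [Equiv.mul_swap_eq_swap_mul]
    rfl
  have hT : ∀ (σ : Perm α) k, φ σ * T k = T (k.map σ) * φ σ := by
    rintro σ (_ | a)
    · simp [T]
    · exact h2 σ a
  have hmul : ∀ (σ τ : Perm α), (σ * τ).optionCongr = σ.optionCongr * τ.optionCongr := by
    intro σ τ
    exact Equiv.ext fun x => by cases x <;> rfl
  have hs : swap (none : Option α) none = 1 := swap_self _
  have hT0 : T none = 1 := rfl
  -- A permutation that fixes `none` can be moved to the right past a transposition at `none`, so
  -- multiplicativity reduces to a product of two such transpositions.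
  have key : ∀ i l : Option α, ∀ σ : Perm α,
      f (swap none i * (swap none l * σ.optionCongr)) = T i * (T l * φ σ) := by
    intro i l σ
    rcases i with _ | a
    · rw [hs, one_mul, hf, hT0, one_mul]
    rcases l with _ | b
    · rw [hs, one_mul, hf, hT0, one_mul]
    by_cases hab : a = b
    · subst hab
      rw [← mul_assoc, swap_mul_self, one_mul, ← mul_assoc]
      change _ = t a * t a * _
      rw [h1, one_mul]
      have := hf none σ
      rwa [hs, one_mul, hT0, one_mul] at this
    · have hba := Ne.symm hab
      -- The product is brought back to the normal form; `h3` says that the images in `M` multiply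
      -- in the same way.
      have e : swap none (some a) * swap none (some b) =
          swap none (some b) * (swap a b).optionCongr := by
        rw [Equiv.optionCongr_swap]
        ext1 x
        rcases x with _ | x
        · simp [swap_apply_def, hba]
        · by_cases hxa : x = a
          · subst hxa; simp [swap_apply_def, hab]
          · by_cases hxb : x = b
            · subst hxb; simp [swap_apply_def, hab]
            · simp [swap_apply_def, hxa, hxb]
      rw [← mul_assoc, e, mul_assoc, ← hmul, hf, map_mul, ← h3 a b hab, h3 a b hab,
        swap_comm, ← h3 b a (Ne.symm hab)]
      change t b * _ = t a * (t b * _)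
      simp only [← mul_assoc]
      rw [h1, one_mul]
  refine ⟨⟨⟨f, ?_⟩, ?_⟩, ?_, ?_⟩
  · have := hf none 1
    rwa [hs, one_mul, hT0, one_mul, optionCongr_one, map_one] at this
  · intro σ τ
    obtain ⟨i, σ, rfl⟩ := hd σ
    obtain ⟨k, τ, rfl⟩ := hd τ
    have : swap none i * σ.optionCongr * (swap none k * τ.optionCongr) =
        swap none i * (swap none (k.map σ) * (σ * τ).optionCongr) := by
      rw [hmul, mul_assoc, ← mul_assoc σ.optionCongr, hmv, mul_assoc]
    simp only [this, key, hf]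
    rw [map_mul, ← mul_assoc (T (k.map σ)), ← hT]
    simp only [mul_assoc]
  · intro σ
    have := hf none σ
    rwa [hs, one_mul, hT0, one_mul] at this
  · intro a
    have := hf (some a) 1
    rwa [optionCongr_one, map_one, mul_one, mul_one] at this

/-- The extension of a permutation by a last fixed point. -/
abbrev liftPerm {n : ℕ} (σ : Perm (Fin n)) : Perm (Fin (n + 1)) :=
  Rep0.sumPerm σ (Equiv.refl (Fin 1))

@[simp] lemma liftPerm_castSucc {n : ℕ} (σ : Perm (Fin n)) (x : Fin n) :
    liftPerm σ x.castSucc = (σ x).castSucc :=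
  Rep0.sumPerm_castAdd σ _ x

@[simp] lemma liftPerm_last {n : ℕ} (σ : Perm (Fin n)) : liftPerm σ (Fin.last n) = Fin.last n :=
  Rep0.sumPerm_natAdd σ (Equiv.refl (Fin 1)) 0

lemma liftPerm_swap {n : ℕ} (x y : Fin n) :
    liftPerm (swap x y) = swap x.castSucc y.castSucc := by
  ext1 z
  induction z using Fin.lastCases with
  | last =>
    rw [liftPerm_last, swap_apply_of_ne_of_ne (Fin.castSucc_lt_last _).ne'
      (Fin.castSucc_lt_last _).ne']
  | cast z => rw [liftPerm_castSucc]; simp only [swap_apply_def, Fin.castSucc_inj]; split_ifs <;> rfl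

lemma exists_liftPerm {n : ℕ} (σ : Perm (Fin (n + 1))) (h : σ (Fin.last n) = Fin.last n) :
    ∃ τ, σ = liftPerm τ := by
  have h1 : ∀ x : Fin n, ∃ y : Fin n, σ x.castSucc = y.castSucc := fun x => by
    obtain ⟨y, hy⟩ | hx := (Fin.eq_castSucc_or_eq_last (σ x.castSucc))
    · exact ⟨y, hy⟩
    · exact absurd (σ.injective (hx.trans h.symm)) (Fin.castSucc_lt_last x).ne
  choose f hf using h1
  have hi : Function.Injective f := fun x y hxy => by
    have := (hf x).trans ((congrArg _ hxy).trans (hf y).symm)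
    exact Fin.castSucc_injective _ (σ.injective this)
  refine ⟨Equiv.ofBijective f (Finite.injective_iff_bijective.1 hi), ?_⟩
  ext1 x
  induction x using Fin.lastCases with
  | last => rw [h, liftPerm_last]
  | cast x => rw [liftPerm_castSucc, hf]; rfl

/-- The criterion is transported along `finSuccEquivLast`, under which the last point corresponds to
`none`. -/
lemma exists_permFin_hom {n : ℕ} (φ : Perm (Fin n) →* M) (t : Fin n → M)
    (h1 : ∀ a, t a * t a = 1) (h2 : ∀ σ a, φ σ * t a = t (σ a) * φ σ)
    (h3 : ∀ a b, a ≠ b → t a * t b * t a = φ (swap a b)) :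
    ∃ Φ : Perm (Fin (n + 1)) →* M, (∀ σ, Φ (liftPerm σ) = φ σ) ∧
      ∀ a, Φ (swap (Fin.last n) a.castSucc) = t a := by
  obtain ⟨Φ, hΦ, hΦ'⟩ := exists_permOption_hom φ t h1 h2 h3
  refine ⟨Φ.comp (finSuccEquivLast (n := n)).permCongrHom.toMonoidHom, fun σ => ?_, fun a => ?_⟩
  · rw [← hΦ]
    refine congrArg Φ (Equiv.ext fun x => ?_)
    rcases x with _ | x
    · simp [Equiv.permCongrHom]
    · simp [Equiv.permCongrHom]
  · rw [← hΦ']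
    refine congrArg Φ (Equiv.ext fun x => ?_)
    simp [Equiv.permCongrHom, Equiv.permCongr_def, Equiv.symm_trans_swap_trans]
end PermExtension


/-! ### Towers of strands and their symmetric group actions -/

/-- Objects `ob n` that behave like the tensor powers of an object, with an endofunctor `up` that
adds one strand at the end, crossings `s`, four-legged vertices `a`, evaluations `b` and
coevaluations `d` of the last two strands. -/
structure StrandTower (D : Type u) [Category.{v} D] where
  /-- The object with `n` strands. -/
  ob : ℕ → D
  /-- Adds a strand at the end. -/
  up {n m : ℕ} (f : ob n ⟶ ob m) : ob (n + 1) ⟶ ob (m + 1)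
  up_id (n : ℕ) : up (𝟙 (ob n)) = 𝟙 (ob (n + 1))
  up_comp {n m k : ℕ} (f : ob n ⟶ ob m) (g : ob m ⟶ ob k) : up (f ≫ g) = up f ≫ up g
  /-- The crossing of the last two strands. -/
  s (n : ℕ) : ob (n + 2) ⟶ ob (n + 2)
  /-- The four-legged vertex on the last two strands. -/
  a (n : ℕ) : ob (n + 2) ⟶ ob (n + 2)
  /-- The evaluation of the last two strands. -/
  b (n : ℕ) : ob (n + 2) ⟶ ob n
  /-- The coevaluation, creating two strands at the end. -/
  d (n : ℕ) : ob n ⟶ ob (n + 2)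
  s_nat {n m : ℕ} (f : ob n ⟶ ob m) : up (up f) ≫ s m = s n ≫ up (up f)
  a_nat {n m : ℕ} (f : ob n ⟶ ob m) : up (up f) ≫ a m = a n ≫ up (up f)
  b_nat {n m : ℕ} (f : ob n ⟶ ob m) : up (up f) ≫ b m = b n ≫ f
  d_nat {n m : ℕ} (f : ob n ⟶ ob m) : f ≫ d m = d n ≫ up (up f)
  s_s (n : ℕ) : s n ≫ s n = 𝟙 _
  braid (n : ℕ) : up (s n) ≫ s (n + 1) ≫ up (s n) = s (n + 1) ≫ up (s n) ≫ s (n + 1)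
  -- Two crossings carry a generator past one strand. The slide relations thus express `up` of a
  -- generator through the same generator one level higher.
  a_slide (n : ℕ) : a (n + 1) ≫ up (s n) ≫ s (n + 1) = up (s n) ≫ s (n + 1) ≫ up (a n)
  b_slide (n : ℕ) : up (s n) ≫ s (n + 1) ≫ up (b n) = b (n + 1)
  d_slide (n : ℕ) : d (n + 1) ≫ up (s n) ≫ s (n + 1) = up (d n)

namespace StrandTower
open Equiv
variable {D : Type u} [Category.{v} D] (T : StrandTower D)

/-- `up` as a homomorphism of endomorphism monoids. -/
def upHom (n : ℕ) : End (T.ob n) →* End (T.ob (n + 1)) where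
  toFun f := T.up f
  map_one' := T.up_id n
  map_mul' f g := T.up_comp g f

/-- The crossing of the last two strands, as an endomorphism. -/
abbrev sEnd (n : ℕ) : End (T.ob (n + 2)) := T.s n

/-- The actions of the symmetric groups on two consecutive objects. -/
structure PermStage (n : ℕ) where
  /-- The action on the smaller object. -/
  lo : Perm (Fin n) →* End (T.ob n)
  /-- The action on the larger object. -/
  hi : Perm (Fin (n + 1)) →* End (T.ob (n + 1))
  compat (σ : Perm (Fin n)) : hi (liftPerm σ) = T.upHom n (lo σ)
  -- The braid relation with the next crossing is carried along, since the extension to the next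
  -- symmetric group depends on it.
  braid (a : Fin n) (x : End (T.ob (n + 2)))
    (_ : x = T.upHom (n + 1) (hi (swap (Fin.last n) a.castSucc))) :
    x * T.sEnd n * x = T.sEnd n * x * T.sEnd n

/-- The trivial actions on `ob 0` and `ob 1`. -/
def permStageZero : T.PermStage 0 where
  lo := 1
  hi := 1
  compat _ := (map_one (T.upHom 0)).symm
  braid a := a.elim0

/-- The transposition of `a` with the new last strand must be the crossing `s n` conjugated by the
old transposition of `a` with the old last strand. The relations of `exists_permFin_hom` for these
elements follow from naturality of the crossing and from the braid relation stored in the stage. -/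
lemma exists_permStage_succ {n : ℕ} (S : T.PermStage n) :
    ∃ S' : T.PermStage (n + 1), S'.lo = S.hi ∧
      S'.hi (swap (Fin.last (n + 1)) (Fin.last n).castSucc) = T.s n := by
  let φ : Perm (Fin (n + 1)) →* End (T.ob (n + 2)) := (T.upHom (n + 1)).comp S.hi
  let s : End (T.ob (n + 2)) := T.s n
  let s' : End (T.ob (n + 3)) := T.s (n + 1)
  have hss : s * s = 1 := T.s_s n
  -- Such a permutation comes from the level below and is lifted twice, so it does not touch the
  -- strands of the crossing.
  have hcs : ∀ σ : Perm (Fin (n + 1)), σ (Fin.last n) = Fin.last n → φ σ * s = s * φ σ := by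
    intro σ hσ
    obtain ⟨τ, rfl⟩ := exists_liftPerm σ hσ
    have : φ (liftPerm τ) = T.up (T.up (S.lo τ)) := congrArg T.up (S.compat τ)
    rw [this]
    exact (T.s_nat (S.lo τ)).symm
  let t : Fin (n + 1) → End (T.ob (n + 2)) := fun a =>
    φ (swap a (Fin.last n)) * s * φ (swap a (Fin.last n))
  -- Any permutation that takes the old last point to `a` may serve as the conjugator: two of them
  -- differ by one that commutes with the crossing.
  have ht : ∀ (κ : Perm (Fin (n + 1))) a, κ (Fin.last n) = a → t a = φ κ * s * φ κ⁻¹ := by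
    intro κ a h
    have h1 : φ (swap a (Fin.last n) * κ) * s = s * φ (swap a (Fin.last n) * κ) :=
      hcs _ (by simp [h])
    rw [map_mul] at h1
    have h2 : φ κ * φ κ⁻¹ = 1 := by rw [← map_mul, mul_inv_cancel, map_one]
    have h3 : φ (swap a (Fin.last n)) * φ (swap a (Fin.last n)) = 1 := by
      rw [← map_mul, swap_mul_self, map_one]
    calc t a = φ (swap a (Fin.last n)) * (s * (φ (swap a (Fin.last n)) * φ κ)) * φ κ⁻¹ := by
          simp only [t, mul_assoc, h2, mul_one]
      _ = _ := by rw [← h1]; simp only [← mul_assoc, h3, one_mul]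
  have hinv : ∀ κ : Perm (Fin (n + 1)), φ κ⁻¹ * φ κ = 1 := fun κ => by
    rw [← map_mul, inv_mul_cancel, map_one]
  have h1 : ∀ a, t a * t a = 1 := by
    intro a
    rw [ht (swap a (Fin.last n)) a (by simp)]
    have := hinv (swap a (Fin.last n))
    have e : ∀ x y z : End (T.ob (n + 2)), x * y * z * (x * y * z) = x * (y * (z * x) * y) * z := by
      intros; simp only [mul_assoc]
    rw [e, this, mul_one, hss, mul_one, ← map_mul, mul_inv_cancel, map_one]
  have h2 : ∀ σ a, φ σ * t a = t (σ a) * φ σ := by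
    intro σ a
    rw [ht (swap a (Fin.last n)) a (by simp), ht (σ * swap a (Fin.last n)) (σ a) (by simp),
      mul_inv_rev, map_mul, map_mul]
    simp only [mul_assoc, hinv, mul_one]
  have h3 : ∀ a b, a ≠ b → t a * t b * t a = φ (swap a b) := by
    intro a b hab
    have hbl : t (Fin.last n) = s := (ht 1 _ rfl).trans (by simp)
    -- This is the third relation when one index is the old last point. The braid relation rewrites
    -- `x * s * x` as `s * x * s`, and conjugating back leaves `x`.
    have h4 : ∀ c : Fin n, t c.castSucc * s * t c.castSucc = φ (swap c.castSucc (Fin.last n)) := by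
      intro c
      have hx := S.braid c _ rfl
      rw [swap_comm] at hx
      change φ _ * s * φ _ = s * φ _ * s at hx
      have hxx : φ (swap c.castSucc (Fin.last n)) * φ (swap c.castSucc (Fin.last n)) = 1 := by
        rw [← map_mul, swap_mul_self, map_one]
      have htc : t c.castSucc = s * φ (swap c.castSucc (Fin.last n)) * s := hx
      rw [htc]
      generalize φ (swap c.castSucc (Fin.last n)) = x at *
      calc s * x * s * s * (s * x * s) = s * x * (s * s) * s * x * s := by simp only [mul_assoc]
        _ = s * (x * s * x) * s := by rw [hss, mul_one]; simp only [mul_assoc]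
        _ = (s * s) * x * (s * s) := by rw [hx]; simp only [mul_assoc]
        _ = x := by rw [hss, one_mul, mul_one]
    -- A general pair is conjugated by `κ` so that its second member becomes the old last point.
    set κ := swap b (Fin.last n) with hκ
    have hκκ : φ κ * φ κ = 1 := by rw [← map_mul, hκ, swap_mul_self, map_one]
    obtain ⟨c, hcc⟩ : ∃ c : Fin n, κ a = c.castSucc := by
      obtain ⟨y, hy⟩ | hx := Fin.eq_castSucc_or_eq_last (κ a)
      · exact ⟨y, hy⟩
      · exfalso
        apply hab
        have : κ (κ a) = κ (Fin.last n) := congrArg κ hx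
        simpa [hκ] using this
    have hb : κ b = Fin.last n := by simp [hκ]
    have ec : ∀ x, t x = φ κ * t (κ x) * φ κ := fun x => by
      rw [mul_assoc, ← h2, ← mul_assoc, hκκ, one_mul]
    have e : ∀ p q r : End (T.ob (n + 2)), p * q * p * (p * r * p) * (p * q * p) =
        p * (q * (p * p) * r * (p * p) * q) * p := by
      intros; simp only [mul_assoc]
    rw [ec a, ec b, hb, hbl, e, hκκ, mul_one, mul_one, hcc, h4, ← map_mul, ← map_mul, ← hcc]
    refine congrArg φ ?_
    rw [Equiv.mul_swap_eq_swap_mul κ, mul_assoc, hκ, swap_mul_self, mul_one]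
    simp
  obtain ⟨Φ, hΦ, hΦ'⟩ := exists_permFin_hom φ t h1 h2 h3
  refine ⟨⟨S.hi, Φ, hΦ, ?_⟩, rfl, ?_⟩
  -- The lifted new transposition is `y * z * y`, where `y` commutes with the next crossing by
  -- naturality and `z` satisfies the braid relation with it by `T.braid`.
  · rintro a x rfl
    rw [hΦ']
    have hy : T.upHom (n + 2) (φ (swap a (Fin.last n))) * s' =
        s' * T.upHom (n + 2) (φ (swap a (Fin.last n))) :=
      (T.s_nat (S.hi (swap a (Fin.last n)))).symm
    have hyy : T.upHom (n + 2) (φ (swap a (Fin.last n))) *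
        T.upHom (n + 2) (φ (swap a (Fin.last n))) = 1 := by
      rw [← map_mul, ← map_mul, swap_mul_self, map_one, map_one]
    have hz : T.upHom (n + 2) s * s' * T.upHom (n + 2) s = s' * T.upHom (n + 2) s * s' := 
      T.braid n
    simp only [t, map_mul]
    generalize T.upHom (n + 2) (φ (swap a (Fin.last n))) = y at *
    generalize T.upHom (n + 2) s = z at *
    change y * z * y * s' * (y * z * y) = s' * (y * z * y) * s'
    calc y * z * y * s' * (y * z * y) = y * z * (y * s') * y * z * y := by simp only [mul_assoc]
      _ = y * (z * s') * (y * y) * z * y := by rw [hy]; simp only [mul_assoc]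
      _ = y * (z * s' * z) * y := by rw [hyy, mul_one]; simp only [mul_assoc]
      _ = (y * s') * z * (s' * y) := by rw [hz]; simp only [mul_assoc]
      _ = s' * (y * z * y) * s' := by rw [← hy]; nth_rw 1 [hy]; simp only [mul_assoc]
  · rw [hΦ']
    exact (ht 1 _ rfl).trans (by simp [s])

/-- The stages of the actions of the symmetric groups. -/
def permStage : ∀ n, T.PermStage n
  | 0 => T.permStageZero
  | n + 1 => (T.exists_permStage_succ (permStage n)).choose

/-- The action of the symmetric group on the strands of `ob n`. -/
def perm {n : ℕ} (σ : Perm (Fin n)) : T.ob n ⟶ T.ob n := (T.permStage n).lo σ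

lemma permStage_lo_succ (n : ℕ) : (T.permStage (n + 1)).lo = (T.permStage n).hi :=
  (T.exists_permStage_succ (T.permStage n)).choose_spec.1

lemma perm_one (n : ℕ) : T.perm (1 : Perm (Fin n)) = 𝟙 _ :=
  map_one (T.permStage n).lo

lemma perm_mul {n : ℕ} (σ τ : Perm (Fin n)) : T.perm (σ * τ) = T.perm τ ≫ T.perm σ :=
  map_mul (T.permStage n).lo σ τ

lemma perm_liftPerm {n : ℕ} (σ : Perm (Fin n)) : T.perm (liftPerm σ) = T.up (T.perm σ) := by
  rw [perm, permStage_lo_succ]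
  exact (T.permStage n).compat σ

lemma perm_swap_last (n : ℕ) :
    T.perm (swap (Fin.last (n + 1)) (Fin.last n).castSucc) = T.s n := by
  rw [perm, permStage_lo_succ]
  exact (T.exists_permStage_succ (T.permStage n)).choose_spec.2

end StrandTower


/-! ### Permutations with prescribed values -/

section PermExists
open Equiv
variable {α : Type*}

lemma exists_perm_extending {k : ℕ} {f g : Fin k → α} (hf : Function.Injective f)
    (hg : Function.Injective g) : ∃ σ : Perm α, ∀ i, σ (f i) = g i := by
  obtain ⟨σ, hσ⟩ := (Equiv.Perm.isMultiplyPretransitive α k).exists_smul_eq ⟨f, hf⟩ ⟨g, hg⟩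
  exact ⟨σ, fun i => congrArg (fun e : Fin k ↪ α => e i) hσ⟩

lemma exists_perm_two {p q x y : α} (h : p ≠ q) (h' : x ≠ y) :
    ∃ σ : Perm α, σ p = x ∧ σ q = y := by
  obtain ⟨σ, hσ⟩ := exists_perm_extending (f := ![p, q]) (g := ![x, y])
    (by intro i j; fin_cases i <;> fin_cases j <;> simp [h, h.symm])
    (by intro i j; fin_cases i <;> fin_cases j <;> simp [h', h'.symm])
  exact ⟨σ, hσ 0, hσ 1⟩

lemma exists_perm_three {p q r x y z : α} (h1 : p ≠ q) (h2 : p ≠ r) (h3 : q ≠ r)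
    (k1 : x ≠ y) (k2 : x ≠ z) (k3 : y ≠ z) :
    ∃ σ : Perm α, σ p = x ∧ σ q = y ∧ σ r = z := by
  obtain ⟨σ, hσ⟩ := exists_perm_extending (f := ![p, q, r]) (g := ![x, y, z])
    (by intro i j; fin_cases i <;> fin_cases j <;> simp [*, Ne.symm h1, Ne.symm h2, Ne.symm h3])
    (by intro i j; fin_cases i <;> fin_cases j <;> simp [*, Ne.symm k1, Ne.symm k2, Ne.symm k3])
  exact ⟨σ, hσ 0, hσ 1, hσ 2⟩

lemma exists_perm_four {p q r s x y z w : α} (h : [p, q, r, s].Nodup) (k : [x, y, z, w].Nodup) :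
    ∃ σ : Perm α, σ p = x ∧ σ q = y ∧ σ r = z ∧ σ s = w := by
  obtain ⟨σ, hσ⟩ := exists_perm_extending (f := [p, q, r, s].get) (g := [x, y, z, w].get)
    (List.nodup_iff_injective_get.1 h) (List.nodup_iff_injective_get.1 k)
  exact ⟨σ, hσ 0, hσ 1, hσ 2, hσ 3⟩
end PermExists

/-! ### Towers with neutralizer and the consequences of duality -/

/-- A tower of strands that satisfies the relations of a `t`-dimensional self-dual object with
neutralizer. -/
structure NeutralTower (t : ℂ) (D : Type u) [Category.{v} D] [Preadditive D] [Linear ℂ D]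
    extends StrandTower D where
  a_a (n : ℕ) : a n ≫ a n = a n
  s_a (n : ℕ) : s n ≫ a n = a n
  a_comm (n : ℕ) : up (a n) ≫ a (n + 1) = a (n + 1) ≫ up (a n)
  d_a (n : ℕ) : d n ≫ a n = d n
  a_b (n : ℕ) : a n ≫ b n = b n
  d_b (n : ℕ) : d n ≫ b n = t • 𝟙 _
  zig (n : ℕ) : up (d n) ≫ b (n + 1) = 𝟙 _
  zag (n : ℕ) : d (n + 1) ≫ up (b n) = 𝟙 _
  d_swing (n : ℕ) : d (n + 1) ≫ up (a n) = up (d n) ≫ a (n + 1)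
  b_swing (n : ℕ) : a (n + 1) ≫ up (b n) = up (a n) ≫ b (n + 1)
  up_add {n m : ℕ} (f g : ob n ⟶ ob m) : up (f + g) = up f + up g
  up_smul {n m : ℕ} (r : ℂ) (f : ob n ⟶ ob m) : up (r • f) = r • up f

namespace NeutralTower
open Equiv StrandTower
variable {t : ℂ} {D : Type u} [Category.{v} D] [Preadditive D] [Linear ℂ D] (T : NeutralTower t D)

/-- Symmetry of the evaluation is not an axiom. It holds because the evaluation factors through the
neutralizer, which absorbs the swap. -/
lemma s_b (n : ℕ) : T.s n ≫ T.b n = T.b n := by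
  rw [← T.a_b, ← Category.assoc, T.s_a]

lemma up_s_s (n : ℕ) : T.up (T.s n) ≫ T.up (T.s n) = 𝟙 _ := by
  rw [← T.up_comp, T.s_s, T.up_id]

/-- Morphisms are determined by pairing the last strand. -/
lemma eq_of_up_b {n m : ℕ} {f g : T.ob n ⟶ T.ob (m + 2)}
    (h : T.up f ≫ T.b (m + 1) = T.up g ≫ T.b (m + 1)) : f = g := by
  have key : ∀ f : T.ob n ⟶ T.ob (m + 2), f = T.d n ≫ T.up (T.up f ≫ T.b (m + 1)) := by
    intro f
    rw [T.up_comp, ← Category.assoc, ← T.d_nat, Category.assoc, T.zag, Category.comp_id]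
  rw [key f, key g, h]

lemma up_s_b (n : ℕ) : T.up (T.s n) ≫ T.b (n + 1) = T.s (n + 1) ≫ T.up (T.b n) := by
  rw [← T.b_slide, ← Category.assoc, up_s_s, Category.id_comp]

/-- Dual to `s_b`: after pairing the last strand, the crossing slides from the coevaluation to an
evaluation, which absorbs it. -/
lemma d_s (n : ℕ) : T.d n ≫ T.s n = T.d n := by
  refine T.eq_of_up_b ?_
  have e : T.up (T.d n) ≫ T.s (n + 1) = T.d (n + 1) ≫ T.up (T.s n) := by
    rw [← T.d_slide, Category.assoc, Category.assoc, T.s_s, Category.comp_id]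
  rw [T.up_comp, Category.assoc, up_s_b, ← Category.assoc, e, Category.assoc, ← T.up_comp, s_b,
    T.zag, T.zig]

/-- The axiom concerns only a swap that precedes the neutralizer. After pairing the last strand,
`b_swing` turns an outgoing leg of the vertex into an incoming one, and both sides reduce to the
axiom `s_a`. -/
lemma a_s (n : ℕ) : T.a n ≫ T.s n = T.a n := by
  refine T.eq_of_up_b ?_
  have e : T.up (T.a n) ≫ T.s (n + 1) =
      T.s (n + 1) ≫ T.up (T.s n) ≫ T.a (n + 1) ≫ T.up (T.s n) := by
    have h := T.a_slide n
    have h' := congrArg (fun x => T.s (n + 1) ≫ T.up (T.s n) ≫ x ≫ T.s (n + 1)) h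
    simp only [Category.assoc, T.s_s, Category.comp_id] at h'
    rw [h', ← Category.assoc (T.up (T.s n)) (T.up (T.s n)), up_s_s, Category.id_comp,
      ← Category.assoc (T.s (n + 1)) (T.s (n + 1)), T.s_s, Category.id_comp]
  calc T.up (T.a n ≫ T.s n) ≫ T.b (n + 1)
      = (T.up (T.a n) ≫ T.s (n + 1)) ≫ T.up (T.b n) := by
        rw [T.up_comp, Category.assoc, up_s_b, Category.assoc]
    _ = T.s (n + 1) ≫ T.up (T.s n) ≫ T.a (n + 1) ≫ T.up (T.b n) := by
        rw [e]; simp only [Category.assoc]; rw [← T.up_comp, s_b]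
    _ = T.s (n + 1) ≫ T.up (T.a n) ≫ T.b (n + 1) := by
        rw [T.b_swing, ← Category.assoc (T.up (T.s n)), ← T.up_comp, T.s_a]
    _ = _ := by rw [← T.b_swing, ← Category.assoc, T.s_a]

/-- The partial trace of the four-legged vertex is the identity. -/
lemma d_up_a_b (n : ℕ) : T.d (n + 1) ≫ T.up (T.a n) ≫ T.b (n + 1) = 𝟙 _ := by
  rw [← Category.assoc, T.d_swing, Category.assoc, T.a_b, T.zig]
end NeutralTower

/-! ### Four-legged vertices on arbitrary pairs of strands -/

namespace NeutralTower
open Equiv StrandTower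
variable {t : ℂ} {D : Type u} [Category.{v} D] [Preadditive D] [Linear ℂ D] (T : NeutralTower t D)

lemma perm_cancel {n : ℕ} (σ : Perm (Fin n)) : T.perm σ⁻¹ ≫ T.perm σ = 𝟙 _ := by
  rw [← T.perm_mul, mul_inv_cancel, T.perm_one]

lemma perm_cancel' {n : ℕ} (σ : Perm (Fin n)) : T.perm σ ≫ T.perm σ⁻¹ = 𝟙 _ := by
  rw [← T.perm_mul, inv_mul_cancel, T.perm_one]

/-- The last position but one. -/
abbrev pen (n : ℕ) : Fin (n + 2) := (Fin.last n).castSucc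

/-- The last position. -/
abbrev lst (n : ℕ) : Fin (n + 2) := Fin.last (n + 1)

lemma pen_ne_lst (n : ℕ) : pen n ≠ lst n := (Fin.castSucc_lt_last _).ne

/-- The four-legged vertex on the strands `x` and `y`, and the identity if `x = y`. -/
def al : ∀ {n : ℕ}, Fin n → Fin n → (T.ob n ⟶ T.ob n)
  | 0, _, _ => 𝟙 _
  | 1, _, _ => 𝟙 _
  | n + 2, x, y => if h : x = y then 𝟙 _ else
      T.perm (exists_perm_two (pen_ne_lst n) h).choose⁻¹ ≫ T.a n ≫
        T.perm (exists_perm_two (pen_ne_lst n) h).choose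

lemma al_self {n : ℕ} (x : Fin n) : T.al x x = 𝟙 _ := by
  rcases n with _ | _ | n
  · rfl
  · rfl
  · simp [al]

lemma exists_lift_lift {n : ℕ} (σ : Perm (Fin (n + 2))) (h : σ (pen n) = pen n)
    (h' : σ (lst n) = lst n) : ∃ τ, σ = liftPerm (liftPerm τ) := by
  obtain ⟨τ, rfl⟩ := exists_liftPerm σ h'
  rw [liftPerm_castSucc, Fin.castSucc_inj] at h
  obtain ⟨τ, rfl⟩ := exists_liftPerm τ h
  exact ⟨τ, rfl⟩

/-- The choice made in `al` is immaterial: two permutations with the same values at the last two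
points differ by one that moves only the first `n` strands, and this one commutes with `a n` by
naturality. -/
lemma al_eq {n : ℕ} (σ : Perm (Fin (n + 2))) :
    T.al (σ (pen n)) (σ (lst n)) = T.perm σ⁻¹ ≫ T.a n ≫ T.perm σ := by
  have h : σ (pen n) ≠ σ (lst n) := fun h => pen_ne_lst n (σ.injective h)
  rw [al, dif_neg h]
  obtain ⟨h1, h2⟩ := (exists_perm_two (pen_ne_lst n) h).choose_spec
  generalize (exists_perm_two (pen_ne_lst n) h).choose = κ at *
  obtain ⟨τ, hτ⟩ := exists_lift_lift (κ⁻¹ * σ) (by simp [← h1]) (by simp [← h2])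
  have hσ : σ = κ * liftPerm (liftPerm τ) := by rw [← hτ]; simp
  have hn : T.a n ≫ T.perm (liftPerm (liftPerm τ)) = T.perm (liftPerm (liftPerm τ)) ≫ T.a n := by
    rw [T.perm_liftPerm, T.perm_liftPerm, T.a_nat]
  rw [hσ, mul_inv_rev, T.perm_mul, T.perm_mul, Category.assoc, ← Category.assoc (T.a n), hn,
    Category.assoc]
  rw [← Category.assoc (T.perm (liftPerm (liftPerm τ))⁻¹), perm_cancel, Category.id_comp]

lemma al_last (n : ℕ) : T.al (pen n) (lst n) = T.a n := by
  have := T.al_eq (n := n) 1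
  simpa [T.perm_one] using this

lemma al_perm {n : ℕ} (x y : Fin n) (σ : Perm (Fin n)) :
    T.al x y ≫ T.perm σ = T.perm σ ≫ T.al (σ x) (σ y) := by
  by_cases hxy : x = y
  · subst hxy; simp [al_self]
  rcases n with _ | _ | n
  · exact x.elim0
  · exact absurd (Fin.ext (by omega)) hxy
  obtain ⟨κ, rfl, rfl⟩ := exists_perm_two (pen_ne_lst n) hxy
  have := T.al_eq (σ * κ)
  simp only [Perm.mul_apply] at this
  rw [this, al_eq, mul_inv_rev, T.perm_mul, T.perm_mul]
  simp only [Category.assoc]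
  rw [← Category.assoc (T.perm σ), perm_cancel', Category.id_comp]

lemma al_conj {n : ℕ} (x y : Fin n) (σ : Perm (Fin n)) :
    T.perm σ⁻¹ ≫ T.al x y ≫ T.perm σ = T.al (σ x) (σ y) := by
  rw [al_perm, ← Category.assoc, perm_cancel, Category.id_comp]

lemma perm_swap_pen (n : ℕ) : T.perm (swap (pen n) (lst n)) = T.s n := by
  rw [swap_comm, T.perm_swap_last]

lemma al_symm {n : ℕ} (x y : Fin n) : T.al x y = T.al y x := by
  by_cases hxy : x = y
  · subst hxy; rfl
  rcases n with _ | _ | n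
  · exact x.elim0
  · exact absurd (Fin.ext (by omega)) hxy
  obtain ⟨κ, rfl, rfl⟩ := exists_perm_two (pen_ne_lst n) hxy
  rw [← al_conj, ← al_conj]
  have h : T.al (lst n) (pen n) = T.al (pen n) (lst n) := by
    have := T.al_conj (pen n) (lst n) (swap (pen n) (lst n))
    rw [swap_apply_left, swap_apply_right, swap_inv, perm_swap_pen, al_last, ← Category.assoc,
      T.s_a, T.a_s] at this
    rw [← this, al_last]
  rw [h]

lemma al_idem {n : ℕ} (x y : Fin n) : T.al x y ≫ T.al x y = T.al x y := by
  by_cases hxy : x = y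
  · subst hxy; simp [al_self]
  rcases n with _ | _ | n
  · exact x.elim0
  · exact absurd (Fin.ext (by omega)) hxy
  obtain ⟨κ, rfl, rfl⟩ := exists_perm_two (pen_ne_lst n) hxy
  rw [al_eq]
  simp only [Category.assoc]
  rw [← Category.assoc (T.perm κ), perm_cancel', Category.id_comp, ← Category.assoc (T.a n),
    T.a_a]

lemma al_swap {n : ℕ} (x y : Fin n) : T.al x y ≫ T.perm (swap x y) = T.al x y := by
  by_cases hxy : x = y
  · subst hxy; rw [swap_self]; exact (congrArg _ (T.perm_one n)).trans (Category.comp_id _)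
  rcases n with _ | _ | n
  · exact x.elim0
  · exact absurd (Fin.ext (by omega)) hxy
  obtain ⟨κ, rfl, rfl⟩ := exists_perm_two (pen_ne_lst n) hxy
  have e : swap (κ (pen n)) (κ (lst n)) = κ * swap (pen n) (lst n) * κ⁻¹ := by
    rw [Equiv.mul_swap_eq_swap_mul, mul_inv_cancel_right]
  rw [al_eq, e, T.perm_mul, T.perm_mul, perm_swap_pen]
  simp only [Category.assoc]
  rw [← Category.assoc (T.perm κ) (T.perm κ⁻¹), perm_cancel', Category.id_comp,
    ← Category.assoc (T.a n) (T.s n), T.a_s]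

/-- By `a_slide`, the vertex next to an added strand is the vertex on the last two strands,
conjugated by the permutation `κ` that moves these two strands down by one place. -/
lemma up_a (n : ℕ) : T.up (T.a n) = T.al (pen n).castSucc (lst n).castSucc := by
  let κ : Perm (Fin (n + 3)) := swap (pen (n + 1)) (lst (n + 1)) * liftPerm (swap (pen n) (lst n))
  have hκ : T.perm κ = T.up (T.s n) ≫ T.s (n + 1) := by
    rw [T.perm_mul, T.perm_liftPerm, perm_swap_pen, perm_swap_pen]
  have h1 : κ (pen (n + 1)) = (pen n).castSucc := by
    have : pen (n + 1) = (lst n).castSucc := rfl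
    simp only [κ, Perm.mul_apply]
    rw [this, liftPerm_castSucc, swap_apply_right, swap_apply_of_ne_of_ne]
    · simp
    · exact (Fin.castSucc_lt_last _).ne
  have h2 : κ (lst (n + 1)) = (lst n).castSucc := by
    simp only [κ, Perm.mul_apply]
    rw [liftPerm_last, swap_apply_right]
  rw [← h1, ← h2, al_eq, hκ, T.a_slide, ← Category.assoc (T.up (T.s n)), ← hκ,
    ← Category.assoc, perm_cancel, Category.id_comp]

lemma up_al {n : ℕ} (x y : Fin n) : T.up (T.al x y) = T.al x.castSucc y.castSucc := by
  by_cases hxy : x = y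
  · subst hxy; rw [al_self, al_self, T.up_id]
  rcases n with _ | _ | n
  · exact x.elim0
  · exact absurd (Fin.ext (by omega)) hxy
  obtain ⟨κ, rfl, rfl⟩ := exists_perm_two (pen_ne_lst n) hxy
  rw [al_eq, T.up_comp, T.up_comp, up_a, ← T.perm_liftPerm, ← T.perm_liftPerm]
  have := T.al_conj (pen n).castSucc (lst n).castSucc (liftPerm κ)
  rw [liftPerm_castSucc, liftPerm_castSucc] at this
  exact this

lemma al_comm_three {n : ℕ} {x y z : Fin n} (h1 : x ≠ y) (h2 : x ≠ z) (h3 : y ≠ z) :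
    T.al x y ≫ T.al y z = T.al y z ≫ T.al x y := by
  obtain ⟨m, rfl⟩ : ∃ m, n = m + 3 := ⟨n - 3, by omega⟩
  obtain ⟨κ, rfl, rfl, rfl⟩ := exists_perm_three (p := (pen m).castSucc) (q := pen (m + 1))
    (r := lst (m + 1)) (fun h => pen_ne_lst m (Fin.castSucc_injective _ h))
    (Fin.castSucc_lt_last _).ne (Fin.castSucc_lt_last _).ne h1 h2 h3
  have e : T.al (pen m).castSucc (pen (m + 1)) ≫ T.al (pen (m + 1)) (lst (m + 1)) =
      T.al (pen (m + 1)) (lst (m + 1)) ≫ T.al (pen m).castSucc (pen (m + 1)) := by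
    rw [al_last]
    have : T.al (pen m).castSucc (pen (m + 1)) = T.up (T.a m) := (T.up_a m).symm
    rw [this, T.a_comm]
  have key : ∀ x y z w, T.al (κ x) (κ y) ≫ T.al (κ z) (κ w) =
      T.perm κ⁻¹ ≫ (T.al x y ≫ T.al z w) ≫ T.perm κ := by
    intro x y z w
    rw [← al_conj, ← al_conj]
    simp only [Category.assoc]
    rw [← Category.assoc (T.perm κ), perm_cancel', Category.id_comp]
  rw [key, key, e]

/-- By equivariance the strands can be moved to the end. Vertices with one common strand commute by
the axiom `a_comm`, those with disjoint pairs by naturality of `a`. -/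
lemma al_comm {n : ℕ} (x y z w : Fin n) : T.al x y ≫ T.al z w = T.al z w ≫ T.al x y := by
  by_cases hxy : x = y
  · subst hxy; simp [al_self]
  by_cases hzw : z = w
  · subst hzw; simp [al_self]
  by_cases hxz : x = z
  · subst hxz
    by_cases hyw : y = w
    · subst hyw; rfl
    rw [T.al_symm x y, T.al_comm_three (Ne.symm hxy) hyw hzw]
  by_cases hyw : y = w
  · subst hyw
    rw [T.al_symm z y, T.al_comm_three hxy hxz (Ne.symm hzw)]
  by_cases hyz : y = z
  · subst hyz
    by_cases hxw : x = w
    · subst hxw; rw [T.al_symm]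
    exact T.al_comm_three hxy hxw hzw
  by_cases hxw : x = w
  · subst hxw
    rw [T.al_symm x y, T.al_symm z x, T.al_comm_three (Ne.symm hxy) hyz hxz]
  obtain ⟨m, rfl⟩ : ∃ m, n = m + 4 := ⟨n - 4, by omega⟩
  obtain ⟨κ, rfl, rfl, rfl, rfl⟩ := exists_perm_four (p := (pen m).castSucc.castSucc)
    (q := (lst m).castSucc.castSucc) (r := pen (m + 2)) (s := lst (m + 2))
    (x := x) (y := y) (z := z) (w := w) (by simp [Fin.ext_iff]; omega) (by simp [*])
  have e : T.al (pen m).castSucc.castSucc (lst m).castSucc.castSucc ≫ T.al (pen (m + 2)) (lst (m + 2)) =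
      T.al (pen (m + 2)) (lst (m + 2)) ≫ T.al (pen m).castSucc.castSucc (lst m).castSucc.castSucc := by
    rw [← up_al, ← up_al, al_last, al_last]
    exact T.a_nat _
  have key : ∀ x y z w, T.al (κ x) (κ y) ≫ T.al (κ z) (κ w) =
      T.perm κ⁻¹ ≫ (T.al x y ≫ T.al z w) ≫ T.perm κ := by
    intro x y z w
    rw [← al_conj, ← al_conj]
    simp only [Category.assoc]
    rw [← Category.assoc (T.perm κ), perm_cancel', Category.id_comp]
  rw [key, key, e]

/-- The transposition of `x` and `y` is absorbed by `al x y` and conjugates `al x z` into `al y z`.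
This identity makes absorption a transitive relation. -/
lemma al_al {n : ℕ} (x y z : Fin n) : T.al x y ≫ T.al x z = T.al x y ≫ T.al y z := by
  by_cases hxz : x = z
  · subst hxz; rw [T.al_symm y x, al_idem, al_self, Category.comp_id]
  by_cases hyz : y = z
  · subst hyz; rw [al_idem, al_self, Category.comp_id]
  have h := T.al_perm x z (swap x y)
  rw [swap_apply_left, swap_apply_of_ne_of_ne (Ne.symm hxz) (Ne.symm hyz)] at h
  calc T.al x y ≫ T.al x z = T.al x z ≫ T.al x y ≫ T.perm (swap x y) := by
        rw [al_swap, al_comm]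
    _ = T.al x y ≫ T.perm (swap x y) ≫ T.al y z := by
        rw [← h, ← Category.assoc, al_comm, Category.assoc]
    _ = _ := by rw [← Category.assoc, al_swap]
end NeutralTower


/-! ### Joining, relabeling and restricting blocks -/

namespace PartCat
open Equiv NeutralTower

/-- The partition obtained by joining the blocks of `x` and `y`. -/
def joinBlocks {X : Type*} (p : Setoid X) (x y : X) : Setoid X where
  r u v := p u v ∨ (p u x ∧ p v y) ∨ (p u y ∧ p v x)
  iseqv :=
    ⟨fun u => Or.inl (p.refl u),
     fun {u v} h => by
      rcases h with h | h | h
      · exact Or.inl (p.symm h)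
      · exact Or.inr (Or.inr h.symm)
      · exact Or.inr (Or.inl h.symm),
     fun {u v w} h h' => by
      have t := fun {a b c} => @Setoid.trans' _ p a b c
      have s := fun {a b} => @Setoid.symm' _ p a b
      rcases h with h | ⟨h1, h2⟩ | ⟨h1, h2⟩ <;> rcases h' with h' | ⟨h3, h4⟩ | ⟨h3, h4⟩
      · exact Or.inl (t h h')
      · exact Or.inr (Or.inl ⟨t h h3, h4⟩)
      · exact Or.inr (Or.inr ⟨t h h3, h4⟩)
      · exact Or.inr (Or.inl ⟨h1, t (s h') h2⟩)
      · exact Or.inl (t h1 (t (s h3) (t h2 (s h4))))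
      · exact Or.inl (t h1 (s h4))
      · exact Or.inr (Or.inr ⟨h1, t (s h') h2⟩)
      · exact Or.inl (t h1 (s h4))
      · exact Or.inl (t h1 (t (s h3) (t h2 (s h4))))⟩

lemma joinBlocks_rel {X : Type*} (p : Setoid X) (x y u v : X) :
    joinBlocks p x y u v ↔ p u v ∨ (p u x ∧ p v y) ∨ (p u y ∧ p v x) := Iff.rfl

lemma joinBlocks_of_rel {X : Type*} {p : Setoid X} {x y : X} (h : p x y) : joinBlocks p x y = p := by
  refine Setoid.ext fun u v => ⟨?_, Or.inl⟩
  rintro (h' | ⟨h1, h2⟩ | ⟨h1, h2⟩)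
  · exact h'
  · exact p.trans' h1 (p.trans' h (p.symm' h2))
  · exact p.trans' h1 (p.trans' (p.symm' h) (p.symm' h2))

lemma resp_joinBlocks {X : Type*} (p : Setoid X) (x y : X) (f : X → Bool) :
    Resp (joinBlocks p x y) f ↔ Resp p f ∧ f x = f y := by
  constructor
  · exact fun h => ⟨fun u v huv => h u v (Or.inl huv),
      h x y (Or.inr (Or.inl ⟨p.refl' x, p.refl' y⟩))⟩
  · rintro ⟨h1, h2⟩ u v (h | ⟨h, h'⟩ | ⟨h, h'⟩)
    · exact h1 u v h
    · rw [h1 _ _ h, h1 _ _ h', h2]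
    · rw [h1 _ _ h, h1 _ _ h', h2]

lemma comap_joinBlocks {X Y : Type*} (p : Setoid X) (e : Y ≃ X) (x y : Y) :
    (joinBlocks p (e x) (e y)).comap e = joinBlocks (p.comap e) x y := rfl

lemma resp_comap {X Y : Type*} (p : Setoid X) (i : Y → X) (f : Y → Bool) :
    Resp (p.comap i) f ↔ ∃ g, Resp p g ∧ g ∘ i = f := by
  classical
  constructor
  · intro h
    -- The extension labels a block `true` exactly when it contains the image of a point labeled
    -- `true`.
    refine ⟨fun x => decide (∃ y, p x (i y) ∧ f y = true), fun u v huv => ?_, funext fun z => ?_⟩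
    · rw [decide_eq_decide]
      exact ⟨fun ⟨y, h1, h2⟩ => ⟨y, p.trans' (p.symm' huv) h1, h2⟩,
        fun ⟨y, h1, h2⟩ => ⟨y, p.trans' huv h1, h2⟩⟩
    · cases hz : f z with
      | true => simpa using ⟨z, p.refl' _, hz⟩
      | false =>
        simp only [Function.comp, decide_eq_false_iff_not]
        rintro ⟨y, h1, h2⟩
        have := h z y h1
        simp_all
  · rintro ⟨g, hg, rfl⟩ u v huv
    exact hg _ _ huv

lemma comap_swap {X : Type*} [DecidableEq X] {p : Setoid X} {x y : X} (h : p x y) :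
    p.comap (swap x y) = p := by
  have key : ∀ u, p (swap x y u) u := by
    intro u
    rw [swap_apply_def]
    split_ifs with h1 h2
    · subst h1; exact p.symm' h
    · subst h2; exact h
    · exact p.refl' u
  exact Setoid.ext fun u v => ⟨fun h => p.trans' (p.symm' (key u)) (p.trans' h (key v)),
    fun h => p.trans' (key u) (p.trans' h (p.symm' (key v)))⟩

lemma isEven_comap {X Y : Type*} [Fintype X] [Fintype Y] {p : Setoid X} (hp : IsEven p) (e : Y ≃ X) :
    IsEven (p.comap e) := by
  rw [isEven_iff] at *
  intro f hf
  obtain ⟨g, hg, rfl⟩ := (resp_comap _ _ _).1 hf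
  have : cnt (g ∘ e) = cnt g := Equiv.sum_comp e (fun x => (g x).toNat)
  rw [this]
  exact hp g hg

lemma isEven_joinBlocks {X : Type*} [Fintype X] {p : Setoid X} (hp : IsEven p) (x y : X) :
    IsEven (joinBlocks p x y) := by
  rw [isEven_iff] at *
  exact fun f hf => hp f ((resp_joinBlocks _ _ _ _).1 hf).1

/-- Otherwise the block of `x` would be a singleton, hence odd. -/
lemma exists_partner {X : Type*} [Finite X] {p : Setoid X} (hp : IsEven p) (x : X) :
    ∃ y, y ≠ x ∧ p y x := by
  by_contra! h
  have h1 := hp _ (p.mem_classes x)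
  have : {y | p y x} = {x} := by
    ext y
    exact ⟨fun hy => by_contra fun hne => h y hne hy, fun hy => by
      rw [Set.mem_singleton_iff] at hy; subst hy; exact p.refl' _⟩
  rw [this, Set.ncard_singleton] at h1
  exact absurd h1 (by decide)

/-- The inclusion of the first `n` of `n + 2` points. -/
abbrev cc {n : ℕ} (x : Fin n) : Fin (n + 2) := x.castSucc.castSucc

/-- The restriction to the first `n` of `n + 2` points. -/
abbrev restrict {n : ℕ} (q : Setoid (Fin (n + 2))) : Setoid (Fin n) := q.comap cc

lemma cnt_cc {n : ℕ} (f : Fin (n + 2) → Bool) :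
    cnt f = cnt (f ∘ cc) + (f (pen n)).toNat + (f (lst n)).toNat := by
  simp [cnt, Fin.sum_univ_castSucc]

/-- In terms of labelings: the two removed points carry equal labels, so they contribute an even
number to the count. -/
lemma isEven_restrict_joinBlocks {n : ℕ} {q : Setoid (Fin (n + 2))} (hq : IsEven q) :
    IsEven (restrict (joinBlocks q (pen n) (lst n))) := by
  rw [isEven_iff] at *
  intro f hf
  obtain ⟨g, hg, rfl⟩ := (resp_comap _ _ _).1 hf
  rw [resp_joinBlocks] at hg
  have := hq g hg.1
  rw [cnt_cc, hg.2, add_assoc, ← two_mul] at this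
  exact (Nat.even_add.1 this).2 (even_two_mul _)

lemma isEven_restrict {n : ℕ} {q : Setoid (Fin (n + 2))} (hq : IsEven q) (h : q (pen n) (lst n)) :
    IsEven (restrict q) := by
  have := isEven_restrict_joinBlocks hq
  rwa [joinBlocks_of_rel h] at this

lemma cc_ne_pen {n : ℕ} (x : Fin n) : cc x ≠ pen n := fun h =>
  (Fin.castSucc_lt_last x).ne (Fin.castSucc_injective _ h)

lemma cc_ne_lst {n : ℕ} (x : Fin n) : cc x ≠ lst n := (Fin.castSucc_lt_last _).ne

lemma cc_injective {n : ℕ} : Function.Injective (cc (n := n)) :=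
  (Fin.castSucc_injective _).comp (Fin.castSucc_injective _)

@[elab_as_elim]
lemma cc_cases {n : ℕ} {M : Fin (n + 2) → Prop} (h : ∀ x : Fin n, M (cc x)) (h1 : M (pen n))
    (h2 : M (lst n)) (x : Fin (n + 2)) : M x := by
  induction x using Fin.lastCases with
  | last => exact h2
  | cast x =>
    induction x using Fin.lastCases with
    | last => exact h1
    | cast x => exact h x

lemma liftPerm_liftPerm_cc {n : ℕ} (τ : Perm (Fin n)) (x : Fin n) :
    liftPerm (liftPerm τ) (cc x) = cc (τ x) := by
  rw [liftPerm_castSucc, liftPerm_castSucc]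

lemma liftPerm_liftPerm_pen {n : ℕ} (τ : Perm (Fin n)) :
    liftPerm (liftPerm τ) (pen n) = pen n := by
  rw [liftPerm_castSucc, liftPerm_last]

lemma liftPerm_liftPerm_lst {n : ℕ} (τ : Perm (Fin n)) :
    liftPerm (liftPerm τ) (lst n) = lst n := by
  rw [liftPerm_last]

lemma exists_perm_pen_lst {n : ℕ} {p : Setoid (Fin (n + 2))} (hp : IsEven p) :
    ∃ σ : Perm (Fin (n + 2)), p (σ (pen n)) (σ (lst n)) := by
  obtain ⟨y, hy, h⟩ := exists_partner hp (lst n)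
  obtain ⟨σ, h1, h2⟩ := exists_perm_two (pen_ne_lst n) hy
  exact ⟨σ, by rwa [h1, h2]⟩

end PartCat

/-! ### The vector of an even partition -/

namespace NeutralTower
open Equiv StrandTower PartCat
variable {t : ℂ} {D : Type u} [Category.{v} D] [Preadditive D] [Linear ℂ D] (T : NeutralTower t D)

/-- The strands that are absorbed together by `f`. -/
def absorb {n m : ℕ} (f : T.ob m ⟶ T.ob n) : Setoid (Fin n) where
  r x y := f ≫ T.al x y = f
  iseqv :=
    ⟨fun x => by rw [al_self, Category.comp_id],
     fun {x y} h => by rw [al_symm]; exact h,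
     -- Once `x` and `y` are absorbed, `al_al` replaces one by the other in a further vertex.
     fun {x y z} h h' => by
      have h : f ≫ T.al x y = f := h
      have h' : f ≫ T.al y z = f := h'
      calc f ≫ T.al x z = f ≫ T.al y x ≫ T.al x z := by
            rw [T.al_symm y x, ← Category.assoc, h]
        _ = f ≫ T.al y x ≫ T.al y z := by rw [al_al]
        _ = _ := by rw [T.al_symm y x, ← Category.assoc, h, h']⟩

lemma absorb_iff {n m : ℕ} (f : T.ob m ⟶ T.ob n) (x y : Fin n) :
    T.absorb f x y ↔ f ≫ T.al x y = f := Iff.rfl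

lemma absorb_perm {n m : ℕ} (f : T.ob m ⟶ T.ob n) (σ : Perm (Fin n)) (x y : Fin n)
    (h : T.absorb f x y) : T.absorb (f ≫ T.perm σ) (σ x) (σ y) := by
  rw [absorb_iff] at *
  rw [Category.assoc, ← al_perm, ← Category.assoc, h]

lemma comp_perm_swap {n m : ℕ} {f : T.ob m ⟶ T.ob n} {x y : Fin n} (h : T.absorb f x y) :
    f ≫ T.perm (swap x y) = f := by
  rw [absorb_iff] at h
  rw [← h, Category.assoc, al_swap]

open scoped Classical in
/-- The four-legged vertex on `c` and some strand with the property `P`, if there is one. -/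
def link {k m : ℕ} (i : Fin m → Fin k) (P : Fin m → Prop) (c : Fin k) : T.ob k ⟶ T.ob k :=
  if h : ∃ x, P x then T.al (i h.choose) c else 𝟙 _

lemma link_neg {k m : ℕ} (i : Fin m → Fin k) {P : Fin m → Prop} (c : Fin k) (h : ¬ ∃ x, P x) :
    T.link i P c = 𝟙 _ := dif_neg h

lemma exists_link {k m : ℕ} (i : Fin m → Fin k) {P : Fin m → Prop} (c : Fin k) (h : ∃ x, P x) :
    ∃ x, P x ∧ T.link i P c = T.al (i x) c := ⟨_, h.choose_spec, dif_pos h⟩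

lemma up_link {k m : ℕ} (i : Fin m → Fin k) (P : Fin m → Prop) (c : Fin k) :
    T.up (T.link i P c) = T.link (fun x => (i x).castSucc) P c.castSucc := by
  by_cases h : ∃ x, P x
  · rw [link, link, dif_pos h, dif_pos h, up_al]
  · rw [link_neg _ _ _ h, link_neg _ _ _ h, T.up_id]

lemma link_perm {k m : ℕ} (i : Fin m → Fin k) (P : Fin m → Prop) (c : Fin k) (σ : Perm (Fin k)) :
    T.link i P c ≫ T.perm σ = T.perm σ ≫ T.link (fun x => σ (i x)) P (σ c) := by
  by_cases h : ∃ x, P x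
  · rw [link, link, dif_pos h, dif_pos h, al_perm]
  · rw [link_neg _ _ _ h, link_neg _ _ _ h, Category.comp_id, Category.id_comp]

lemma link_comm_al {k m : ℕ} (i : Fin m → Fin k) (P : Fin m → Prop) (c x y : Fin k) :
    T.link i P c ≫ T.al x y = T.al x y ≫ T.link i P c := by
  by_cases h : ∃ x, P x
  · rw [link, dif_pos h, al_comm]
  · rw [link_neg _ _ _ h, Category.comp_id, Category.id_comp]

lemma link_comm {k m m' : ℕ} (i : Fin m → Fin k) (P : Fin m → Prop) (c : Fin k)
    (i' : Fin m' → Fin k) (P' : Fin m' → Prop) (c' : Fin k) :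
    T.link i P c ≫ T.link i' P' c' = T.link i' P' c' ≫ T.link i P c := by
  by_cases h : ∃ x, P' x
  · obtain ⟨x, -, hx⟩ := T.exists_link i' c' h
    rw [hx, link_comm_al]
  · rw [link_neg _ _ _ h, Category.comp_id, Category.id_comp]

/-- The vector of a partition whose last two points are in one block, in terms of that of its
restriction to the other points. -/
def vecStep {n : ℕ} (w : Setoid (Fin n) → (T.ob 0 ⟶ T.ob n)) (q : Setoid (Fin (n + 2))) :
    T.ob 0 ⟶ T.ob (n + 2) :=
  w (restrict q) ≫ T.d n ≫ T.link cc (fun x => q (cc x) (pen n)) (pen n)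

open scoped Classical in
/-- The vector of an even partition. -/
def vec : ∀ n, Setoid (Fin n) → (T.ob 0 ⟶ T.ob n)
  | 0, _ => 𝟙 _
  -- A default value, as a single point has no even partition. The `0` in the last case is likewise
  -- never reached by an even partition, by `exists_perm_pen_lst`.
  | 1, _ => 0
  | n + 2, p => if h : ∃ σ : Perm (Fin (n + 2)), p (σ (pen n)) (σ (lst n)) then
      T.vecStep (vec n) (p.comap h.choose) ≫ T.perm h.choose else 0

lemma exists_vec {n : ℕ} {p : Setoid (Fin (n + 2))} (hp : IsEven p) :
    ∃ σ : Perm (Fin (n + 2)), p (σ (pen n)) (σ (lst n)) ∧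
      T.vec (n + 2) p = T.vecStep (T.vec n) (p.comap σ) ≫ T.perm σ := by
  have h := exists_perm_pen_lst hp
  refine ⟨h.choose, h.choose_spec, ?_⟩
  rw [vec, dif_pos h]

section Step
variable {n : ℕ} {w : Setoid (Fin n) → (T.ob 0 ⟶ T.ob n)}

/-- The strand chosen in `link` can be replaced by any other in the block: the vector of the
restriction absorbs the vertex on the two strands, and `al_al` exchanges them. -/
lemma vecStep_eq {q : Setoid (Fin (n + 2))} (hw : restrict q ≤ T.absorb (w (restrict q))) (x : Fin n)
    (hx : q (cc x) (pen n)) :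
    T.vecStep w q = w (restrict q) ≫ T.d n ≫ T.al (cc x) (pen n) := by
  obtain ⟨y, hy, e⟩ := T.exists_link cc (P := fun x => q (cc x) (pen n)) (pen n) ⟨x, hx⟩
  have h : restrict q x y := q.trans' hx (q.symm' hy)
  have h' := hw h
  rw [absorb_iff] at h'
  rw [vecStep, e, ← h', Category.assoc, Category.assoc, ← Category.assoc (T.al x y),
    ← Category.assoc (T.al x y), T.d_nat, up_al, up_al, Category.assoc, Category.assoc,
    T.al_al (cc x) (cc y)]

lemma vecStep_eq' {q : Setoid (Fin (n + 2))} (h : ¬ ∃ x : Fin n, q (cc x) (pen n)) :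
    T.vecStep w q = w (restrict q) ≫ T.d n := by
  rw [vecStep, link_neg _ _ _ h, Category.comp_id]

/-- A vertex on the first `n` strands slides through to `w`, the one on the last pair is absorbed by
the coevaluation, and one between a point of the block and the last pair is absorbed by the link,
which is idempotent. Transitivity covers the remaining pairs. -/
lemma le_absorb_vecStep {q : Setoid (Fin (n + 2))} (hq : q (pen n) (lst n))
    (hw : restrict q ≤ T.absorb (w (restrict q))) : q ≤ T.absorb (T.vecStep w q) := by
  have h1 : ∀ x y, restrict q x y → T.absorb (T.vecStep w q) (cc x) (cc y) := by
    intro x y h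
    have h' := hw h
    rw [absorb_iff] at *
    rw [vecStep, Category.assoc, Category.assoc, link_comm_al, ← up_al, ← up_al,
      ← Category.assoc (T.d n), ← T.d_nat, Category.assoc, ← Category.assoc, h']
  have h2 : T.absorb (T.vecStep w q) (pen n) (lst n) := by
    rw [absorb_iff, vecStep, Category.assoc, Category.assoc, link_comm_al, al_last,
      ← Category.assoc (T.d n), T.d_a]
  have h3 : ∀ x, q (cc x) (pen n) → T.absorb (T.vecStep w q) (cc x) (pen n) := by
    intro x hx
    rw [absorb_iff, T.vecStep_eq hw x hx, Category.assoc, Category.assoc, al_idem]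
  have h4 : ∀ u, q u (pen n) → T.absorb (T.vecStep w q) u (pen n) := by
    intro u hu
    induction u using cc_cases with
    | h x => exact h3 x hu
    | h1 => exact Setoid.refl' _ _
    | h2 => exact Setoid.symm' _ h2
  have h5 : ∀ u v, q u v → q u (pen n) → T.absorb (T.vecStep w q) u v := fun u v h h' =>
    Setoid.trans' _ (h4 u h') (Setoid.symm' _ (h4 v (q.trans' (q.symm' h) h')))
  intro u v h
  induction u using cc_cases with
  | h x =>
    induction v using cc_cases with
    | h y => exact h1 x y h
    | h1 => exact h4 _ h
    | h2 => exact h5 _ _ h (q.trans' h (q.symm' hq))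
  | h1 => exact h5 _ _ h (q.refl' _)
  | h2 => exact h5 _ _ h (q.symm' hq)

/-- Permutations of the first `n` points. -/
lemma vecStep_lift {q : Setoid (Fin (n + 2))} (τ : Perm (Fin n))
    (hE : w ((restrict q).comap τ) ≫ T.perm τ = w (restrict q)) 
    (hw : restrict q ≤ T.absorb (w (restrict q)))
    (hw' : (restrict q).comap τ ≤ T.absorb (w ((restrict q).comap τ))) :
    T.vecStep w (q.comap (liftPerm (liftPerm τ))) ≫ T.perm (liftPerm (liftPerm τ)) =
      T.vecStep w q := by
  have hr : restrict (q.comap (liftPerm (liftPerm τ))) = (restrict q).comap τ := by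
    refine Setoid.ext fun x y => ?_
    change q _ _ ↔ q _ _
    rw [liftPerm_liftPerm_cc, liftPerm_liftPerm_cc]
  have hp : ∀ x, q.comap (liftPerm (liftPerm τ)) (cc x) (pen n) ↔ q (cc (τ x)) (pen n) := by
    intro x
    change q _ _ ↔ q _ _
    rw [liftPerm_liftPerm_cc, liftPerm_liftPerm_pen]
  by_cases h : ∃ x, q (cc x) (pen n)
  · obtain ⟨x, hx⟩ := h
    rw [T.vecStep_eq hw x hx, T.vecStep_eq (by rw [hr]; exact hw') (τ⁻¹ x) (by rw [hp]; simpa),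
      Category.assoc, Category.assoc, al_perm, liftPerm_liftPerm_cc, liftPerm_liftPerm_pen, hr,
      T.perm_liftPerm, T.perm_liftPerm, ← Category.assoc (T.d n), ← T.d_nat, Category.assoc,
      ← Category.assoc, hE]
    simp
  · rw [T.vecStep_eq' h, T.vecStep_eq' (fun ⟨x, hx⟩ => h ⟨_, (hp x).1 hx⟩), hr, T.perm_liftPerm,
      T.perm_liftPerm, Category.assoc, ← T.d_nat, ← Category.assoc, hE]
end Step
end NeutralTower


/-! ### Independence of the vectors of the choices -/

namespace NeutralTower
open Equiv StrandTower PartCat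
variable {t : ℂ} {D : Type u} [Category.{v} D] [Preadditive D] [Linear ℂ D] (T : NeutralTower t D)

/-- For the last four points the factors on the right are adjacent transpositions, which act by the
crossings `s` and their lifts. -/
lemma block_swap_eq {α : Type*} [DecidableEq α] {p q r s : α} (h : [p, q, r, s].Nodup) :
    swap p r * swap q s = swap q r * swap p q * swap r s * swap q r := by
  simp only [List.nodup_cons, List.mem_cons, List.not_mem_nil, or_false, not_or,
    List.nodup_nil, and_true, not_false_iff] at h
  obtain ⟨⟨h1, h2, h3⟩, ⟨h4, h5⟩, h6⟩ := h
  ext1 x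
  simp only [Perm.mul_apply, swap_apply_def]
  grind

lemma nodup_last_four (m : ℕ) :
    [cc (pen m), cc (lst m), pen (m + 2), lst (m + 2)].Nodup := by
  simp [Fin.ext_iff]; omega

/-- The exchange of the last two pairs of points. -/
abbrev blockSwap (m : ℕ) : Perm (Fin (m + 4)) :=
  swap (cc (pen m)) (pen (m + 2)) * swap (cc (lst m)) (lst (m + 2))

/-- Sliding the second coevaluation past the two strands of the first turns it into `up (up (d m))`.
By naturality of `d`, the two pairs may be created in either order. -/
lemma d_d_blockSwap (m : ℕ) :
    T.d m ≫ T.d (m + 2) ≫ T.perm (blockSwap m) = T.d m ≫ T.d (m + 2) := by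
  have hs1 : T.perm (swap (cc (lst m)) (pen (m + 2))) = T.up (T.s (m + 1)) := by
    rw [← perm_swap_pen, ← T.perm_liftPerm, liftPerm_swap]
  have hs2 : T.perm (swap (cc (pen m)) (cc (lst m))) = T.up (T.up (T.s m)) := by
    rw [← perm_swap_pen, ← T.perm_liftPerm, liftPerm_swap, ← T.perm_liftPerm, liftPerm_swap]
  have e : T.d (m + 2) ≫ T.perm (blockSwap m) = T.up (T.up (T.d m)) := by
    rw [blockSwap, block_swap_eq (nodup_last_four m), T.perm_mul, T.perm_mul, T.perm_mul, hs1, hs2,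
      perm_swap_pen]
    rw [← T.d_slide, T.up_comp, T.up_comp, ← T.d_slide]
    simp only [Category.assoc]
  rw [e, ← T.d_nat]

/-- Equivariance and absorption for the vectors of the even partitions of `n` points. -/
structure VecProps (n : ℕ) : Prop where
  perm (p : Setoid (Fin n)) (_ : IsEven p) (σ : Perm (Fin n)) :
    T.vec n (p.comap σ) ≫ T.perm σ = T.vec n p
  absorb (p : Setoid (Fin n)) (_ : IsEven p) : p ≤ T.absorb (T.vec n p)
  step (m : ℕ) (_ : n = m + 2) (p : Setoid (Fin (m + 2))) (_ : IsEven p)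
    (_ : p (pen m) (lst m)) : T.vec (m + 2) p = T.vecStep (T.vec m) p

/-- If the last two pairs belong to different blocks, neither link touches the other pair. Two steps
of the recursion then take a form in which the two pairs play the same role up to order. -/
lemma vecStep_vecStep {m : ℕ} (H : T.VecProps (m + 2)) {q : Setoid (Fin (m + 4))} (hq : IsEven q)
    (h1 : q (pen (m + 2)) (lst (m + 2))) (h2 : q (cc (pen m)) (cc (lst m)))
    (h3 : ¬ q (cc (pen m)) (pen (m + 2))) :
    T.vecStep (T.vec (m + 2)) q = T.vec m (restrict (restrict q)) ≫ T.d m ≫ T.d (m + 2) ≫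
      T.link (fun z => cc (cc z)) (fun z => q (cc (cc z)) (cc (pen m))) (cc (pen m)) ≫
      T.link (fun z => cc (cc z)) (fun z => q (cc (cc z)) (pen (m + 2))) (pen (m + 2)) := by
  have he := isEven_restrict hq h1
  have e1 : T.vec (m + 2) (restrict q) ≫ T.d (m + 2) = T.vec m (restrict (restrict q)) ≫ T.d m ≫
      T.d (m + 2) ≫ T.link (fun z => cc (cc z)) (fun z => q (cc (cc z)) (cc (pen m))) (cc (pen m)) := by
    rw [H.step m rfl _ he h2, vecStep, Category.assoc, Category.assoc, T.d_nat, up_link, up_link]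
    rfl
  by_cases h : ∃ z : Fin m, q (cc (cc z)) (pen (m + 2))
  · obtain ⟨z, hz, e⟩ := T.exists_link (fun z => cc (cc z)) (pen (m + 2)) h
    rw [e, T.vecStep_eq (H.absorb _ he) (cc z) hz, ← Category.assoc, e1]
    simp only [Category.assoc]
  · have h' : ¬ ∃ x, q (cc x) (pen (m + 2)) := by
      rintro ⟨x, hx⟩
      induction x using cc_cases with
      | h z => exact h ⟨z, hx⟩
      | h1 => exact h3 hx
      | h2 => exact h3 (q.trans' h2 hx)
    rw [link_neg _ _ _ h, T.vecStep_eq' h', e1, Category.comp_id]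

lemma blockSwap_cc_cc {m : ℕ} (z : Fin m) : blockSwap m (cc (cc z)) = cc (cc z) := by
  rw [blockSwap, Perm.mul_apply,
    swap_apply_of_ne_of_ne (cc_injective.ne (cc_ne_lst z)) (cc_ne_lst _),
    swap_apply_of_ne_of_ne (cc_injective.ne (cc_ne_pen z)) (cc_ne_pen _)]

lemma blockSwap_apply (m : ℕ) : blockSwap m (cc (pen m)) = pen (m + 2) ∧
    blockSwap m (cc (lst m)) = lst (m + 2) ∧ blockSwap m (pen (m + 2)) = cc (pen m) ∧
    blockSwap m (lst (m + 2)) = cc (lst m) := by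
  have h := nodup_last_four m
  simp only [List.nodup_cons, List.mem_cons, List.not_mem_nil, or_false, not_or,
    List.nodup_nil, and_true, not_false_iff] at h
  obtain ⟨⟨h1, h2, h3⟩, ⟨h4, h5⟩, h6⟩ := h
  simp only [blockSwap, Perm.mul_apply, swap_apply_def]
  refine ⟨?_, ?_, ?_, ?_⟩ <;> simp [*, Ne.symm h1, Ne.symm h3, Ne.symm h5, Ne.symm h4, Ne.symm h6]

/-- In the form of `vecStep_vecStep` the coevaluations can be exchanged by `d_d_blockSwap`, and the
links commute. -/
lemma vecStep_blockSwap {m : ℕ} (H : T.VecProps (m + 2)) {q : Setoid (Fin (m + 4))} (hq : IsEven q)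
    (h1 : q (pen (m + 2)) (lst (m + 2))) (h2 : q (cc (pen m)) (cc (lst m)))
    (h3 : ¬ q (cc (pen m)) (pen (m + 2))) :
    T.vecStep (T.vec (m + 2)) (q.comap (blockSwap m)) ≫ T.perm (blockSwap m) =
      T.vecStep (T.vec (m + 2)) q := by
  obtain ⟨k1, k2, k3, k4⟩ := blockSwap_apply m
  have k0 : ∀ z : Fin m, blockSwap m (cc (cc z)) = cc (cc z) := blockSwap_cc_cc
  have hc : ∀ u v, q.comap (blockSwap m) u v ↔ q (blockSwap m u) (blockSwap m v) :=
    fun _ _ => Iff.rfl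
  have hr : restrict (restrict (q.comap (blockSwap m))) = restrict (restrict q) := by
    refine Setoid.ext fun x y => ?_
    change q _ _ ↔ q _ _
    rw [k0, k0]
  rw [T.vecStep_vecStep H hq h1 h2 h3,
    T.vecStep_vecStep H (isEven_comap hq _) (by rw [hc, k3, k4]; exact h2)
      (by rw [hc, k1, k2]; exact h1) (by rw [hc, k1, k3]; exact fun h => h3 (q.symm' h)), hr]
  simp only [hc, k0, k1, k3, Category.assoc]
  rw [link_perm, k3]
  simp only [k0]
  rw [← Category.assoc (T.link _ _ _) (T.perm _), link_perm, k1]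
  simp only [k0, Category.assoc]
  have e := T.d_d_blockSwap m
  rw [← Category.assoc (T.d (m + 2)) (T.perm _), ← Category.assoc (T.d m), e, Category.assoc,
    link_comm]

/-- The vector does not depend on the choice of the two points of one block that are moved to the
end. -/
lemma vecStep_perm {n : ℕ} (H : T.VecProps n) {q : Setoid (Fin (n + 2))} (hq : IsEven q)
    (h : q (pen n) (lst n)) (σ : Perm (Fin (n + 2))) (hσ : q (σ (pen n)) (σ (lst n))) :
    T.vecStep (T.vec n) (q.comap σ) ≫ T.perm σ = T.vecStep (T.vec n) q := by
  -- A permutation that fixes the last pair only relabels the other points, where equivariance is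
  -- known by induction.
  have hlift : ∀ {q : Setoid (Fin (n + 2))}, IsEven q → q (pen n) (lst n) →
      ∀ σ : Perm (Fin (n + 2)), σ (pen n) = pen n → σ (lst n) = lst n →
      T.vecStep (T.vec n) (q.comap σ) ≫ T.perm σ = T.vecStep (T.vec n) q := by
    intro q hq h σ h1 h2
    obtain ⟨τ, rfl⟩ := exists_lift_lift σ h1 h2
    have he := isEven_restrict hq h
    exact T.vecStep_lift τ (H.perm _ he τ) (H.absorb _ he) (H.absorb _ (isEven_comap he τ))
  -- If the new pair lies in the block of the old one, two transpositions inside this block carry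
  -- the old pair to the new one. They preserve `q` and are absorbed by the vector; what remains of
  -- `σ` fixes the last pair.
  by_cases hB : q (pen n) (σ (pen n))
  · have hab := T.le_absorb_vecStep h (H.absorb _ (isEven_restrict hq h))
    have hswap : ∀ x y, q x y → T.vecStep (T.vec n) (q.comap (swap x y)) ≫ T.perm (swap x y) =
        T.vecStep (T.vec n) q := fun x y hxy => by
      rw [comap_swap hxy, T.comp_perm_swap (hab hxy)]
    set κ₁ := swap (pen n) (σ (pen n)) with hκ₁
    have c1 : q.comap κ₁ = q := comap_swap hB
    have r2 : q (κ₁ (lst n)) (σ (lst n)) := by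
      have : q.comap κ₁ (pen n) (lst n) := by rw [c1]; exact h
      have : q (κ₁ (pen n)) (κ₁ (lst n)) := this
      rw [hκ₁, swap_apply_left, ← hκ₁] at this
      exact q.trans' (q.symm' this) hσ
    set κ₂ := swap (κ₁ (lst n)) (σ (lst n)) with hκ₂
    have c2 : q.comap κ₂ = q := comap_swap r2
    have e1 : (κ₂ * κ₁) (pen n) = σ (pen n) := by
      have h1 : κ₁ (pen n) = σ (pen n) := by rw [hκ₁, swap_apply_left]
      rw [Perm.mul_apply, h1, hκ₂, swap_apply_of_ne_of_ne]
      · rw [← h1]; exact κ₁.injective.ne (pen_ne_lst n)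
      · exact σ.injective.ne (pen_ne_lst n)
    have e2 : (κ₂ * κ₁) (lst n) = σ (lst n) := by
      rw [Perm.mul_apply, hκ₂, swap_apply_left]
    have hσ' : σ = κ₂ * κ₁ * ((κ₂ * κ₁)⁻¹ * σ) := by rw [mul_inv_cancel_left]
    have cκ : q.comap (κ₂ * κ₁) = q := by
      change (q.comap κ₂).comap κ₁ = q
      rw [c2, c1]
    have eκ : T.vecStep (T.vec n) q ≫ T.perm (κ₂ * κ₁) = T.vecStep (T.vec n) q := by
      rw [T.perm_mul, ← Category.assoc, T.comp_perm_swap (hab hB), T.comp_perm_swap (hab r2)]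
    have hl := hlift hq h ((κ₂ * κ₁)⁻¹ * σ) (by rw [Perm.mul_apply, ← e1]; simp)
      (by rw [Perm.mul_apply, ← e2]; simp)
    have cq : q.comap σ = q.comap ((κ₂ * κ₁)⁻¹ * σ) := by
      nth_rw 1 [hσ']
      change (q.comap (κ₂ * κ₁)).comap _ = _
      rw [cκ]
    rw [cq]
    nth_rw 2 [hσ']
    rw [T.perm_mul, ← Category.assoc, hl, eκ]
  -- If the new pair lies in another block, it consists of two of the first `n` points. Then `σ` is
  -- a product of `κ`, relating the new pair to the places just before the last pair, of the
  -- exchange of the two pairs, and of `l`, which fixes the last pair.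
  · have aux : ∀ u, q u (σ (pen n)) → ∃ x : Fin n, u = cc x := by
      intro u hu
      induction u using cc_cases with
      | h x => exact ⟨x, rfl⟩
      | h1 => exact absurd hu hB
      | h2 => exact absurd (q.trans' h hu) hB
    obtain ⟨x, hx⟩ := aux (σ (pen n)) (q.refl' _)
    obtain ⟨y, hy⟩ := aux (σ (lst n)) (q.symm' hσ)
    have hxy : x ≠ y := by
      rintro rfl
      exact pen_ne_lst n (σ.injective (hx.trans hy.symm))
    obtain ⟨m, rfl⟩ : ∃ m, n = m + 2 := ⟨n - 2, by omega⟩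
    obtain ⟨τ, h1, h2⟩ := exists_perm_two (pen_ne_lst m) hxy
    set κ := liftPerm (liftPerm τ) with hκ
    set q' := q.comap κ with hq'
    set l := (κ * blockSwap m)⁻¹ * σ with hl
    have hσl : σ = κ * (blockSwap m * l) := by rw [hl]; simp [mul_assoc]
    obtain ⟨k1, k2, k3, k4⟩ := blockSwap_apply m
    have kp : (κ * blockSwap m) (pen (m + 2)) = σ (pen (m + 2)) := by
      rw [Perm.mul_apply, k3, hκ, liftPerm_liftPerm_cc, h1, hx]
    have kl : (κ * blockSwap m) (lst (m + 2)) = σ (lst (m + 2)) := by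
      rw [Perm.mul_apply, k4, hκ, liftPerm_liftPerm_cc, h2, hy]
    have lp : l (pen (m + 2)) = pen (m + 2) := by rw [hl, Perm.mul_apply, ← kp]; simp
    have ll : l (lst (m + 2)) = lst (m + 2) := by rw [hl, Perm.mul_apply, ← kl]; simp
    have q1 : q' (pen (m + 2)) (lst (m + 2)) := by
      change q (κ _) (κ _)
      rwa [hκ, liftPerm_liftPerm_pen, liftPerm_liftPerm_lst]
    have q2 : q' (cc (pen m)) (cc (lst m)) := by
      change q (κ _) (κ _)
      rw [hκ, liftPerm_liftPerm_cc, liftPerm_liftPerm_cc, h1, h2, ← hx, ← hy]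
      exact hσ
    have q3 : ¬ q' (cc (pen m)) (pen (m + 2)) := by
      change ¬ q (κ _) (κ _)
      rw [hκ, liftPerm_liftPerm_cc, liftPerm_liftPerm_pen, h1, ← hx]
      exact fun h => hB (q.symm' h)
    have hq'e : IsEven q' := isEven_comap hq _
    have s1 := hlift hq h κ (liftPerm_liftPerm_pen τ) (liftPerm_liftPerm_lst τ)
    have s2 := T.vecStep_blockSwap H hq'e q1 q2 q3
    have s3 := hlift (isEven_comap hq'e (blockSwap m))
      (by change q' (blockSwap m _) (blockSwap m _); rw [k3, k4]; exact q2) l lp ll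
    have cq : q.comap σ = ((q.comap κ).comap (blockSwap m)).comap l := by
      nth_rw 1 [hσl]
      rfl
    rw [cq, hσl, T.perm_mul, T.perm_mul, Category.assoc, ← Category.assoc, s3, ← Category.assoc, s2, s1]

lemma vecProps_zero : T.VecProps 0 where
  perm p _ σ := by
    have : σ = 1 := Subsingleton.elim _ _
    subst this
    rw [T.perm_one, Category.comp_id]
    rfl
  absorb p _ x := x.elim0
  step m h := by omega

lemma vecProps_one : T.VecProps 1 where
  perm p _ σ := zero_comp
  absorb p _ x y _ := zero_comp
  step m h := by omega

/-- If `ρ'` is the choice for `p.comap σ`, then `σ * ρ'` is an admissible choice for `p`, and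
`vecStep_perm` compares it with the choice `ρ` made for `p`. -/
lemma vecProps_add_two {n : ℕ} (H : T.VecProps n) : T.VecProps (n + 2) where
  perm p hp σ := by
    obtain ⟨ρ, h1, e1⟩ := T.exists_vec hp
    obtain ⟨ρ', h2, e2⟩ := T.exists_vec (isEven_comap hp σ)
    rw [e1, e2]
    have := T.vecStep_perm H (isEven_comap hp ρ) h1 (ρ⁻¹ * (σ * ρ'))
      (by
        change p (ρ (ρ⁻¹ (σ (ρ' _)))) (ρ (ρ⁻¹ (σ (ρ' _))))
        have h3 : p (σ (ρ' (pen n))) (σ (ρ' (lst n))) := h2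
        simpa using h3)
    rw [← this, Category.assoc, Category.assoc, ← T.perm_mul, ← T.perm_mul, mul_inv_cancel_left]
    congr 2
    refine Setoid.ext fun x y => ?_
    change p (σ (ρ' _)) (σ (ρ' _)) ↔ p (ρ (ρ⁻¹ (σ (ρ' _)))) (ρ (ρ⁻¹ (σ (ρ' _))))
    simp
  absorb p hp := by
    obtain ⟨ρ, h1, e1⟩ := T.exists_vec hp
    rw [e1]
    intro x y hxy
    have he := isEven_comap hp ρ
    have := T.le_absorb_vecStep h1 (H.absorb _ (isEven_restrict he h1))
    have h2 := T.absorb_perm _ ρ (ρ⁻¹ x) (ρ⁻¹ y) (this (by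
      change p (ρ (ρ⁻¹ x)) (ρ (ρ⁻¹ y))
      simpa using hxy))
    simpa using h2
  step m hm p hp h := by
    obtain rfl : n = m := by omega
    obtain ⟨ρ, h1, e1⟩ := T.exists_vec hp
    rw [e1, T.vecStep_perm H hp h ρ h1]

lemma vecProps : ∀ n, T.VecProps n
  | 0 => T.vecProps_zero
  | 1 => T.vecProps_one
  | n + 2 => T.vecProps_add_two (vecProps n)

lemma vec_perm {n : ℕ} {p : Setoid (Fin n)} (hp : IsEven p) (σ : Perm (Fin n)) :
    T.vec n (p.comap σ) ≫ T.perm σ = T.vec n p := (T.vecProps n).perm p hp σ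

lemma vec_al_of_rel {n : ℕ} {p : Setoid (Fin n)} (hp : IsEven p) {x y : Fin n} (h : p x y) :
    T.vec n p ≫ T.al x y = T.vec n p := (T.vecProps n).absorb p hp h

lemma vec_eq_vecStep {n : ℕ} {p : Setoid (Fin (n + 2))} (hp : IsEven p) (h : p (pen n) (lst n)) :
    T.vec (n + 2) p = T.vecStep (T.vec n) p := (T.vecProps (n + 2)).step n rfl p hp h

lemma vec_eq_d_al {n : ℕ} {p : Setoid (Fin (n + 2))} (hp : IsEven p) (h : p (pen n) (lst n))
    (x : Fin n) (hx : p (cc x) (pen n)) :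
    T.vec (n + 2) p = T.vec n (restrict p) ≫ T.d n ≫ T.al (cc x) (pen n) := by
  rw [T.vec_eq_vecStep hp h]
  exact T.vecStep_eq ((T.vecProps n).absorb _ (isEven_restrict hp h)) x hx

lemma vec_eq_d {n : ℕ} {p : Setoid (Fin (n + 2))} (hp : IsEven p) (h : p (pen n) (lst n))
    (hx : ¬ ∃ x : Fin n, p (cc x) (pen n)) :
    T.vec (n + 2) p = T.vec n (restrict p) ≫ T.d n := by
  rw [T.vec_eq_vecStep hp h]
  exact T.vecStep_eq' hx

end NeutralTower


/-! ### The action of vertices and evaluations on the vectors -/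

namespace NeutralTower
open Equiv StrandTower PartCat
variable {t : ℂ} {D : Type u} [Category.{v} D] [Preadditive D] [Linear ℂ D] (T : NeutralTower t D)

/-- If the block of the last pair has a point `x` among the first `n`, the vertex can be moved to
`x` and `y`, where the induction hypothesis joins the blocks. Otherwise the vertex is itself the
link of the enlarged block. -/
lemma vec_al_pen_of_not_rel {n : ℕ} {q : Setoid (Fin (n + 2))} (hq : IsEven q)
    (h : q (pen n) (lst n)) (y : Fin n)
    (ih : ∀ p : Setoid (Fin n), IsEven p → ∀ x y, T.vec n p ≫ T.al x y = T.vec n (joinBlocks p x y)) :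
    T.vec (n + 2) q ≫ T.al (pen n) (cc y) = T.vec (n + 2) (joinBlocks q (pen n) (cc y)) := by
  have hr := isEven_restrict hq h
  rw [T.vec_eq_d_al (p := joinBlocks q (pen n) (cc y)) (isEven_joinBlocks hq _ _) (Or.inl h) y
    (Or.inr (Or.inr ⟨q.refl' _, q.refl' _⟩))]
  by_cases hx : ∃ x : Fin n, q (cc x) (pen n)
  · obtain ⟨x, hx⟩ := hx
    have e : restrict (joinBlocks q (pen n) (cc y)) = joinBlocks (restrict q) x y := by
      refine Setoid.ext fun u v => ?_
      have key : ∀ u, q (cc u) (pen n) ↔ q (cc u) (cc x) := fun u =>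
        ⟨fun h => q.trans' h (q.symm' hx), fun h => q.trans' h hx⟩
      change (q _ _ ∨ _ ∨ _) ↔ (q _ _ ∨ _ ∨ _)
      rw [key, key]
      rfl
    rw [e, ← ih _ hr, T.vec_eq_d_al hq h x hx]
    simp only [Category.assoc]
    rw [← Category.assoc (T.al x y), T.d_nat, up_al, up_al]
    simp only [Category.assoc]
    rw [T.al_symm (cc x) (pen n), al_al, T.al_symm (pen n) (cc x), al_comm, T.al_symm (cc x) (cc y),
      T.al_al (cc y) (cc x) (pen n)]
  · have e : restrict (joinBlocks q (pen n) (cc y)) = restrict q := by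
      refine Setoid.ext fun u v => ⟨?_, Or.inl⟩
      rintro (h | ⟨h, -⟩ | ⟨-, h⟩)
      · exact h
      · exact absurd ⟨u, h⟩ hx
      · exact absurd ⟨v, h⟩ hx
    rw [e, T.vec_eq_d hq h hx, T.al_symm, Category.assoc]

/-- A four-legged vertex joins two blocks. -/
lemma vec_al : ∀ (n : ℕ) (p : Setoid (Fin n)), IsEven p → ∀ x y,
    T.vec n p ≫ T.al x y = T.vec n (joinBlocks p x y)
  | 0, _, _, x, _ => x.elim0
  | 1, p, hp, x, y => by
    obtain rfl : x = y := Fin.ext (by omega)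
    rw [al_self, Category.comp_id, joinBlocks_of_rel (p.refl' x)]
  | n + 2, p, hp, x, y => by
    by_cases hxy : p x y
    · rw [T.vec_al_of_rel hp hxy, joinBlocks_of_rel hxy]
    -- The point `x` and a partner in its block are moved to the last two places. As `y` belongs to
    -- another block, it then lies among the first `n` points.
    · obtain ⟨z, hz, hzx⟩ := exists_partner hp x
      obtain ⟨σ, rfl, rfl⟩ := exists_perm_two (pen_ne_lst n) (Ne.symm hz)
      obtain ⟨y, rfl⟩ := σ.surjective y
      have h : p.comap σ (pen n) (lst n) := p.symm' hzx
      have hxy' : ¬ p.comap σ (pen n) y := hxy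
      obtain ⟨y, rfl⟩ : ∃ y', y = cc y' := by
        induction y using cc_cases with
        | h y => exact ⟨y, rfl⟩
        | h1 => exact absurd ((p.comap σ).refl' _) hxy'
        | h2 => exact absurd h hxy'
      have hp' := isEven_comap hp σ
      rw [← T.vec_perm hp σ, ← T.vec_perm (isEven_joinBlocks hp _ _) σ, comap_joinBlocks,
        Category.assoc, ← al_perm, ← Category.assoc,
        T.vec_al_pen_of_not_rel hp' h y (vec_al n)]

/-- The partition of the first `n` points that arises by connecting the last two of `n + 2`
points. -/
abbrev contract {n : ℕ} (q : Setoid (Fin (n + 2))) : Setoid (Fin n) :=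
  restrict (joinBlocks q (pen n) (lst n))

/-- Conjugating by the exchange `f` of `x` with the last of the first `n` strands reduces this to
neighbouring strands, where it is the partial trace `d_up_a_b`. -/
lemma d_al_b {n : ℕ} (x : Fin n) : T.d n ≫ T.al (cc x) (pen n) ≫ T.b n = 𝟙 _ := by
  obtain ⟨k, rfl⟩ : ∃ k, n = k + 1 := ⟨n - 1, by have := x.2; omega⟩
  have h0 : T.d (k + 1) ≫ T.al (cc (Fin.last k)) (pen (k + 1)) ≫ T.b (k + 1) = 𝟙 _ := by
    rw [← T.d_up_a_b, up_a]
  have h1 := T.al_perm (cc (Fin.last k)) (pen (k + 1)) (liftPerm (liftPerm (swap (Fin.last k) x)))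
  rw [liftPerm_liftPerm_cc, liftPerm_liftPerm_pen, swap_apply_left, T.perm_liftPerm,
    T.perm_liftPerm] at h1
  set f := T.perm (swap (Fin.last k) x) with hf
  have hff : f ≫ f = 𝟙 _ := by rw [hf, ← T.perm_mul, swap_mul_self, T.perm_one]
  calc _ = f ≫ (f ≫ T.d (k + 1)) ≫ T.al (cc x) (pen (k + 1)) ≫ T.b (k + 1) := by
        rw [Category.assoc, ← Category.assoc f f, hff, Category.id_comp]
    _ = f ≫ T.d (k + 1) ≫ T.al (cc (Fin.last k)) (pen (k + 1)) ≫ T.up (T.up f) ≫ T.b (k + 1) := by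
        rw [T.d_nat, Category.assoc, ← Category.assoc (T.up (T.up f)), ← h1, Category.assoc]
    _ = f ≫ (T.d (k + 1) ≫ T.al (cc (Fin.last k)) (pen (k + 1)) ≫ T.b (k + 1)) ≫ f := by
        rw [T.b_nat]; simp only [Category.assoc]
    _ = _ := by rw [h0, Category.id_comp, hff]

/-- The same conjugation reduces this to neighbouring strands, where it is a zigzag with a crossing
that the coevaluation absorbs. -/
lemma d_perm_b {n : ℕ} (x : Fin n) : T.d n ≫ T.perm (swap (cc x) (pen n)) ≫ T.b n = 𝟙 _ := by
  obtain ⟨k, rfl⟩ : ∃ k, n = k + 1 := ⟨n - 1, by have := x.2; omega⟩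
  have h0 : T.d (k + 1) ≫ T.perm (swap (cc (Fin.last k)) (pen (k + 1))) ≫ T.b (k + 1) = 𝟙 _ := by
    have : T.perm (swap (cc (Fin.last k)) (pen (k + 1))) = T.up (T.s k) := by
      rw [← perm_swap_pen, ← T.perm_liftPerm, liftPerm_swap]
    rw [this, up_s_b, ← Category.assoc, d_s, T.zag]
  set f := T.perm (swap (Fin.last k) x) with hf
  have hff : f ≫ f = 𝟙 _ := by rw [hf, ← T.perm_mul, swap_mul_self, T.perm_one]
  have h1 : T.up (T.up f) ≫ T.perm (swap (cc x) (pen (k + 1))) =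
      T.perm (swap (cc (Fin.last k)) (pen (k + 1))) ≫ T.up (T.up f) := by
    rw [hf, ← T.perm_liftPerm, ← T.perm_liftPerm, ← T.perm_mul, ← T.perm_mul]
    congr 1
    rw [Equiv.mul_swap_eq_swap_mul, liftPerm_liftPerm_cc, liftPerm_liftPerm_pen, swap_apply_left]
  calc _ = f ≫ (f ≫ T.d (k + 1)) ≫ T.perm (swap (cc x) (pen (k + 1))) ≫ T.b (k + 1) := by
        rw [Category.assoc, ← Category.assoc f f, hff, Category.id_comp]
    _ = f ≫ T.d (k + 1) ≫ T.perm (swap (cc (Fin.last k)) (pen (k + 1))) ≫ T.up (T.up f) ≫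
          T.b (k + 1) := by
        rw [T.d_nat, Category.assoc, ← Category.assoc (T.up (T.up f)), h1, Category.assoc]
    _ = f ≫ (T.d (k + 1) ≫ T.perm (swap (cc (Fin.last k)) (pen (k + 1))) ≫ T.b (k + 1)) ≫ f := by
        rw [T.b_nat]; simp only [Category.assoc]
    _ = _ := by rw [h0, Category.id_comp, hff]

/-- Connecting the two points of a block of size two yields the factor `t`. -/
lemma vec_b_loop {n : ℕ} {q : Setoid (Fin (n + 2))} (hq : IsEven q) (h : q (pen n) (lst n))
    (hx : ¬ ∃ x : Fin n, q (cc x) (pen n)) :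
    T.vec (n + 2) q ≫ T.b n = t • T.vec n (contract q) := by
  rw [T.vec_eq_d hq h hx, contract, joinBlocks_of_rel h, Category.assoc, T.d_b, Linear.comp_smul,
    Category.comp_id]

/-- The pair is linked to the strand `x`, so closing it produces a partial trace of the vertex
instead of a loop. -/
lemma vec_b_of_rel {n : ℕ} {q : Setoid (Fin (n + 2))} (hq : IsEven q) (h : q (pen n) (lst n))
    (x : Fin n) (hx : q (cc x) (pen n)) :
    T.vec (n + 2) q ≫ T.b n = T.vec n (contract q) := by
  rw [T.vec_eq_d_al hq h x hx, contract, joinBlocks_of_rel h]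
  simp only [Category.assoc]
  rw [d_al_b, Category.comp_id]

/-- Let `k` be a partner of the last point. Moving `k` next to it, the coevaluation that creates
this pair and the evaluation form a zigzag, which puts the strand of the last point but one in the
place of `k`. -/
lemma vec_b_of_not_rel {n : ℕ} {q : Setoid (Fin (n + 2))} (hq : IsEven q)
    (h : ¬ q (pen n) (lst n)) :
    T.vec (n + 2) q ≫ T.b n = T.vec n (contract q) := by
  obtain ⟨k, hk⟩ : ∃ k : Fin n, q (cc k) (lst n) := by
    obtain ⟨z, hz, hz'⟩ := exists_partner hq (lst n)
    induction z using cc_cases with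
    | h k => exact ⟨k, hz'⟩
    | h1 => exact absurd hz' h
    | h2 => exact absurd rfl hz
  set σ := swap (cc k) (pen n) with hσ
  have hσk : σ (cc k) = pen n := swap_apply_left _ _
  have hσp : σ (pen n) = cc k := swap_apply_right _ _
  have hσl : σ (lst n) = lst n := swap_apply_of_ne_of_ne (cc_ne_lst k).symm (pen_ne_lst n).symm
  have hσx : ∀ x, x ≠ k → σ (cc x) = cc x := fun x hx =>
    swap_apply_of_ne_of_ne (cc_injective.ne hx) (cc_ne_pen x)
  have hrel : ∀ u v, q.comap σ u v ↔ q (σ u) (σ v) := fun _ _ => Iff.rfl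
  have hpl : q.comap σ (pen n) (lst n) := by rw [hrel, hσp, hσl]; exact hk
  have hkp : ¬ q (cc k) (pen n) := fun h' => h (q.trans' (q.symm' h') hk)
  have he := isEven_comap hq σ
  have tr := fun {a b c} => @Setoid.trans' _ q a b c
  have sy := fun {a b} => @Setoid.symm' _ q a b
  have rf := fun a => q.refl' a
  rw [← T.vec_perm hq σ]
  -- A further point `x` in the block of `k` contributes a link. It becomes a vertex on `x` and `k`
  -- after the evaluation and joins the two blocks by `vec_al`.
  by_cases hx : ∃ x : Fin n, q.comap σ (cc x) (pen n)
  · obtain ⟨x, hx⟩ := hx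
    have hxk : x ≠ k := by
      rintro rfl
      rw [hrel, hσk, hσp] at hx
      exact hkp (q.symm' hx)
    have hx' : q (cc x) (cc k) := by rwa [hrel, hσx x hxk, hσp] at hx
    rw [T.vec_eq_d_al he hpl x hx]
    simp only [Category.assoc]
    rw [← Category.assoc (T.al _ _), al_perm, Category.assoc, hσx x hxk, hσp, ← up_al, ← up_al,
      T.b_nat, ← Category.assoc (T.perm _), ← Category.assoc (T.d n), d_perm_b, Category.id_comp,
      T.vec_al _ _ (isEven_restrict he hpl)]
    congr 1
    refine Setoid.ext fun u v => ?_
    change (q (σ (cc u)) (σ (cc v)) ∨ (q (σ (cc u)) (σ (cc x)) ∧ q (σ (cc v)) (σ (cc k))) ∨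
      (q (σ (cc u)) (σ (cc k)) ∧ q (σ (cc v)) (σ (cc x)))) ↔
      (q (cc u) (cc v) ∨ (q (cc u) (pen n) ∧ q (cc v) (lst n)) ∨
        (q (cc u) (lst n) ∧ q (cc v) (pen n)))
    rw [hσx x hxk, hσk]
    have hl : ∀ w, q (cc w) (lst n) ↔ q (cc w) (cc x) := fun w =>
      ⟨fun h => tr h (tr (sy hk) (sy hx')), fun h => tr h (tr hx' hk)⟩
    rw [hl, hl]
    by_cases hu : u = k <;> by_cases hv : v = k
    · subst hu; subst hv
      exact ⟨fun _ => Or.inl (q.refl' _), fun _ => Or.inl (q.refl' _)⟩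
    · subst hu
      rw [hσk, hσx v hv]
      grind
    · subst hv
      rw [hσk, hσx u hu]
      grind
    · rw [hσx u hu, hσx v hv]
      grind
  · rw [T.vec_eq_d he hpl hx, Category.assoc, Category.assoc, d_perm_b, Category.comp_id]
    congr 1
    refine Setoid.ext fun u v => ?_
    change q (σ (cc u)) (σ (cc v)) ↔ (q (cc u) (cc v) ∨ (q (cc u) (pen n) ∧ q (cc v) (lst n)) ∨
        (q (cc u) (lst n) ∧ q (cc v) (pen n)))
    have hn : ∀ w, w ≠ k → ¬ q (cc w) (lst n) := fun w hw hwl => hx ⟨w, by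
      rw [hrel, hσx w hw, hσp]
      exact tr hwl (sy hk)⟩
    have hn' : ∀ w, w ≠ k → ¬ q (cc w) (cc k) := fun w hw hwl => hn w hw (tr hwl hk)
    by_cases hu : u = k <;> by_cases hv : v = k
    · subst hu; subst hv
      exact ⟨fun _ => Or.inl (q.refl' _), fun _ => q.refl' _⟩
    · subst hu
      rw [hσk, hσx v hv]
      have := hn v hv
      have := hn' v hv
      grind
    · subst hv
      rw [hσk, hσx u hu]
      have := hn u hu
      have := hn' u hu
      grind
    · rw [hσx u hu, hσx v hv]
      have := hn u hu
      have := hn v hv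
      grind

end NeutralTower


/-! ### Morphisms on the last factors of tensor powers -/

section TowerOfPowers
variable {C : Type u} [Category.{v} C] [MonoidalCategory C]

/-- A sequence of objects that are the tensor powers of `A` up to isomorphism. -/
structure PowerSeq (A : C) where
  /-- The powers. -/
  ob : ℕ → C
  /-- The comparison isomorphisms. -/
  e : ∀ n, ob n ⊗ A ≅ ob (n + 1)

namespace PowerSeq
variable {A : C} (P : PowerSeq A)

/-- The comparison isomorphism for two strands. -/
def e₂ (n : ℕ) : P.ob n ⊗ (A ⊗ A) ≅ P.ob (n + 2) :=
  (α_ _ _ _).symm ≪≫ whiskerRightIso (P.e n) A ≪≫ P.e (n + 1)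

/-- The comparison isomorphism for three strands. -/
def e₃ (n : ℕ) : P.ob n ⊗ (A ⊗ (A ⊗ A)) ≅ P.ob (n + 3) :=
  (α_ _ _ _).symm ≪≫ whiskerRightIso (P.e n) (A ⊗ A) ≪≫ P.e₂ (n + 1)

/-- The definition splits off the last two of the three strands; here only the last one is split
off, which is the grouping that `up` sees. -/
lemma e₃_eq (n : ℕ) : (P.e₃ n).hom =
    P.ob n ◁ (α_ A A A).inv ≫ (α_ _ _ _).inv ≫ (P.e₂ n).hom ▷ A ≫ (P.e (n + 2)).hom := by
  simp only [e₃, e₂, Iso.trans_hom, Iso.symm_hom, whiskerRightIso_hom, comp_whiskerRight,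
    Category.assoc, whiskerRight_tensor, Iso.hom_inv_id_assoc]
  simp

/-- Adding a strand on the right. -/
def up {n m : ℕ} (f : P.ob n ⟶ P.ob m) : P.ob (n + 1) ⟶ P.ob (m + 1) :=
  (P.e n).inv ≫ f ▷ A ≫ (P.e m).hom

lemma e_up {n m : ℕ} (f : P.ob n ⟶ P.ob m) : (P.e n).hom ≫ P.up f = f ▷ A ≫ (P.e m).hom := by
  simp [up]

lemma e₂_up_up {n m : ℕ} (f : P.ob n ⟶ P.ob m) :
    (P.e₂ n).hom ≫ P.up (P.up f) = f ▷ (A ⊗ A) ≫ (P.e₂ m).hom := by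
  simp only [e₂, Iso.trans_hom, Iso.symm_hom, whiskerRightIso_hom, Category.assoc, e_up]
  rw [← comp_whiskerRight_assoc, e_up]
  simp

/-- The morphism that is `g` on the last strands, and the identity on the first `n`. -/
def last {n n₁ n₂ : ℕ} {V W : C} (i : P.ob n ⊗ V ≅ P.ob n₁) (j : P.ob n ⊗ W ≅ P.ob n₂) (g : V ⟶ W) :
    P.ob n₁ ⟶ P.ob n₂ :=
  i.inv ≫ P.ob n ◁ g ≫ j.hom

lemma last_comp {n n₁ n₂ n₃ : ℕ} {V W Z : C} (i : P.ob n ⊗ V ≅ P.ob n₁) (j : P.ob n ⊗ W ≅ P.ob n₂)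
    (k : P.ob n ⊗ Z ≅ P.ob n₃) (g : V ⟶ W) (g' : W ⟶ Z) :
    P.last i j g ≫ P.last j k g' = P.last i k (g ≫ g') := by
  simp [last]

lemma last_comp_assoc {n n₁ n₂ n₃ m : ℕ} {V W Z : C} (i : P.ob n ⊗ V ≅ P.ob n₁)
    (j : P.ob n ⊗ W ≅ P.ob n₂) (k : P.ob n ⊗ Z ≅ P.ob n₃) (g : V ⟶ W) (g' : W ⟶ Z)
    (f : P.ob n₃ ⟶ P.ob m) :
    P.last i j g ≫ P.last j k g' ≫ f = P.last i k (g ≫ g') ≫ f := by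
  rw [← Category.assoc, last_comp]

lemma last_id {n n₁ : ℕ} {V : C} (i : P.ob n ⊗ V ≅ P.ob n₁) : P.last i i (𝟙 V) = 𝟙 _ := by
  simp [last]

variable (α : A ⊗ A ⟶ A ⊗ A) (β : A ⊗ A ⟶ 𝟙_ C) (δ : 𝟙_ C ⟶ A ⊗ A)

/-- Together with the lemmas `last_succ_endo`, `last_succ_ev` and `last_succ_coev`, this and its two
companions bring the relations on three strands into the form `P.last _ _ g`, where they become
relations between morphisms of `C` such as those of the axioms. -/
lemma up_last_endo (n : ℕ) : P.up (P.last (P.e₂ n) (P.e₂ n) α) =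
    P.last (P.e₃ n) (P.e₃ n) ((α_ A A A).inv ≫ α ▷ A ≫ (α_ A A A).hom) := by
  rw [last, last, ← cancel_epi (P.e₃ n).hom, Iso.hom_inv_id_assoc, e₃_eq]
  simp only [Category.assoc, e_up]
  simp only [comp_whiskerRight, Category.assoc, hom_inv_whiskerRight_assoc]
  simp

lemma up_last_ev (n : ℕ) : P.up (P.last (P.e₂ n) (ρ_ (P.ob n)) β) =
    P.last (P.e₃ n) (P.e n) ((α_ A A A).inv ≫ β ▷ A ≫ (λ_ A).hom) := by
  rw [last, last, ← cancel_epi (P.e₃ n).hom, Iso.hom_inv_id_assoc, e₃_eq]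
  simp only [Category.assoc, e_up]
  simp only [comp_whiskerRight, Category.assoc, hom_inv_whiskerRight_assoc]
  simp

lemma up_last_coev (n : ℕ) : P.up (P.last (ρ_ (P.ob n)) (P.e₂ n) δ) =
    P.last (P.e n) (P.e₃ n) ((λ_ A).inv ≫ δ ▷ A ≫ (α_ A A A).hom) := by
  rw [last, last, ← cancel_epi (P.e n).hom, Iso.hom_inv_id_assoc, e₃_eq]
  simp only [e_up]
  simp only [comp_whiskerRight, Category.assoc]
  simp

lemma e₂_succ_hom (n : ℕ) :
    (P.e₂ (n + 1)).hom = (P.e n).inv ▷ (A ⊗ A) ≫ (α_ _ _ _).hom ≫ (P.e₃ n).hom := by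
  simp [e₃, -whiskerRight_tensor]

lemma e₂_succ_inv (n : ℕ) :
    (P.e₂ (n + 1)).inv = (P.e₃ n).inv ≫ (α_ _ _ _).inv ≫ (P.e n).hom ▷ (A ⊗ A) := by
  simp [e₃, -whiskerRight_tensor]

lemma last_succ_endo (n : ℕ) : P.last (P.e₂ (n + 1)) (P.e₂ (n + 1)) α =
    P.last (P.e₃ n) (P.e₃ n) (A ◁ α) := by
  rw [last, last, e₂_succ_hom, e₂_succ_inv]
  simp only [Category.assoc, ← whisker_exchange_assoc, hom_inv_whiskerRight_assoc]
  simp [-whiskerRight_tensor]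

lemma last_succ_ev (n : ℕ) : P.last (P.e₂ (n + 1)) (ρ_ (P.ob (n + 1))) β =
    P.last (P.e₃ n) (P.e n) (A ◁ β ≫ (ρ_ A).hom) := by
  rw [last, last, e₂_succ_inv]
  simp only [Category.assoc, ← whisker_exchange_assoc]
  simp

lemma last_succ_coev (n : ℕ) : P.last (ρ_ (P.ob (n + 1))) (P.e₂ (n + 1)) δ =
    P.last (P.e n) (P.e₃ n) ((ρ_ A).inv ≫ A ◁ δ) := by
  rw [last, last, e₂_succ_hom]
  simp only [whisker_exchange_assoc]
  simp

end PowerSeq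
end TowerOfPowers


/-! ### The tower of an object with neutralizer -/

section Slides
variable {C : Type u} [Category.{v} C] [MonoidalCategory C]

/-- By the hexagon, two successive crossings form one braiding of `A` with `A ⊗ A`. The slide
relations are therefore instances of naturality of the braiding. -/
lemma braid_over_two [BraidedCategory C] (A : C) :
    ((α_ A A A).inv ≫ (β_ A A).hom ▷ A ≫ (α_ A A A).hom) ≫ A ◁ (β_ A A).hom =
      (β_ A (A ⊗ A)).hom ≫ (α_ A A A).hom := by
  simp

lemma endo_braid_over_two [BraidedCategory C] {A : C} (g : A ⊗ A ⟶ A ⊗ A) :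
    A ◁ g ≫ (β_ A (A ⊗ A)).hom ≫ (α_ A A A).hom =
      ((β_ A (A ⊗ A)).hom ≫ (α_ A A A).hom) ≫ (α_ A A A).inv ≫ g ▷ A ≫ (α_ A A A).hom := by
  rw [← Category.assoc, BraidedCategory.braiding_naturality_right]
  simp

lemma coev_braid_over_two [BraidedCategory C] {A : C} (δ : 𝟙_ C ⟶ A ⊗ A) :
    ((ρ_ A).inv ≫ A ◁ δ) ≫ (β_ A (A ⊗ A)).hom ≫ (α_ A A A).hom =
      (λ_ A).inv ≫ δ ▷ A ≫ (α_ A A A).hom := by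
  rw [Category.assoc, BraidedCategory.braiding_naturality_right_assoc, braiding_tensorUnit_right]
  simp

lemma braid_over_two_ev [BraidedCategory C] {A : C} (β : A ⊗ A ⟶ 𝟙_ C) :
    ((β_ A (A ⊗ A)).hom ≫ (α_ A A A).hom) ≫ (α_ A A A).inv ≫ β ▷ A ≫ (λ_ A).hom =
      A ◁ β ≫ (ρ_ A).hom := by
  rw [Category.assoc, Iso.hom_inv_id_assoc, ← BraidedCategory.braiding_naturality_right_assoc,
    braiding_tensorUnit_right]
  simp

namespace PowerSeq

variable {A : C} (P : PowerSeq A)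

/-- The tower of the powers of an object of a symmetric monoidal category. -/
def strandTower [SymmetricCategory C] (α : A ⊗ A ⟶ A ⊗ A) (β : A ⊗ A ⟶ 𝟙_ C)
    (δ : 𝟙_ C ⟶ A ⊗ A) : StrandTower C where
  ob := P.ob
  up := P.up
  up_id n := by simp [up]
  up_comp f g := by simp [up]
  s n := P.last (P.e₂ n) (P.e₂ n) (β_ A A).hom
  a n := P.last (P.e₂ n) (P.e₂ n) α
  b n := P.last (P.e₂ n) (ρ_ _) β
  d n := P.last (ρ_ _) (P.e₂ n) δ
  s_nat f := by
    rw [← cancel_epi (P.e₂ _).hom, ← Category.assoc, e₂_up_up]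
    simp [last, -whiskerRight_tensor, e₂_up_up, whisker_exchange_assoc]
  a_nat f := by
    rw [← cancel_epi (P.e₂ _).hom, ← Category.assoc, e₂_up_up]
    simp [last, -whiskerRight_tensor, e₂_up_up, whisker_exchange_assoc]
  b_nat f := by
    rw [← cancel_epi (P.e₂ _).hom, ← Category.assoc, e₂_up_up]
    simp [last, -whiskerRight_tensor, ← whisker_exchange_assoc]
  d_nat f := by
    simp [last, -whiskerRight_tensor, e₂_up_up, whisker_exchange_assoc]
  s_s n := by rw [last_comp, SymmetricCategory.symmetry, last_id]
  braid n := by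
    rw [up_last_endo, last_succ_endo, last_comp_assoc, last_comp, last_comp, last_comp]
    congr 1
    rw [braid_over_two, endo_braid_over_two, Category.assoc]
  a_slide n := by
    rw [up_last_endo, up_last_endo, last_succ_endo, last_succ_endo, last_comp, last_comp,
      last_comp_assoc, last_comp, braid_over_two, endo_braid_over_two]
  b_slide n := by
    rw [up_last_endo, up_last_ev, last_succ_endo, last_succ_ev, last_comp_assoc, last_comp,
      braid_over_two, braid_over_two_ev]
  d_slide n := by
    rw [up_last_endo, up_last_coev, last_succ_endo, last_succ_coev, last_comp, last_comp,
      braid_over_two, coev_braid_over_two]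

variable [Preadditive C] [Linear ℂ C] [MonoidalPreadditive C] [MonoidalLinear ℂ C]
  [SymmetricCategory C] {α : A ⊗ A ⟶ A ⊗ A} {β : A ⊗ A ⟶ 𝟙_ C} {δ : 𝟙_ C ⟶ A ⊗ A}

lemma last_smul {n n₁ n₂ : ℕ} {V W : C} (i : P.ob n ⊗ V ≅ P.ob n₁) (j : P.ob n ⊗ W ≅ P.ob n₂)
    (r : ℂ) (g : V ⟶ W) : P.last i j (r • g) = r • P.last i j g := by
  rw [last, last, MonoidalLinear.whiskerLeft_smul, Linear.smul_comp, Linear.comp_smul]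

lemma up_add {n m : ℕ} (f g : P.ob n ⟶ P.ob m) : P.up (f + g) = P.up f + P.up g := by
  rw [up, up, up, MonoidalPreadditive.add_whiskerRight, Preadditive.add_comp, Preadditive.comp_add]

lemma up_smul {n m : ℕ} (r : ℂ) (f : P.ob n ⟶ P.ob m) : P.up (r • f) = r • P.up f := by
  rw [up, up, MonoidalLinear.smul_whiskerRight, Linear.smul_comp, Linear.comp_smul]

/-- The tower of the powers of a self-dual object with neutralizer. -/
def neutralTower {t : ℂ} (h : IsSelfDualWithNeutralizer t A α β δ) : NeutralTower t C where
  toStrandTower := P.strandTower α β δ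
  a_a n := (P.last_comp _ _ _ _ _).trans (by rw [h.idem]; rfl)
  s_a n := (P.last_comp _ _ _ _ _).trans (by rw [h.swap]; rfl)
  a_comm n := by
    simp only [strandTower]
    rw [up_last_endo, last_succ_endo, last_comp, last_comp]
    congr 1
    simpa using (α_ A A A).inv ≫= h.commute
  d_a n := (P.last_comp _ _ _ _ _).trans (by rw [h.coev_neutral]; rfl)
  a_b n := (P.last_comp _ _ _ _ _).trans (by rw [h.ev_neutral]; rfl)
  d_b n := (P.last_comp _ _ _ _ _).trans (by rw [h.dim, last_smul, last_id]; rfl)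
  zig n := by
    simp only [strandTower]
    rw [up_last_coev, last_succ_ev, last_comp]
    simp only [Category.assoc, h.zigzag_left, last_id]
  zag n := by
    simp only [strandTower]
    rw [last_succ_coev, up_last_ev, last_comp]
    simp only [Category.assoc, h.zigzag_right, last_id]
  d_swing n := by
    simp only [strandTower]
    rw [up_last_coev, last_succ_coev, up_last_endo, last_succ_endo, last_comp, last_comp]
    simp only [Category.assoc, h.coev_slide]
  b_swing n := by
    simp only [strandTower]
    rw [up_last_ev, last_succ_ev, up_last_endo, last_succ_endo, last_comp, last_comp]
    simp only [Category.assoc, h.ev_slide]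
  up_add f g := P.up_add f g
  up_smul r f := P.up_smul r f

end PowerSeq
end Slides

section TensorPowers
variable {C : Type u} [Category.{v} C] [MonoidalCategory C]

/-- The tensor powers of `A`. -/
def tpowSeq (A : C) : PowerSeq A where
  ob := tpow A
  e := tpowSucc A
end TensorPowers


/-! ### Adjacent transpositions as generators -/

open Equiv in
/-- Permutations are generated by the exchanges of the last two points. -/
lemma perm_fin_induction {M : ∀ n, Perm (Fin n) → Prop} (one : ∀ n, M n 1)
    (mul : ∀ n σ τ, M n σ → M n τ → M n (σ * τ)) (lift : ∀ n σ, M n σ → M (n + 1) (liftPerm σ))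
    (last : ∀ n, M (n + 2) (swap (NeutralTower.pen n) (NeutralTower.lst n))) : ∀ n σ, M n σ
  | 0, σ => by rw [Subsingleton.elim σ 1]; exact one 0
  | n + 1, σ => by
    -- Exchanges of neighbours generate, and all but the last of them are lifts.
    have h : σ ∈ Submonoid.closure (Set.range fun i : Fin n ↦ swap i.castSucc i.succ) := by
      rw [Perm.mclosure_swap_castSucc_succ]; trivial
    induction h using Submonoid.closure_induction with
    | mem σ h =>
      obtain ⟨i, rfl⟩ := h
      obtain ⟨k, rfl⟩ : ∃ k, n = k + 1 := ⟨n - 1, by have := i.2; omega⟩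
      induction i using Fin.lastCases with
      | last => exact last k
      | cast i =>
        have := lift _ _ (perm_fin_induction one mul lift last (k + 1) (swap i.castSucc i.succ))
        rw [liftPerm_swap] at this
        exact this
    | one => exact one _
    | mul σ τ _ _ h h' => exact mul _ _ _ h h'

/-! ### Partitions of upper points composed with elementary diagrams -/

namespace PartCat
open NeutralTower

/-- A partition with upper points only. -/
abbrev flat {n : ℕ} (p : Setoid (Fin 0 ⊕ Fin n)) : Setoid (Fin n) := p.comap Sum.inr

lemma resp_flat {n : ℕ} (p : Setoid (Fin 0 ⊕ Fin n)) (i : Fin 0 → Bool) (k : Fin n → Bool) :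
    Resp (flat p) k ↔ Resp p (Sum.elim i k) := by
  rw [resp_comap]
  constructor
  · rintro ⟨g, hg, rfl⟩
    rw [Subsingleton.elim i (g ∘ Sum.inl), Sum.elim_comp_inl_inr]
    exact hg
  · exact fun h => ⟨_, h, rfl⟩

lemma isEven_flat {n : ℕ} {p : Setoid (Fin 0 ⊕ Fin n)} (hp : IsEven p) : IsEven (flat p) :=
  isEven_comap hp (Equiv.emptySum (Fin 0) (Fin n)).symm

lemma resp_flat_vcomp {n m : ℕ} (p : Setoid (Fin 0 ⊕ Fin n)) (q : Setoid (Fin n ⊕ Fin m))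
    (k : Fin m → Bool) :
    Resp (flat (vcomp p q)) k ↔ ∃ j, Resp (flat p) j ∧ Resp q (Sum.elim j k) := by
  rw [resp_flat _ (fun _ => true), resp_vcomp]
  simp only [resp_flat _ (fun _ => true)]
  exact ⟨fun ⟨j, h⟩ => ⟨j, h⟩, fun ⟨j, h⟩ => ⟨j, h⟩⟩

lemma flat_vcomp_ofEquiv {n m : ℕ} (p : Setoid (Fin 0 ⊕ Fin n)) (e : Fin n ≃ Fin m) :
    flat (vcomp p (ofEquiv e)) = (flat p).comap e.symm :=
  setoid_ext fun k => by
    rw [resp_flat_vcomp, resp_comap]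
    refine exists_congr fun g => and_congr_right fun _ => ?_
    rw [resp_ofEquiv]
    constructor
    · rintro rfl; funext x; simp
    · rintro rfl; funext x; simp

lemma resp_top {X : Type*} (f : X → Bool) : Resp (⊤ : Setoid X) f ↔ ∀ x y, f x = f y :=
  ⟨fun h x y => h x y trivial, fun h x y _ => h x y⟩

lemma lft_eq_cc {n : ℕ} (f : Fin (n + 2) → Bool) : lft f = f ∘ cc := rfl

lemma rgt_eq {n : ℕ} (f : Fin (n + 2) → Bool) : rgt f = ![f (pen n), f (lst n)] := by
  funext x
  fin_cases x <;> rfl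

lemma cc_ext {n : ℕ} {f g : Fin (n + 2) → Bool} (h : f ∘ cc = g ∘ cc) (h1 : f (pen n) = g (pen n))
    (h2 : f (lst n) = g (lst n)) : f = g := by
  funext x
  induction x using cc_cases with
  | h x => exact congrFun h x
  | h1 => exact h1
  | h2 => exact h2

/-- The identity strands next to a partition into one block. -/
abbrev besideTop (n k l : ℕ) : Setoid (Fin (n + k) ⊕ Fin (n + l)) :=
  hcomp (ofEquiv (Equiv.refl (Fin n))) ⊤

lemma resp_besideTop_four {n : ℕ} (i j : Fin (n + 2) → Bool) :
    Resp (besideTop n 2 2) (Sum.elim i j) ↔ i = j ∧ j (pen n) = j (lst n) := by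
  rw [resp_hcomp, resp_ofEquiv, resp_top, lft_eq_cc, lft_eq_cc, rgt_eq, rgt_eq]
  constructor
  · rintro ⟨h1, h2⟩
    have e1 := h2 (Sum.inl 0) (Sum.inr 0)
    have e2 := h2 (Sum.inl 1) (Sum.inr 1)
    have e3 := h2 (Sum.inr 0) (Sum.inr 1)
    exact ⟨cc_ext h1 e1 e2, e3⟩
  · rintro ⟨rfl, h⟩
    refine ⟨rfl, ?_⟩
    have key : ∀ x : Fin 2 ⊕ Fin 2, Sum.elim ![i (pen n), i (lst n)] ![i (pen n), i (lst n)] x =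
        i (lst n) := by
      rintro (x | x) <;> fin_cases x <;> first | exact h | rfl
    exact fun x y => (key x).trans (key y).symm

lemma resp_besideTop_cup {n : ℕ} (i : Fin n → Bool) (j : Fin (n + 2) → Bool) :
    Resp (besideTop n 0 2) (Sum.elim i j) ↔ i = j ∘ cc ∧ j (pen n) = j (lst n) := by
  rw [resp_hcomp, resp_ofEquiv, resp_top, lft_eq_cc, rgt_eq]
  refine and_congr Iff.rfl ⟨fun h => h (Sum.inr 0) (Sum.inr 1), fun h => ?_⟩
  have key : ∀ x : Fin 0 ⊕ Fin 2, Sum.elim (rgt i) ![j (pen n), j (lst n)] x = j (lst n) := by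
    rintro (x | x)
    · exact x.elim0
    · fin_cases x <;> first | exact h | rfl
  exact fun x y => (key x).trans (key y).symm

lemma resp_besideTop_cap {n : ℕ} (i : Fin (n + 2) → Bool) (j : Fin n → Bool) :
    Resp (besideTop n 2 0) (Sum.elim i j) ↔ i ∘ cc = j ∧ i (pen n) = i (lst n) := by
  rw [resp_hcomp, resp_ofEquiv, resp_top, lft_eq_cc, rgt_eq]
  refine and_congr Iff.rfl ⟨fun h => h (Sum.inl 0) (Sum.inl 1), fun h => ?_⟩
  have key : ∀ x : Fin 2 ⊕ Fin 0, Sum.elim ![i (pen n), i (lst n)] (rgt j) x = i (lst n) := by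
    rintro (x | x)
    · fin_cases x <;> first | exact h | rfl
    · exact x.elim0
  exact fun x y => (key x).trans (key y).symm

section
variable {n : ℕ}

lemma loops_four (p : Setoid (Fin 0 ⊕ Fin (n + 2))) : loops p (besideTop n 2 2) = 0 :=
  loops_eq_zero _ _ ⟨fun x y => Subtype.ext (by
    rw [((resp_besideTop_four _ _).1 x.2.2).1, ((resp_besideTop_four _ _).1 y.2.2).1])⟩

lemma flat_vcomp_four (p : Setoid (Fin 0 ⊕ Fin (n + 2))) :
    flat (vcomp p (besideTop n 2 2)) = joinBlocks (flat p) (pen n) (lst n) :=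
  setoid_ext fun k => by
    rw [resp_flat_vcomp, resp_joinBlocks]
    simp only [resp_besideTop_four]
    exact ⟨by rintro ⟨j, h, rfl, h'⟩; exact ⟨h, h'⟩, fun ⟨h, h'⟩ => ⟨k, h, rfl, h'⟩⟩

lemma loops_cup (p : Setoid (Fin 0 ⊕ Fin n)) : loops p (besideTop n 0 2) = 0 :=
  loops_eq_zero _ _ ⟨fun x y => Subtype.ext (by
    rw [((resp_besideTop_cup _ _).1 x.2.2).1, ((resp_besideTop_cup _ _).1 y.2.2).1])⟩

lemma resp_flat_vcomp_cup (p : Setoid (Fin 0 ⊕ Fin n)) (k : Fin (n + 2) → Bool) :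
    Resp (flat (vcomp p (besideTop n 0 2))) k ↔ Resp (flat p) (k ∘ cc) ∧ k (pen n) = k (lst n) := by
  rw [resp_flat_vcomp]
  simp only [resp_besideTop_cup]
  exact ⟨by rintro ⟨j, h, rfl, h'⟩; exact ⟨h, h'⟩, fun ⟨h, h'⟩ => ⟨_, h, rfl, h'⟩⟩

lemma rel_iff_resp {X : Type*} (p : Setoid X) (x y : X) : p x y ↔ ∀ f, Resp p f → f x = f y := by
  classical
  refine ⟨fun h f hf => hf x y h, fun h => ?_⟩
  have := h (fun z => decide (p x z)) (fun a b hab => by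
      simp only [decide_eq_decide]
      exact ⟨fun h => p.trans h hab, fun h => p.trans h (p.symm hab)⟩)
  simpa [p.refl x] using this

lemma restrict_flat_vcomp_cup (p : Setoid (Fin 0 ⊕ Fin n)) :
    restrict (flat (vcomp p (besideTop n 0 2))) = flat p :=
  setoid_ext fun k => by
    rw [resp_comap]
    simp only [resp_flat_vcomp_cup]
    constructor
    · rintro ⟨g, ⟨h, -⟩, rfl⟩
      exact h
    · intro h
      refine ⟨Fin.append k fun _ => true, ⟨?_, ?_⟩, lft_append k _⟩
      · have e : Fin.append k (fun _ : Fin 2 => true) ∘ cc = k := lft_append k _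
        rwa [e]
      · have := rgt_append k (fun _ : Fin 2 => true)
        exact (congrFun this 0).trans (congrFun this 1).symm

lemma flat_vcomp_cup_pen_lst (p : Setoid (Fin 0 ⊕ Fin n)) :
    flat (vcomp p (besideTop n 0 2)) (pen n) (lst n) :=
  (rel_iff_resp _ _ _).2 fun _ hf => ((resp_flat_vcomp_cup _ _).1 hf).2

lemma not_flat_vcomp_cup (p : Setoid (Fin 0 ⊕ Fin n)) (x : Fin n) :
    ¬ flat (vcomp p (besideTop n 0 2)) (cc x) (pen n) := by
  intro h
  have := (rel_iff_resp _ _ _).1 h (Fin.append (fun _ => true) fun _ => false)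
    ((resp_flat_vcomp_cup _ _).2 ⟨?_, ?_⟩)
  · have h1 := congrFun (lft_append (fun _ : Fin n => true) (fun _ : Fin 2 => false)) x
    have h2 := congrFun (rgt_append (fun _ : Fin n => true) (fun _ : Fin 2 => false)) 0
    exact absurd (h1.symm.trans (this.trans h2)) (by decide)
  · have e : Fin.append (fun _ : Fin n => true) (fun _ : Fin 2 => false) ∘ cc = fun _ => true :=
      lft_append _ _
    rw [e]
    exact resp_const _
  · have := rgt_append (fun _ : Fin n => true) (fun _ : Fin 2 => false)
    exact (congrFun this 0).trans (congrFun this 1).symm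

lemma flat_vcomp_cap (p : Setoid (Fin 0 ⊕ Fin (n + 2))) :
    flat (vcomp p (besideTop n 2 0)) = contract (flat p) :=
  setoid_ext fun k => by
    rw [resp_flat_vcomp, resp_comap]
    simp only [resp_joinBlocks]
    refine exists_congr fun j => ?_
    rw [and_assoc]
    refine and_congr_right fun _ => ?_
    rw [and_comm]
    exact resp_besideTop_cap _ _

lemma mid_cap_ext {p : Setoid (Fin 0 ⊕ Fin (n + 2))}
    {x y : Mid p (besideTop n 2 0) (fun _ => true) (fun _ => true)}
    (h : x.1 (lst n) = y.1 (lst n)) : x = y := by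
  have hx := (resp_besideTop_cap _ _).1 x.2.2
  have hy := (resp_besideTop_cap _ _).1 y.2.2
  exact Subtype.ext (cc_ext (hx.1.trans hy.1.symm) (hx.2.trans (h.trans hy.2.symm)) h)

/-- The label of the capped pair is forced by the outer label at `x`, so the middle labeling is
unique and no component stays in the middle row. -/
lemma loops_cap_of_rel {p : Setoid (Fin 0 ⊕ Fin (n + 2))} (x : Fin n)
    (hx : flat p (cc x) (pen n) ∨ flat p (cc x) (lst n)) : loops p (besideTop n 2 0) = 0 := by
  refine loops_eq_zero _ _ ⟨fun y z => mid_cap_ext ?_⟩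
  have key : ∀ y : Mid p (besideTop n 2 0) (fun _ => true) (fun _ => true), y.1 (lst n) = true := by
    intro y
    have hy := (resp_besideTop_cap _ _).1 y.2.2
    have h1 : y.1 (cc x) = true := congrFun hy.1 x
    have h2 := (resp_flat _ _ _).2 y.2.1
    rcases hx with hx | hx
    · rw [← hy.2, ← h2 _ _ hx, h1]
    · rw [← h2 _ _ hx, h1]
  rw [key, key]

/-- With all outer labels fixed, the common label of the last two points is the only freedom. There
are two middle labelings, and `card_mid` reads off one loop. -/
lemma loops_cap_of_not_rel {p : Setoid (Fin 0 ⊕ Fin (n + 2))} (h : flat p (pen n) (lst n))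
    (hx : ¬ ∃ x : Fin n, flat p (cc x) (pen n)) : loops p (besideTop n 2 0) = 1 := by
  have hc := card_mid p (besideTop n 2 0) _ _ (resp_const_sum _)
  have h1 : ∀ b : Bool, lft (Fin.append (fun _ : Fin n => true) (fun _ : Fin 2 => b)) =
    fun _ => true := fun b => lft_append _ _
  have h2 : ∀ b : Bool, rgt (Fin.append (fun _ : Fin n => true) (fun _ : Fin 2 => b)) =
    fun _ => b := fun b => rgt_append _ _
  have hl : ∀ u, flat p u (pen n) → u = pen n ∨ u = lst n := by
    intro u hu
    induction u using cc_cases with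
    | h x => exact absurd ⟨x, hu⟩ hx
    | h1 => exact Or.inl rfl
    | h2 => exact Or.inr rfl
  have hv : ∀ b : Bool, ∀ u, flat p u (pen n) →
      Fin.append (fun _ : Fin n => true) (fun _ : Fin 2 => b) u = b := by
    intro b u hu
    rcases hl u hu with rfl | rfl
    · exact congrFun (h2 b) 0
    · exact congrFun (h2 b) 1
  have e : Mid p (besideTop n 2 0) (fun _ => true) (fun _ => true) ≃ Bool :=
    { toFun := fun j => j.1 (lst n)
      invFun := fun b => ⟨Fin.append (fun _ => true) (fun _ => b), by
        refine ⟨(resp_flat _ _ _).1 fun u v huv => ?_, (resp_besideTop_cap _ _).2 ⟨h1 b, ?_⟩⟩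
        · by_cases hu : flat p u (pen n)
          · rw [hv b u hu, hv b v ((flat p).trans' ((flat p).symm' huv) hu)]
          · have hw : ¬ flat p v (pen n) := fun h' => hu ((flat p).trans' huv h')
            have key : ∀ u, ¬ flat p u (pen n) →
                Fin.append (fun _ : Fin n => true) (fun _ : Fin 2 => b) u = true := by
              intro u hu
              induction u using cc_cases with
              | h x => exact congrFun (h1 b) x
              | h1 => exact absurd ((flat p).refl' _) hu
              | h2 => exact absurd ((flat p).symm' h) hu
            rw [key u hu, key v hw]
        · exact (congrFun (h2 b) 0).trans (congrFun (h2 b) 1).symm⟩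
      left_inv := fun j => mid_cap_ext (congrFun (h2 _) 1)
      right_inv := fun b => congrFun (h2 b) 1 }
  rw [Nat.card_congr e, Nat.card_eq_fintype_card, Fintype.card_bool] at hc
  exact (Nat.pow_right_injective (le_refl 2) (by simpa using hc)).symm
end
end PartCat


namespace StrandTower
variable {D : Type u} [Category.{v} D] (T : StrandTower D)

/-- The slide relation solved for `up`. This form writes `up` of a generator in terms of generators,
as `Realizes.up` requires. -/
lemma up_a_eq (n : ℕ) : T.up (T.a n) =
    T.s (n + 1) ≫ T.up (T.s n) ≫ T.a (n + 1) ≫ T.up (T.s n) ≫ T.s (n + 1) := by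
  rw [T.a_slide, ← Category.assoc (T.up (T.s n)), ← T.up_comp, T.s_s, T.up_id, Category.id_comp,
    ← Category.assoc, T.s_s, Category.id_comp]

lemma up_b_eq (n : ℕ) : T.up (T.b n) = T.s (n + 1) ≫ T.up (T.s n) ≫ T.b (n + 1) := by
  rw [← T.b_slide, ← Category.assoc (T.up (T.s n)), ← T.up_comp, T.s_s, T.up_id, Category.id_comp,
    ← Category.assoc, T.s_s, Category.id_comp]

end StrandTower

/-! ### The tower of the objects `[n]` and bending -/

namespace Rep0
open NeutralTower PartCat
variable (t : ℂ)

/-- The objects `[n]` as the tensor powers of `[1]`. -/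
def powerSeq : PowerSeq (⟨1⟩ : Rep0 t) where
  ob n := ⟨n⟩
  e n := Iso.refl (⟨n + 1⟩ : Rep0 t)

/-- The tower of the objects `[n]`. -/
abbrev tower : StrandTower (Rep0 t) :=
  (powerSeq t).strandTower (A := ⟨1⟩) (fourLegs t) (cap t) (cup t)

lemma powerSeq_e₂_hom (n : ℕ) : ((powerSeq t).e₂ n).hom = 𝟙 (⟨n + 2⟩ : Rep0 t) := by
  have h1 : (α_ (⟨n⟩ : Rep0 t) ⟨1⟩ ⟨1⟩).inv = 𝟙 (⟨n + 2⟩ : Rep0 t) := rfl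
  have h2 : (𝟙 (⟨n + 1⟩ : Rep0 t)) ▷ (⟨1⟩ : Rep0 t) = 𝟙 (⟨n + 2⟩ : Rep0 t) := id_whiskerRight _ _
  change (α_ (⟨n⟩ : Rep0 t) ⟨1⟩ ⟨1⟩).inv ≫ (𝟙 (⟨n + 1⟩ : Rep0 t)) ▷ (⟨1⟩ : Rep0 t) ≫
    𝟙 (⟨n + 2⟩ : Rep0 t) = _
  rw [h1, h2]
  exact (Category.id_comp _).trans (Category.id_comp _)

lemma powerSeq_e₂ (n : ℕ) : (powerSeq t).e₂ n = Iso.refl (⟨n + 2⟩ : Rep0 t) :=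
  Iso.ext (powerSeq_e₂_hom t n)

lemma rightUnitor_eq (n : ℕ) : ρ_ (⟨n⟩ : Rep0 t) = Iso.refl (⟨n⟩ : Rep0 t) := Iso.ext rfl

variable {t}

lemma tower_up {n m : ℕ} (f : (⟨n⟩ : Rep0 t) ⟶ ⟨m⟩) :
    (tower t).up (n := n) (m := m) f = tens f (𝟙 (⟨1⟩ : Rep0 t)) :=
  (Category.id_comp _).trans (Category.comp_id _)

lemma last_e₂ {n : ℕ} (g : (⟨2⟩ : Rep0 t) ⟶ ⟨2⟩) :
    (powerSeq t).last ((powerSeq t).e₂ n) ((powerSeq t).e₂ n) g = tens (𝟙 (⟨n⟩ : Rep0 t)) g := by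
  rw [powerSeq_e₂]
  exact (Category.id_comp _).trans (Category.comp_id _)

lemma tower_a (n : ℕ) : (tower t).a n = diag (X := ⟨n + 2⟩) (Y := ⟨n + 2⟩)
    ⟨besideTop n 2 2, isEven_hcomp (isEven_ofEquiv _) (isEven_top ⟨2, by simp⟩)⟩ := by
  refine (last_e₂ _).trans ?_
  rw [id_eq_perm, perm, fourLegs, tens_diag]

lemma tower_s (n : ℕ) : (tower t).s n = perm (X := ⟨n + 2⟩) (Y := ⟨n + 2⟩)
    (Equiv.swap (pen n) (lst n)) := by
  have h : (β_ (⟨1⟩ : Rep0 t) ⟨1⟩).hom = 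
      perm (X := ⟨2⟩) (Y := ⟨2⟩) (finAddFlip (m := 1) (n := 1)) := rfl
  change (powerSeq t).last ((powerSeq t).e₂ n) ((powerSeq t).e₂ n)
    (β_ (⟨1⟩ : Rep0 t) ⟨1⟩).hom = _
  rw [h, last_e₂, id_eq_perm, tens_perm]
  refine congrArg perm (Equiv.ext fun x => ?_)
  induction x using cc_cases with
  | h x =>
    rw [Equiv.swap_apply_of_ne_of_ne (cc_ne_pen x) (cc_ne_lst x)]
    exact sumPerm_castAdd _ _ x
  | h1 => rw [Equiv.swap_apply_left]; exact sumPerm_natAdd _ _ 0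
  | h2 => rw [Equiv.swap_apply_right]; exact sumPerm_natAdd _ _ 1

lemma tower_d (n : ℕ) : (tower t).d n = diag (X := ⟨n⟩) (Y := ⟨n + 2⟩)
    ⟨besideTop n 0 2, isEven_hcomp (isEven_ofEquiv _) (isEven_top (by simp))⟩ := by
  have h : (tower t).d n = tens (𝟙 (⟨n⟩ : Rep0 t)) (cup t) := by
    change (powerSeq t).last (ρ_ (⟨n⟩ : Rep0 t)) ((powerSeq t).e₂ n) (cup t) = _
    rw [powerSeq_e₂, rightUnitor_eq]
    exact (Category.id_comp _).trans (Category.comp_id _)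
  rw [h, id_eq_perm, perm, cup, tens_diag]

lemma tower_b (n : ℕ) : (tower t).b n = diag (X := ⟨n + 2⟩) (Y := ⟨n⟩)
    ⟨besideTop n 2 0, isEven_hcomp (isEven_ofEquiv _) (isEven_top (by simp))⟩ := by
  have h : (tower t).b n = tens (𝟙 (⟨n⟩ : Rep0 t)) (cap t) := by
    change (powerSeq t).last ((powerSeq t).e₂ n) (ρ_ (⟨n⟩ : Rep0 t)) (cap t) = _
    rw [powerSeq_e₂, rightUnitor_eq]
    exact (Category.id_comp _).trans (Category.comp_id _)
  rw [h, id_eq_perm, perm, cap, tens_diag]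

lemma resp_zig {n : ℕ} (i : Fin (n + 1) → Bool) (j : Fin (n + 3) → Bool) :
    Resp (hcomp (besideTop n 0 2) (ofEquiv (Equiv.refl (Fin 1)))) (Sum.elim i j) ↔
      (∀ x : Fin n, i x.castSucc = j (cc x.castSucc)) ∧ j (cc (Fin.last n)) = j (pen (n + 1)) ∧
        i (Fin.last n) = j (lst (n + 1)) := by
  rw [resp_hcomp, resp_besideTop_cup, resp_ofEquiv, and_assoc]
  refine and_congr ⟨fun h x => congrFun h x, fun h => funext h⟩ (and_congr Iff.rfl
    ⟨fun h => congrFun h 0, fun h => funext fun x => ?_⟩)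
  rw [Subsingleton.elim x 0]
  exact h

lemma loops_zig (n : ℕ) :
    loops (hcomp (besideTop n 0 2) (ofEquiv (Equiv.refl (Fin 1)))) (besideTop (n + 1) 2 0) = 0 :=
  loops_eq_zero _ _ ⟨by
    have key : ∀ x : Mid (hcomp (besideTop n 0 2) (ofEquiv (Equiv.refl (Fin 1))))
        (besideTop (n + 1) 2 0) (fun _ => true) (fun _ => true), x.1 = fun _ => true := by
      intro x
      have h1 := (resp_zig _ _).1 x.2.1
      have h2 := (resp_besideTop_cap _ _).1 x.2.2
      exact cc_ext h2.1 (h2.2.trans h1.2.2.symm) h1.2.2.symm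
    exact fun x y => Subtype.ext ((key x).trans (key y).symm)⟩

/-- On labelings, the coevaluation and the evaluation copy the last label from the lower to the
upper row, and the other strands are straight. -/
lemma vcomp_zig (n : ℕ) :
    vcomp (hcomp (besideTop n 0 2) (ofEquiv (Equiv.refl (Fin 1)))) (besideTop (n + 1) 2 0) =
      ofEquiv (Equiv.refl (Fin (n + 1))) :=
  setoid_ext fun f => by
    rw [← Sum.elim_comp_inl_inr f, resp_vcomp, resp_ofEquiv]
    obtain ⟨i, hi⟩ : ∃ i : Fin (n + 1) → Bool, f ∘ Sum.inl = i := ⟨_, rfl⟩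
    obtain ⟨k, hk⟩ : ∃ k : Fin (n + 1) → Bool, f ∘ Sum.inr = k := ⟨_, rfl⟩
    rw [hi, hk]
    clear hi hk
    constructor
    · rintro ⟨j, h1, h2⟩
      rw [resp_zig] at h1
      obtain ⟨rfl, h3⟩ := (resp_besideTop_cap _ _).1 h2
      funext x
      induction x using Fin.lastCases with
      | last => exact h1.2.2.trans (h3.symm.trans h1.2.1.symm)
      | cast x => exact h1.1 x
    · rintro rfl
      have hc : (Fin.append (m := n + 1) k (fun _ : Fin 2 => k (Fin.last n))) ∘ cc (n := n + 1) = k :=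
        lft_append k (fun _ : Fin 2 => k (Fin.last n))
      have hr := rgt_append k (fun _ : Fin 2 => k (Fin.last n))
      exact ⟨Fin.append (m := n + 1) (n := 2) k fun _ => k (Fin.last n), (resp_zig _ _).2
        ⟨fun x => (congrFun hc _).symm, (congrFun hc _).trans (congrFun hr 0).symm,
          (congrFun hr 1).symm⟩,
        (resp_besideTop_cap _ _).2 ⟨hc, (congrFun hr 0).trans (congrFun hr 1).symm⟩⟩

/-- Beyond the structure of a `StrandTower`, this is the only relation needed for `[n]` itself: it
makes bending reversible in `bend_bend`. -/
lemma tower_zig (n : ℕ) : (tower t).up ((tower t).d n) ≫ (tower t).b (n + 1) = 𝟙 _ := by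
  rw [tower_d, tower_up, tower_b, id_eq_perm, perm, tens_diag]
  refine (diag_comp _ _).trans ?_
  dsimp only
  have h := loops_zig n
  have h' := vcomp_zig n
  change t ^ loops (hcomp (besideTop n 0 2) (ofEquiv (Equiv.refl (Fin 1)))) (besideTop (n + 1) 2 0) •
    diag (X := ⟨n + 1⟩) (Y := ⟨n + 1⟩) ⟨vcomp (hcomp (besideTop n 0 2)
      (ofEquiv (Equiv.refl (Fin 1)))) (besideTop (n + 1) 2 0), _⟩ = _
  simp only [h, h', pow_zero, one_smul]
  rfl

/-- Adding a strand on the right. -/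
def addStrand {n m : ℕ} (f : (⟨n⟩ : Rep0 t) ⟶ ⟨m⟩) : (⟨n + 1⟩ : Rep0 t) ⟶ ⟨m + 1⟩ :=
  tens f (𝟙 (⟨1⟩ : Rep0 t))

variable (t) in
/-- The crossing of the last two strands. -/
def crossLast (n : ℕ) : (⟨n + 2⟩ : Rep0 t) ⟶ ⟨n + 2⟩ :=
  perm (X := ⟨n + 2⟩) (Y := ⟨n + 2⟩) (Equiv.swap (pen n) (lst n))

variable (t) in
/-- The four-legged block on the last two strands. -/
def fourLast (n : ℕ) : (⟨n + 2⟩ : Rep0 t) ⟶ ⟨n + 2⟩ := diag (X := ⟨n + 2⟩) (Y := ⟨n + 2⟩)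
  ⟨besideTop n 2 2, isEven_hcomp (isEven_ofEquiv _) (isEven_top ⟨2, by simp⟩)⟩

variable (t) in
/-- The cup that creates two strands at the end. -/
def cupLast (n : ℕ) : (⟨n⟩ : Rep0 t) ⟶ ⟨n + 2⟩ := diag (X := ⟨n⟩) (Y := ⟨n + 2⟩)
  ⟨besideTop n 0 2, isEven_hcomp (isEven_ofEquiv _) (isEven_top (by simp))⟩

variable (t) in
/-- The cap on the last two strands. -/
def capLast (n : ℕ) : (⟨n + 2⟩ : Rep0 t) ⟶ ⟨n⟩ := diag (X := ⟨n + 2⟩) (Y := ⟨n⟩)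
  ⟨besideTop n 2 0, isEven_hcomp (isEven_ofEquiv _) (isEven_top (by simp))⟩

lemma addStrand_comp {n m k : ℕ} (f : (⟨n⟩ : Rep0 t) ⟶ ⟨m⟩) (g : (⟨m⟩ : Rep0 t) ⟶ ⟨k⟩) :
    addStrand (f ≫ g) = addStrand f ≫ addStrand g := by
  have := tens_comp f (𝟙 (⟨1⟩ : Rep0 t)) g (𝟙 (⟨1⟩ : Rep0 t))
  rw [Category.comp_id] at this
  exact this.symm

lemma addStrand_id (n : ℕ) : addStrand (𝟙 (⟨n⟩ : Rep0 t)) = 𝟙 _ :=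
  id_whiskerRight (⟨n⟩ : Rep0 t) ⟨1⟩

lemma addStrand_add {n m : ℕ} (f g : (⟨n⟩ : Rep0 t) ⟶ ⟨m⟩) :
    addStrand (f + g) = addStrand f + addStrand g := add_tens _ _ _

lemma addStrand_smul {n m : ℕ} (r : ℂ) (f : (⟨n⟩ : Rep0 t) ⟶ ⟨m⟩) :
    addStrand (r • f) = r • addStrand f := smul_tens _ _ _

lemma addStrand_perm {n : ℕ} (σ : Equiv.Perm (Fin n)) :
    addStrand (perm (X := ⟨n⟩) (Y := ⟨n⟩) σ : (⟨n⟩ : Rep0 t) ⟶ ⟨n⟩) =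
      perm (X := ⟨n + 1⟩) (Y := ⟨n + 1⟩) (liftPerm σ) := by
  rw [addStrand, id_eq_perm, tens_perm]

lemma addStrand_crossLast (n : ℕ) : addStrand (crossLast t n) =
    perm (X := ⟨n + 3⟩) (Y := ⟨n + 3⟩) (liftPerm (Equiv.swap (pen n) (lst n))) :=
  addStrand_perm _

lemma tower_up' {n m : ℕ} (f : (⟨n⟩ : Rep0 t) ⟶ ⟨m⟩) :
    (tower t).up (n := n) (m := m) f = addStrand f := tower_up f

lemma capLast_natural {n m : ℕ} (f : (⟨n⟩ : Rep0 t) ⟶ ⟨m⟩) :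
    addStrand (addStrand f) ≫ capLast t m = capLast t n ≫ f := by
  have := (tower t).b_nat (n := n) (m := m) f
  rw [tower_b, tower_b, tower_up', tower_up'] at this
  exact this

lemma addStrand_fourLast (n : ℕ) : addStrand (fourLast t n) =
    crossLast t (n + 1) ≫ addStrand (crossLast t n) ≫ fourLast t (n + 1) ≫
      addStrand (crossLast t n) ≫ crossLast t (n + 1) := by
  have := (tower t).up_a_eq n
  rw [tower_a, tower_a, tower_s, tower_s, tower_up', tower_up'] at this
  exact this

lemma addStrand_capLast (n : ℕ) : addStrand (capLast t n) =
    crossLast t (n + 1) ≫ addStrand (crossLast t n) ≫ capLast t (n + 1) := by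
  have := (tower t).up_b_eq n
  rw [tower_b, tower_b, tower_s, tower_s, tower_up', tower_up'] at this
  exact this

lemma addStrand_cupLast (n : ℕ) : addStrand (cupLast t n) =
    cupLast t (n + 1) ≫ addStrand (crossLast t n) ≫ crossLast t (n + 1) := by
  have := (tower t).d_slide n
  rw [tower_d, tower_d, tower_s, tower_s, tower_up', tower_up'] at this
  exact this.symm

lemma addStrand_cupLast_capLast (n : ℕ) :
    addStrand (cupLast t n) ≫ capLast t (n + 1) = 𝟙 (⟨n + 1⟩ : Rep0 t) := by
  have := tower_zig (t := t) n
  rw [tower_b, tower_d, tower_up'] at this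
  exact this

/-- Bending the last lower strand up and down again. -/
lemma bend_bend {n m : ℕ} (f : (⟨n + 1⟩ : Rep0 t) ⟶ ⟨m⟩) :
    addStrand (cupLast t n ≫ addStrand f) ≫ capLast t m = f := by
  rw [addStrand_comp, Category.assoc, capLast_natural, ← Category.assoc,
    addStrand_cupLast_capLast, Category.id_comp]

end Rep0


/-! ### Partitions determined by their upper points -/

namespace PartCat
open NeutralTower

lemma flat_injective {n : ℕ} {P Q : EvenPart 0 n} (h : flat P.1 = flat Q.1) : P = Q := by
  refine Subtype.ext (setoid_ext fun f => ?_)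
  rw [← Sum.elim_comp_inl_inr f, ← resp_flat, ← resp_flat, h]

lemma exists_flat {n : ℕ} {p : Setoid (Fin n)} (hp : IsEven p) : ∃ P : EvenPart 0 n, flat P.1 = p :=
  ⟨⟨p.comap (Equiv.emptySum (Fin 0) (Fin n)), isEven_comap hp _⟩, rfl⟩

lemma eq_of_rel_pen_lst {n : ℕ} {p q : Setoid (Fin (n + 2))} (hp : p (pen n) (lst n))
    (hq : q (pen n) (lst n)) (h : ∀ x y : Fin n, p (cc x) (cc y) ↔ q (cc x) (cc y))
    (h' : ∀ x : Fin n, p (cc x) (pen n) ↔ q (cc x) (pen n)) : p = q := by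
  have key : ∀ {p q : Setoid (Fin (n + 2))}, p (pen n) (lst n) → q (pen n) (lst n) →
      (∀ x y : Fin n, p (cc x) (cc y) ↔ q (cc x) (cc y)) →
      (∀ x : Fin n, p (cc x) (pen n) ↔ q (cc x) (pen n)) → p ≤ q := by
    intro p q hp hq h h'
    have h1 : ∀ x : Fin n, p (cc x) (lst n) → q (cc x) (lst n) := fun x hx =>
      q.trans' ((h' x).1 (p.trans' hx (p.symm' hp))) hq
    intro u v huv
    induction u using cc_cases with
    | h x =>
      induction v using cc_cases with
      | h y => exact (h x y).1 huv
      | h1 => exact (h' x).1 huv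
      | h2 => exact h1 x huv
    | h1 =>
      induction v using cc_cases with
      | h y => exact q.symm' ((h' y).1 (p.symm' huv))
      | h1 => exact q.refl' _
      | h2 => exact hq
    | h2 =>
      induction v using cc_cases with
      | h y => exact q.symm' (h1 y (p.symm' huv))
      | h1 => exact q.symm' hq
      | h2 => exact q.refl' _
  exact le_antisymm (key hp hq h h') (key hq hp (fun x y => (h x y).symm) fun x => (h' x).symm)

end PartCat

namespace Rep0
open PartCat NeutralTower
variable {t : ℂ}

lemma exists_diag_comp_perm {n : ℕ} (P : EvenPart 0 n) (σ : Equiv.Perm (Fin n)) :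
    ∃ Q : EvenPart 0 n, flat Q.1 = (flat P.1).comap σ.symm ∧
      (diag P : (⟨0⟩ : Rep0 t) ⟶ ⟨n⟩) ≫ perm (X := ⟨n⟩) (Y := ⟨n⟩) σ = diag Q :=
  ⟨_, flat_vcomp_ofEquiv _ _, diag_comp_perm (X := ⟨0⟩) (Y := ⟨n⟩) (Z := ⟨n⟩) P σ⟩

lemma exists_diag_comp_fourLast {n : ℕ} (P : EvenPart 0 (n + 2)) :
    ∃ Q : EvenPart 0 (n + 2), flat Q.1 = joinBlocks (flat P.1) (pen n) (lst n) ∧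
      (diag P : (⟨0⟩ : Rep0 t) ⟶ ⟨n + 2⟩) ≫ fourLast t n = diag Q := by
  refine ⟨⟨vcomp P.1 (besideTop n 2 2), isEven_vcomp P.2
    (isEven_hcomp (isEven_ofEquiv _) (isEven_top ⟨2, by simp⟩))⟩, flat_vcomp_four P.1,
    (diag_comp (X := ⟨0⟩) (Y := ⟨n + 2⟩) (Z := ⟨n + 2⟩) P _).trans ?_⟩
  dsimp only
  rw [loops_four, pow_zero, one_smul]

lemma exists_diag_comp_cupLast {n : ℕ} (P : EvenPart 0 n) :
    ∃ Q : EvenPart 0 (n + 2), (restrict (flat Q.1) = flat P.1 ∧ flat Q.1 (pen n) (lst n) ∧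
        ¬ ∃ x, flat Q.1 (cc x) (pen n)) ∧
      (diag P : (⟨0⟩ : Rep0 t) ⟶ ⟨n⟩) ≫ cupLast t n = diag Q := by
  refine ⟨⟨vcomp P.1 (besideTop n 0 2), isEven_vcomp P.2
    (isEven_hcomp (isEven_ofEquiv _) (isEven_top (by simp)))⟩, ⟨restrict_flat_vcomp_cup P.1,
    flat_vcomp_cup_pen_lst P.1, fun ⟨x, hx⟩ => not_flat_vcomp_cup P.1 x hx⟩,
    (diag_comp (X := ⟨0⟩) (Y := ⟨n⟩) (Z := ⟨n + 2⟩) P _).trans ?_⟩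
  dsimp only
  rw [loops_cup, pow_zero, one_smul]

lemma exists_diag_comp_capLast {n : ℕ} (P : EvenPart 0 (n + 2)) :
    ∃ Q : EvenPart 0 n, flat Q.1 = contract (flat P.1) ∧
      (diag P : (⟨0⟩ : Rep0 t) ⟶ ⟨n + 2⟩) ≫ capLast t n =
        t ^ loops P.1 (besideTop n 2 0) • (diag Q : (⟨0⟩ : Rep0 t) ⟶ ⟨n⟩) :=
  ⟨⟨vcomp P.1 (besideTop n 2 0), isEven_vcomp P.2
    (isEven_hcomp (isEven_ofEquiv _) (isEven_top (by simp)))⟩, flat_vcomp_cap P.1,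
    diag_comp (X := ⟨0⟩) (Y := ⟨n + 2⟩) (Z := ⟨n⟩) P _⟩

end Rep0

/-! ### Interpretation of `Rep₀(H_t)` in a tower -/

namespace NeutralTower
open PartCat Rep0 StrandTower
variable {t : ℂ} {D : Type u} [Category.{v} D] [Preadditive D] [Linear ℂ D] (T : NeutralTower t D)

/-- A morphism of `Rep₀(H_t)` and its interpretation in the tower `T`. -/
inductive Realizes : ∀ {n m : ℕ}, ((⟨n⟩ : Rep0 t) ⟶ ⟨m⟩) → (T.ob n ⟶ T.ob m) → Prop
  | perm {n : ℕ} (σ : Equiv.Perm (Fin n)) :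
      Realizes (Rep0.perm (X := ⟨n⟩) (Y := ⟨n⟩) σ) (T.perm σ)
  | four (n : ℕ) : Realizes (fourLast t n) (T.a n)
  | cap (n : ℕ) : Realizes (capLast t n) (T.b n)
  | cup (n : ℕ) : Realizes (cupLast t n) (T.d n)
  | comp {n m k : ℕ} {g : (⟨n⟩ : Rep0 t) ⟶ ⟨m⟩} {φ : T.ob n ⟶ T.ob m}
      {g' : (⟨m⟩ : Rep0 t) ⟶ ⟨k⟩} {φ' : T.ob m ⟶ T.ob k} :
      Realizes g φ → Realizes g' φ' → Realizes (g ≫ g') (φ ≫ φ')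
  | zero {n m : ℕ} : Realizes (0 : (⟨n⟩ : Rep0 t) ⟶ ⟨m⟩) 0
  | add {n m : ℕ} {g g' : (⟨n⟩ : Rep0 t) ⟶ ⟨m⟩} {φ φ' : T.ob n ⟶ T.ob m} :
      Realizes g φ → Realizes g' φ' → Realizes (g + g') (φ + φ')
  | smul {n m : ℕ} {g : (⟨n⟩ : Rep0 t) ⟶ ⟨m⟩} {φ : T.ob n ⟶ T.ob m} (r : ℂ) :
      Realizes g φ → Realizes (r • g) (r • φ)

variable {T}

lemma Realizes.id (n : ℕ) : T.Realizes (𝟙 (⟨n⟩ : Rep0 t)) (𝟙 (T.ob n)) := by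
  have := Realizes.perm (T := T) (1 : Equiv.Perm (Fin n))
  rwa [perm_one] at this

lemma Realizes.cross (n : ℕ) : T.Realizes (crossLast t n) (T.s n) := by
  rw [← perm_swap_pen]
  exact .perm _

lemma Realizes.addStrand_cross (n : ℕ) :
    T.Realizes (addStrand (crossLast t n)) (T.up (T.s n)) := by
  rw [← perm_swap_pen, ← perm_liftPerm, addStrand_crossLast]
  exact .perm _

/-- Adding a strand is not a constructor. The slide relations, valid in both towers, express each
generator with an added strand through crossings and the generator one level higher. -/
lemma Realizes.up {n m : ℕ} {g : (⟨n⟩ : Rep0 t) ⟶ ⟨m⟩} {φ : T.ob n ⟶ T.ob m}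
    (h : T.Realizes g φ) : T.Realizes (addStrand g) (T.up φ) := by
  induction h with
  | perm σ => rw [← perm_liftPerm, addStrand_perm]; exact .perm _
  | four n =>
    rw [up_a_eq, addStrand_fourLast]
    exact .comp (.cross _) (.comp (.addStrand_cross _) (.comp (.four _)
      (.comp (.addStrand_cross _) (.cross _))))
  | cap n =>
    rw [up_b_eq, addStrand_capLast]
    exact .comp (.cross _) (.comp (.addStrand_cross _) (.cap _))
  | cup n =>
    rw [← T.d_slide, addStrand_cupLast]
    exact .comp (.cup _) (.comp (.addStrand_cross _) (.cross _))
  | comp _ _ h h' => rw [T.up_comp, addStrand_comp]; exact .comp h h'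
  | @zero n m =>
    have h1 := T.up_smul 0 (0 : T.ob n ⟶ T.ob m)
    have h2 := addStrand_smul (t := t) 0 (0 : (⟨n⟩ : Rep0 t) ⟶ ⟨m⟩)
    rw [zero_smul, zero_smul] at h1 h2
    rw [h1, h2]
    exact .zero
  | add _ _ h h' => rw [T.up_add, addStrand_add]; exact .add h h'
  | smul r _ h => rw [T.up_smul, addStrand_smul]; exact .smul r h

lemma Realizes.exists_joinBlocks {m : ℕ} {P : EvenPart 0 (m + 2)} {φ : T.ob 0 ⟶ T.ob (m + 2)}
    (h : T.Realizes (diag P : (⟨0⟩ : Rep0 t) ⟶ ⟨m + 2⟩) φ) {x y : Fin (m + 2)} (hxy : x ≠ y) :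
    ∃ (Q : EvenPart 0 (m + 2)) (ψ : T.ob 0 ⟶ T.ob (m + 2)),
      flat Q.1 = joinBlocks (flat P.1) x y ∧ T.Realizes (diag Q : (⟨0⟩ : Rep0 t) ⟶ ⟨m + 2⟩) ψ := by
  obtain ⟨σ, rfl, rfl⟩ := exists_perm_two (pen_ne_lst m) hxy
  obtain ⟨Q₁, h1, e1⟩ := exists_diag_comp_perm (t := t) P σ.symm
  obtain ⟨Q₂, h2, e2⟩ := exists_diag_comp_fourLast (t := t) Q₁
  obtain ⟨Q₃, h3, e3⟩ := exists_diag_comp_perm (t := t) Q₂ σ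
  have hr := ((h.comp (.perm σ.symm)).comp (.four m)).comp (.perm σ)
  rw [e1, e2, e3] at hr
  refine ⟨Q₃, _, ?_, hr⟩
  rw [h3, h2, h1]
  exact Setoid.ext fun u v => by
    change (flat P.1 (σ (σ.symm u)) (σ (σ.symm v)) ∨ (flat P.1 (σ (σ.symm u)) _ ∧
      flat P.1 (σ (σ.symm v)) _) ∨ (flat P.1 (σ (σ.symm u)) _ ∧ flat P.1 (σ (σ.symm v)) _)) ↔ _
    rw [Equiv.apply_symm_apply, Equiv.apply_symm_apply]
    rfl

/-- The recursion of `vec` on the side of diagrams: two points of one block are moved to the end,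
recreated by a cup over the restriction, joined to the rest of their block, and moved back. -/
lemma exists_realizes_diag : ∀ {m : ℕ} (P : EvenPart 0 m),
    ∃ φ, T.Realizes (diag P : (⟨0⟩ : Rep0 t) ⟶ ⟨m⟩) φ
  | 0, P => by
    have : P = ⟨ofEquiv (Equiv.refl (Fin 0)), isEven_ofEquiv _⟩ :=
      flat_injective (Setoid.ext fun x => x.elim0)
    rw [this]
    exact ⟨_, Realizes.id 0⟩
  | 1, P => by
    obtain ⟨y, hy, -⟩ := exists_partner (isEven_flat P.2) 0
    exact absurd (Subsingleton.elim y 0) hy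
  | m + 2, P => by
    obtain ⟨σ, hσ⟩ := exists_perm_pen_lst (isEven_flat P.2)
    set q := (flat P.1).comap σ with hq
    have hqr : q (pen m) (lst m) := hσ
    have hqe : IsEven q := isEven_comap (isEven_flat P.2) σ
    obtain ⟨R, hR⟩ := exists_flat (isEven_restrict hqe hσ)
    obtain ⟨φ, hφ⟩ := exists_realizes_diag R
    obtain ⟨S, ⟨hS1, hS2, hS3⟩, e⟩ := exists_diag_comp_cupLast (t := t) R
    have hS : T.Realizes (diag S : (⟨0⟩ : Rep0 t) ⟶ ⟨m + 2⟩) (φ ≫ T.d m) := by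
      have := hφ.comp (.cup m)
      rwa [e] at this
    have hc : ∀ x y : Fin m, flat S.1 (cc x) (cc y) ↔ q (cc x) (cc y) := fun x y => by
      have : restrict (flat S.1) x y ↔ restrict q x y := by rw [hS1, hR]
      exact this
    obtain ⟨Q, ψ, hQ, hψ⟩ : ∃ (Q : EvenPart 0 (m + 2)) (ψ : T.ob 0 ⟶ T.ob (m + 2)),
        flat Q.1 = q ∧ T.Realizes (diag Q : (⟨0⟩ : Rep0 t) ⟶ ⟨m + 2⟩) ψ := by
      by_cases h : ∃ x : Fin m, q (cc x) (pen m)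
      · obtain ⟨x, hx⟩ := h
        obtain ⟨Q, ψ, hQ, hψ⟩ := hS.exists_joinBlocks (cc_ne_pen x)
        refine ⟨Q, ψ, hQ.trans (eq_of_rel_pen_lst (Or.inl hS2) hqr (fun y z => ?_) fun y => ?_), hψ⟩
        · rw [joinBlocks_rel, hc]
          exact ⟨fun h => h.elim id (fun h => h.elim (fun h => absurd ⟨_, h.2⟩ hS3)
            fun h => absurd ⟨_, h.1⟩ hS3), Or.inl⟩
        · rw [joinBlocks_rel, hc]
          constructor
          · rintro (h | h | h)
            · exact absurd ⟨_, h⟩ hS3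
            · exact q.trans' h.1 hx
            · exact absurd ⟨_, h.1⟩ hS3
          · exact fun h => Or.inr (Or.inl ⟨q.trans' h (q.symm' hx), Setoid.refl' _ _⟩)
      · refine ⟨S, _, eq_of_rel_pen_lst hS2 hqr hc fun x => ?_, hS⟩
        exact ⟨fun h => absurd ⟨_, h⟩ hS3, fun h' => absurd ⟨_, h'⟩ h⟩
    obtain ⟨P', hP', e'⟩ := exists_diag_comp_perm (t := t) Q σ
    obtain rfl : P' = P := flat_injective (by
      rw [hP', hQ, hq]
      exact Setoid.ext fun u v => by
        change flat P.1 (σ (σ.symm u)) (σ (σ.symm v)) ↔ _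
        rw [Equiv.apply_symm_apply, Equiv.apply_symm_apply])
    have hr := hψ.comp (.perm σ)
    rw [e'] at hr
    exact ⟨_, hr⟩

/-- Bending up the last lower strand reduces the number of lower points, and by `bend_bend` it is
undone with one added strand and a cap. -/
lemma exists_realizes : ∀ {n m : ℕ} (g : (⟨n⟩ : Rep0 t) ⟶ ⟨m⟩), ∃ φ, T.Realizes g φ
  | 0, m, g => by
    refine hom_ind g ⟨0, .zero⟩ (fun f g ⟨φ, h⟩ ⟨ψ, h'⟩ => ⟨_, .add h h'⟩) fun a P => ?_
    obtain ⟨φ, h⟩ := exists_realizes_diag (T := T) P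
    exact ⟨_, .smul a h⟩
  | n + 1, m, g => by
    obtain ⟨φ, h⟩ := exists_realizes (cupLast t n ≫ addStrand g)
    rw [← bend_bend g]
    exact ⟨_, .comp h.up (.cap m)⟩


variable (T)

/-- The interpretation of a morphism out of `[0]`. -/
def vecHom (n : ℕ) : ((⟨0⟩ : Rep0 t) ⟶ ⟨n⟩) →ₗ[ℂ] (T.ob 0 ⟶ T.ob n) :=
  Finsupp.linearCombination ℂ fun P : EvenPart 0 n => T.vec n (flat P.1)

lemma vecHom_diag {n : ℕ} (P : EvenPart 0 n) :
    T.vecHom n (diag P) = T.vec n (flat P.1) :=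
  (Finsupp.linearCombination_single ℂ _ _).trans (one_smul _ _)

lemma vecHom_comp_of_diag {n m : ℕ} {g : (⟨n⟩ : Rep0 t) ⟶ ⟨m⟩} {φ : T.ob n ⟶ T.ob m}
    (h : ∀ P : EvenPart 0 n, T.vecHom m (diag P ≫ g) = T.vecHom n (diag P) ≫ φ)
    (f : (⟨0⟩ : Rep0 t) ⟶ ⟨n⟩) : T.vecHom m (f ≫ g) = T.vecHom n f ≫ φ := by
  refine hom_ind f ?_ (fun a b ha hb => ?_) fun a P => ?_
  · rw [zero_comp, map_zero, map_zero, zero_comp]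
  · rw [Preadditive.add_comp, map_add, map_add, Preadditive.add_comp, ha, hb]
  · rw [Linear.smul_comp, map_smul, map_smul, Linear.smul_comp, h]

variable {T}

/-- Here the calculus of vectors meets composition of partitions. For each generator the effect on
the flat partition is matched with the corresponding rule for `vec`; for the cap, the number of
loops is one exactly when the last two points form a block. -/
lemma Realizes.vecHom_comp {n m : ℕ} {g : (⟨n⟩ : Rep0 t) ⟶ ⟨m⟩} {φ : T.ob n ⟶ T.ob m}
    (h : T.Realizes g φ) :
    ∀ f : (⟨0⟩ : Rep0 t) ⟶ ⟨n⟩, T.vecHom m (f ≫ g) = T.vecHom n f ≫ φ := by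
  induction h with
  | @perm n σ =>
    refine T.vecHom_comp_of_diag fun P => ?_
    obtain ⟨Q, hQ, e⟩ := exists_diag_comp_perm (t := t) P σ
    have hc : ((flat P.1).comap σ.symm).comap σ = flat P.1 := Setoid.ext fun u v => by
      change flat P.1 (σ.symm (σ u)) (σ.symm (σ v)) ↔ _
      rw [Equiv.symm_apply_apply, Equiv.symm_apply_apply]
    rw [e, vecHom_diag, vecHom_diag, hQ, ← T.vec_perm (isEven_comap (isEven_flat P.2) σ.symm) σ, hc]
  | four n =>
    refine T.vecHom_comp_of_diag fun P => ?_
    obtain ⟨Q, hQ, e⟩ := exists_diag_comp_fourLast (t := t) P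
    rw [e, vecHom_diag, vecHom_diag, hQ, ← T.vec_al _ _ (isEven_flat P.2), al_last]
  | cap n =>
    refine T.vecHom_comp_of_diag fun P => ?_
    obtain ⟨Q, hQ, e⟩ := exists_diag_comp_capLast (t := t) P
    rw [e, map_smul, vecHom_diag, vecHom_diag, hQ]
    by_cases h : flat P.1 (pen n) (lst n)
    · by_cases hx : ∃ x, flat P.1 (cc x) (pen n)
      · obtain ⟨x, hx⟩ := hx
        rw [loops_cap_of_rel x (Or.inl hx), pow_zero, one_smul,
          T.vec_b_of_rel (isEven_flat P.2) h x hx]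
      · rw [loops_cap_of_not_rel h hx, pow_one, T.vec_b_loop (isEven_flat P.2) h hx]
    · obtain ⟨x, hx⟩ : ∃ x, flat P.1 (cc x) (lst n) := by
        obtain ⟨z, hz, hz'⟩ := exists_partner (isEven_flat P.2) (lst n)
        induction z using cc_cases with
        | h k => exact ⟨k, hz'⟩
        | h1 => exact absurd hz' h
        | h2 => exact absurd rfl hz
      rw [loops_cap_of_rel x (Or.inr hx), pow_zero, one_smul,
        T.vec_b_of_not_rel (isEven_flat P.2) h]
  | cup n =>
    refine T.vecHom_comp_of_diag fun P => ?_
    obtain ⟨Q, ⟨h1, h2, h3⟩, e⟩ := exists_diag_comp_cupLast (t := t) P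
    rw [e, vecHom_diag, vecHom_diag, T.vec_eq_d (isEven_flat Q.2) h2 h3, h1]
  | comp _ _ h h' =>
    intro f
    rw [← Category.assoc, h', h, Category.assoc]
  | zero => intro f; rw [comp_zero, map_zero, comp_zero]
  | add _ _ h h' => intro f; rw [Preadditive.comp_add, map_add, h, h', Preadditive.comp_add]
  | smul r _ h => intro f; rw [Linear.comp_smul, map_smul, h, Linear.comp_smul]

variable (T)

/-- The interpretation of morphisms of `Rep₀(H_t)` in a tower, by bending the lower strands. -/
def mapHom : ∀ k l, ((⟨k⟩ : Rep0 t) ⟶ ⟨l⟩) → (T.ob k ⟶ T.ob l)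
  | 0, l, f => T.vecHom l f
  | k + 1, l, f => T.up (mapHom k (l + 1) (cupLast t k ≫ addStrand f)) ≫ T.b l

variable {T}

/-- Composition on top commutes with bending the bottom. Induction on the number of lower strands
works because `Realizes` is closed under `up`. -/
lemma Realizes.mapHom_comp : ∀ {k n m : ℕ} {g : (⟨n⟩ : Rep0 t) ⟶ ⟨m⟩} {φ : T.ob n ⟶ T.ob m}
    (_ : T.Realizes g φ) (f : (⟨k⟩ : Rep0 t) ⟶ ⟨n⟩),
    T.mapHom k m (f ≫ g) = T.mapHom k n f ≫ φ
  | 0, _, _, _, _, h, f => h.vecHom_comp f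
  | k + 1, n, m, g, φ, h, f => by
    rw [mapHom, mapHom, addStrand_comp, ← Category.assoc, h.up.mapHom_comp, T.up_comp,
      Category.assoc, T.b_nat, Category.assoc]

variable (T)

lemma mapHom_id : ∀ n, T.mapHom n n (𝟙 _) = 𝟙 _
  | 0 => (T.vecHom_diag ⟨ofEquiv (Equiv.refl (Fin 0)), isEven_ofEquiv _⟩).trans rfl
  | n + 1 => by
    rw [mapHom, addStrand_id]
    have h := (Realizes.cup (T := T) n).mapHom_comp (𝟙 _)
    rw [mapHom_id n, Category.id_comp, Category.id_comp] at h
    have e : cupLast t n ≫ 𝟙 (⟨n + 1 + 1⟩ : Rep0 t) = cupLast t n := Category.comp_id _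
    rw [e, h, T.zig]

variable {T}

/-- Applying `mapHom_comp` to the identity shows that a realization is unique, so `Realizes` is the
graph of a function. -/
lemma Realizes.mapHom_eq {n m : ℕ} {g : (⟨n⟩ : Rep0 t) ⟶ ⟨m⟩} {φ : T.ob n ⟶ T.ob m}
    (h : T.Realizes g φ) : T.mapHom n m g = φ := by
  have := h.mapHom_comp (𝟙 _)
  rwa [mapHom_id, Category.id_comp, Category.id_comp] at this

variable (T)

lemma realizes_mapHom {n m : ℕ} (g : (⟨n⟩ : Rep0 t) ⟶ ⟨m⟩) : T.Realizes g (T.mapHom n m g) := by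
  obtain ⟨φ, h⟩ := exists_realizes (T := T) g
  rwa [h.mapHom_eq]

/-- The interpretation of `Rep₀(H_t)` in a tower. -/
def toFunctor : Rep0 t ⥤ D where
  obj X := T.ob X.n
  map {X Y} f := T.mapHom X.n Y.n f
  map_id X := T.mapHom_id X.n
  map_comp f g := ((T.realizes_mapHom f).comp (T.realizes_mapHom g)).mapHom_eq

instance : T.toFunctor.Additive where
  map_add := ((T.realizes_mapHom _).add (T.realizes_mapHom _)).mapHom_eq

instance : T.toFunctor.Linear ℂ where
  map_smul f r := ((T.realizes_mapHom f).smul r).mapHom_eq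

lemma Realizes.map_eq {n m : ℕ} {g : (⟨n⟩ : Rep0 t) ⟶ ⟨m⟩} {φ : T.ob n ⟶ T.ob m}
    (h : T.Realizes g φ) : T.toFunctor.map g = φ := h.mapHom_eq

lemma realizes_map {n m : ℕ} (g : (⟨n⟩ : Rep0 t) ⟶ ⟨m⟩) : T.Realizes g (T.toFunctor.map g) :=
  T.realizes_mapHom g

end NeutralTower


/-! ### Coherence of the isomorphisms between tensor powers -/

section TensorPowers
variable {C : Type u} [Category.{v} C] [MonoidalCategory C] (A : C)

/-- The definitions treat the exponents `0` and `1` separately. This uniform recursion is what the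
inductions below use to split off one factor. -/
lemma tpowAdd_succ (k : ℕ) : ∀ l, tpow A k ◁ (tpowSucc A l).hom ≫ (tpowAdd A k (l + 1)).hom =
    (α_ _ _ _).inv ≫ (tpowAdd A k l).hom ▷ A ≫ (tpowSucc A (k + l)).hom
  | 0 => by
    change tpow A k ◁ (λ_ A).hom ≫ (tpowSucc A k).hom = (α_ (tpow A k) (𝟙_ C) A).inv ≫
      (ρ_ (tpow A k)).hom ▷ A ≫ (tpowSucc A k).hom
    rw [triangle_assoc_comp_right_assoc]
  | l + 1 => by
    have h : (tpowSucc A (l + 1)).hom = 𝟙 (tpow A (l + 1) ⊗ A) := rfl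
    rw [h]
    exact (congrArg (· ≫ (tpowAdd A k (l + 2)).hom) (MonoidalCategory.whiskerLeft_id _ _)).trans
      (Category.id_comp _)

/-- Objects with equal numbers of factors. -/
abbrev tpowCast {m n : ℕ} (h : m = n) : tpow A m ⟶ tpow A n := eqToHom (congrArg (tpow A) h)

lemma tpowSucc_cast {m n : ℕ} (h : m = n) : (tpowSucc A m).hom ≫
    tpowCast A (congrArg (· + 1) h) = tpowCast A h ▷ A ≫ (tpowSucc A n).hom := by
  subst h; simp

lemma tpowAdd_assoc (k l : ℕ) : ∀ m, (tpowAdd A k l).hom ▷ tpow A m ≫ (tpowAdd A (k + l) m).hom ≫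
    tpowCast A (Nat.add_assoc k l m) =
      (α_ _ _ _).hom ≫ tpow A k ◁ (tpowAdd A l m).hom ≫ (tpowAdd A k (l + m)).hom
  | 0 => by
    change (tpowAdd A k l).hom ▷ 𝟙_ C ≫ (ρ_ (tpow A (k + l))).hom ≫ 𝟙 _ =
      (α_ (tpow A k) (tpow A l) (𝟙_ C)).hom ≫ tpow A k ◁ (ρ_ (tpow A l)).hom ≫ (tpowAdd A k l).hom
    simp
  | m + 1 => by
    have ih := tpowAdd_assoc k l m
    rw [← cancel_epi ((tpow A k ⊗ tpow A l) ◁ (tpowSucc A m).hom)]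
    rw [whisker_exchange_assoc, reassoc_of% (tpowAdd_succ A (k + l) m)]
    have h1 : (tpowSucc A (k + l + m)).hom ≫ tpowCast A (Nat.add_assoc k l (m + 1)) =
      tpowCast A (Nat.add_assoc k l m) ▷ A ≫ (tpowSucc A (k + (l + m))).hom :=
      tpowSucc_cast A (Nat.add_assoc k l m)
    rw [h1]
    have h2 := tpowAdd_succ A k (l + m)
    have h3 := tpowAdd_succ A l m
    have h4 := congrArg (· ▷ A) ih
    simp only [comp_whiskerRight] at h4
    have h5 : tpow A k ◁ ((tpowAdd A l m).hom ▷ A) ≫ tpow A k ◁ (tpowSucc A (l + m)).hom ≫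
        (tpowAdd A k (l + (m + 1))).hom = (α_ _ _ _).inv ≫ (tpow A k ◁ (tpowAdd A l m).hom) ▷ A ≫
          (tpowAdd A k (l + m)).hom ▷ A ≫ (tpowSucc A (k + (l + m))).hom := by
      refine (congrArg (_ ≫ ·) h2).trans ?_
      simp
    have h6 := congrArg (tpow A k ◁ ·) h3
    simp only [MonoidalCategory.whiskerLeft_comp] at h6
    rw [associator_naturality_right_assoc, reassoc_of% h6, h5]
    rw [associator_inv_naturality_left_assoc, reassoc_of% h4]
    simp

/-- The zeroth power is the unit. -/
def tpowUnit : tpow A 0 ≅ 𝟙_ C := Iso.refl _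

lemma tpowAdd_zero_left : ∀ l, (tpowAdd A 0 l).hom ≫ tpowCast A (Nat.zero_add l) =
    (tpowUnit A).hom ▷ tpow A l ≫ (λ_ (tpow A l)).hom
  | 0 => by
    change (ρ_ (𝟙_ C)).hom ≫ 𝟙 _ = 𝟙 (𝟙_ C) ▷ 𝟙_ C ≫ (λ_ (𝟙_ C)).hom
    simp [unitors_equal]
  | l + 1 => by
    have h4 := congrArg (· ▷ A) (tpowAdd_zero_left l)
    simp only [comp_whiskerRight] at h4
    rw [← cancel_epi (tpow A 0 ◁ (tpowSucc A l).hom), reassoc_of% (tpowAdd_succ A 0 l)]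
    have h1 : (tpowSucc A (0 + l)).hom ≫ tpowCast A (Nat.zero_add (l + 1)) =
      tpowCast A (Nat.zero_add l) ▷ A ≫ (tpowSucc A l).hom := tpowSucc_cast A (Nat.zero_add l)
    rw [h1, reassoc_of% h4, whisker_exchange_assoc, leftUnitor_naturality]
    simp

/-- A morphism on the last factors. -/
def tpowLast (n : ℕ) {i j : ℕ} (g : tpow A i ⟶ tpow A j) : tpow A (n + i) ⟶ tpow A (n + j) :=
  (tpowAdd A n i).inv ≫ tpow A n ◁ g ≫ (tpowAdd A n j).hom

/-- By `tpowAdd_assoc`, the factors to the left of `g` may be grouped together. This yields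
naturality for strands on the left of a generator. -/
lemma tpowAdd_tpowLast (k n : ℕ) {i j : ℕ} (g : tpow A i ⟶ tpow A j) :
    tpow A k ◁ tpowLast A n g ≫ (tpowAdd A k (n + j)).hom =
      (tpowAdd A k (n + i)).hom ≫ tpowCast A (Nat.add_assoc k n i).symm ≫ tpowLast A (k + n) g ≫
        tpowCast A (Nat.add_assoc k n j) := by
  have h1 := tpowAdd_assoc A k n i
  have h2 := tpowAdd_assoc A k n j
  rw [← cancel_epi (tpow A k ◁ (tpowAdd A n i).hom), ← cancel_epi (α_ _ _ _).hom,
    ← reassoc_of% h1, tpowLast, tpowLast]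
  simp only [MonoidalCategory.whiskerLeft_comp, Category.assoc, whiskerLeft_hom_inv_assoc,
    eqToHom_trans_assoc, eqToHom_refl, Category.id_comp, Iso.hom_inv_id_assoc]
  rw [← whisker_exchange_assoc, h2]
  simp

end TensorPowers


/-! ### Strands on the left and on the right of a morphism -/

namespace Rep0
open PartCat NeutralTower
variable {t : ℂ}

lemma fourLast_eq (n : ℕ) : fourLast t n = tens (𝟙 (⟨n⟩ : Rep0 t)) (fourLegs t) := by
  rw [id_eq_perm, perm, fourLegs, tens_diag]
  rfl

lemma capLast_eq (n : ℕ) : capLast t n = tens (𝟙 (⟨n⟩ : Rep0 t)) (cap t) := by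
  rw [id_eq_perm, perm, cap, tens_diag]
  rfl

lemma cupLast_eq (n : ℕ) : cupLast t n = tens (𝟙 (⟨n⟩ : Rep0 t)) (cup t) := by
  rw [id_eq_perm, perm, cup, tens_diag]
  rfl

lemma crossLast_eq (n : ℕ) : crossLast t n = tens (𝟙 (⟨n⟩ : Rep0 t)) (cross t) := by
  rw [cross, id_eq_perm, tens_perm]
  refine congrArg perm (Equiv.ext fun x => ?_)
  induction x using cc_cases with
  | h x =>
    rw [Equiv.swap_apply_of_ne_of_ne (cc_ne_pen x) (cc_ne_lst x)]
    exact (sumPerm_castAdd (Equiv.refl (Fin n)) (Equiv.swap (0 : Fin 2) 1) x).symm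
  | h1 =>
    rw [Equiv.swap_apply_left]
    exact ((sumPerm_natAdd (Equiv.refl (Fin n)) (Equiv.swap (0 : Fin 2) 1) 0).trans
      (congrArg (Fin.natAdd n) (Equiv.swap_apply_left 0 1))).symm
  | h2 =>
    rw [Equiv.swap_apply_right]
    exact ((sumPerm_natAdd (Equiv.refl (Fin n)) (Equiv.swap (0 : Fin 2) 1) 1).trans
      (congrArg (Fin.natAdd n) (Equiv.swap_apply_right 0 1))).symm

/-- Strands on the left of a morphism. -/
def strandsLeft (k : ℕ) {n m : ℕ} (g : (⟨n⟩ : Rep0 t) ⟶ ⟨m⟩) : (⟨k + n⟩ : Rep0 t) ⟶ ⟨k + m⟩ :=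
  tens (𝟙 (⟨k⟩ : Rep0 t)) g

/-- Strands on the right of a morphism. -/
def strandsRight {n m : ℕ} (g : (⟨n⟩ : Rep0 t) ⟶ ⟨m⟩) (l : ℕ) : (⟨n + l⟩ : Rep0 t) ⟶ ⟨m + l⟩ :=
  tens g (𝟙 (⟨l⟩ : Rep0 t))

lemma tens_id_id (k n : ℕ) :
    tens (𝟙 (⟨k⟩ : Rep0 t)) (𝟙 (⟨n⟩ : Rep0 t)) = 𝟙 (⟨k + n⟩ : Rep0 t) :=
  id_tensorHom_id (C := Rep0 t) ⟨k⟩ ⟨n⟩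

lemma tens_id_tens {k n p q : ℕ} (g : (⟨p⟩ : Rep0 t) ⟶ ⟨q⟩) :
    tens (𝟙 (⟨k + n⟩ : Rep0 t)) g ≫ perm (X := ⟨k + n + q⟩) (Y := ⟨k + (n + q)⟩)
        (finCongr (Nat.add_assoc _ _ _)) =
      perm (X := ⟨k + n + p⟩) (Y := ⟨k + (n + p)⟩) (finCongr (Nat.add_assoc _ _ _)) ≫
        tens (𝟙 (⟨k⟩ : Rep0 t)) (tens (𝟙 (⟨n⟩ : Rep0 t)) g) := by
  rw [← tens_id_id]
  exact assoc_natural (𝟙 (⟨k⟩ : Rep0 t)) (𝟙 (⟨n⟩ : Rep0 t)) g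

lemma strandsLeft_fourLast (k n : ℕ) : strandsLeft k (fourLast t n) = fourLast t (k + n) := by
  have h := tens_id_tens (k := k) (n := n) (fourLegs t)
  rw [← fourLast_eq, ← fourLast_eq] at h
  -- The numbers `k + n + 2` and `k + (n + 2)` agree by definition, so the associators are
  -- identities and can be dropped.
  exact (Category.id_comp _).symm.trans (h.symm.trans (Category.comp_id _))

lemma strandsLeft_crossLast (k n : ℕ) :
    strandsLeft k (crossLast t n) = crossLast t (k + n) := by
  have h := tens_id_tens (k := k) (n := n) (cross t)
  rw [← crossLast_eq, ← crossLast_eq] at h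
  exact (Category.id_comp _).symm.trans (h.symm.trans (Category.comp_id _))

lemma strandsLeft_capLast (k n : ℕ) : strandsLeft k (capLast t n) = capLast t (k + n) := by
  have h := tens_id_tens (k := k) (n := n) (cap t)
  rw [← capLast_eq, ← capLast_eq] at h
  exact (Category.id_comp _).symm.trans (h.symm.trans (Category.comp_id _))

lemma strandsLeft_cupLast (k n : ℕ) : strandsLeft k (cupLast t n) = cupLast t (k + n) := by
  have h := tens_id_tens (k := k) (n := n) (cup t)
  rw [← cupLast_eq, ← cupLast_eq] at h
  exact (Category.id_comp _).symm.trans (h.symm.trans (Category.comp_id _))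

lemma strandsLeft_addStrand {k n m : ℕ} (g : (⟨n⟩ : Rep0 t) ⟶ ⟨m⟩) :
    strandsLeft k (addStrand g) = addStrand (strandsLeft k g) := by
  have h := assoc_natural (𝟙 (⟨k⟩ : Rep0 t)) g (𝟙 (⟨1⟩ : Rep0 t))
  exact (Category.id_comp _).symm.trans (h.symm.trans (Category.comp_id _))

lemma strandsRight_succ {l n m : ℕ} (g : (⟨n⟩ : Rep0 t) ⟶ ⟨m⟩) :
    strandsRight g (l + 1) = addStrand (strandsRight g l) := by
  have h := assoc_natural g (𝟙 (⟨l⟩ : Rep0 t)) (𝟙 (⟨1⟩ : Rep0 t))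
  rw [tens_id_id] at h
  exact (Category.id_comp _).symm.trans (h.symm.trans (Category.comp_id _))

lemma strandsRight_zero {n m : ℕ} (g : (⟨n⟩ : Rep0 t) ⟶ ⟨m⟩) : strandsRight g 0 = g :=
  (Category.comp_id _).symm.trans ((right_natural g).trans (Category.id_comp _))

end Rep0

namespace NeutralTower
open PartCat Rep0
variable {t : ℂ} {D : Type u} [Category.{v} D] [Preadditive D] [Linear ℂ D]

/-- The morphisms of `Rep₀(H_t)` are generated by the crossings, the four-legged blocks, the cups
and the caps on the last strands. -/
lemma hom_induction (T : NeutralTower t D)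
    {M : ∀ {n m : ℕ}, ((⟨n⟩ : Rep0 t) ⟶ ⟨m⟩) → Prop}
    (id : ∀ n, M (𝟙 (⟨n⟩ : Rep0 t))) (cross : ∀ n, M (crossLast t n)) (four : ∀ n, M (fourLast t n))
    (cap : ∀ n, M (capLast t n)) (cup : ∀ n, M (cupLast t n))
    (up : ∀ {n m : ℕ} (g : (⟨n⟩ : Rep0 t) ⟶ ⟨m⟩), M g → M (addStrand g))
    (comp : ∀ {n m k : ℕ} (g : (⟨n⟩ : Rep0 t) ⟶ ⟨m⟩) (g' : (⟨m⟩ : Rep0 t) ⟶ ⟨k⟩),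
      M g → M g' → M (g ≫ g'))
    (zero : ∀ n m, M (0 : (⟨n⟩ : Rep0 t) ⟶ ⟨m⟩))
    (add : ∀ {n m : ℕ} (g g' : (⟨n⟩ : Rep0 t) ⟶ ⟨m⟩), M g → M g' → M (g + g'))
    (smul : ∀ {n m : ℕ} (r : ℂ) (g : (⟨n⟩ : Rep0 t) ⟶ ⟨m⟩), M g → M (r • g))
    {n m : ℕ} (g : (⟨n⟩ : Rep0 t) ⟶ ⟨m⟩) : M g := by
  -- The tower only provides a derivation of `Realizes` for `g`, and the induction runs over this
  -- derivation.
  have h := T.realizes_map g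
  generalize T.toFunctor.map g = φ at h
  induction h with
  | @perm n σ =>
    refine perm_fin_induction (M := fun n σ => M (Rep0.perm (X := ⟨n⟩) (Y := ⟨n⟩) σ)) id
      (fun n σ τ h h' => ?_) (fun n σ h => ?_) cross n σ
    · have := comp _ _ h' h
      rwa [perm_comp_perm] at this
    · rw [← addStrand_perm]; exact up _ h
  | four n => exact four n
  | cap n => exact cap n
  | cup n => exact cup n
  | comp _ _ h h' => exact comp _ _ h h'
  | zero => exact zero _ _
  | add _ _ h h' => exact add _ _ h h'
  | smul r _ h => exact smul r _ h

end NeutralTower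

/-! ### The functor on the tensor powers of `A` -/

section PowFunctor
open Rep0
variable {C : Type u} [Category.{v} C] [Preadditive C] [Linear ℂ C] [MonoidalCategory C]
  [MonoidalPreadditive C] [MonoidalLinear ℂ C] [SymmetricCategory C] {t : ℂ} {A : C}
  {α : A ⊗ A ⟶ A ⊗ A} {β : A ⊗ A ⟶ 𝟙_ C} {δ : 𝟙_ C ⟶ A ⊗ A}

variable (h : IsSelfDualWithNeutralizer t A α β δ)

/-- The interpretation of the morphisms of `Rep₀(H_t)` on the tensor powers of `A`. -/
def pmap {n m : ℕ} (g : (⟨n⟩ : Rep0 t) ⟶ ⟨m⟩) : tpow A n ⟶ tpow A m :=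
  ((tpowSeq A).neutralTower h).toFunctor.map g

lemma pmap_id (n : ℕ) : pmap h (𝟙 (⟨n⟩ : Rep0 t)) = 𝟙 (tpow A n) :=
  ((tpowSeq A).neutralTower h).toFunctor.map_id _

lemma pmap_comp {n m k : ℕ} (g : (⟨n⟩ : Rep0 t) ⟶ ⟨m⟩) (g' : (⟨m⟩ : Rep0 t) ⟶ ⟨k⟩) :
    pmap h (g ≫ g') = pmap h g ≫ pmap h g' :=
  ((tpowSeq A).neutralTower h).toFunctor.map_comp _ _

lemma pmap_add {n m : ℕ} (g g' : (⟨n⟩ : Rep0 t) ⟶ ⟨m⟩) :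
    pmap h (g + g') = pmap h g + pmap h g' :=
  ((tpowSeq A).neutralTower h).toFunctor.map_add

lemma pmap_smul {n m : ℕ} (r : ℂ) (g : (⟨n⟩ : Rep0 t) ⟶ ⟨m⟩) :
    pmap h (r • g) = r • pmap h g :=
  ((tpowSeq A).neutralTower h).toFunctor.map_smul _ _

lemma pmap_zero (n m : ℕ) : pmap h (0 : (⟨n⟩ : Rep0 t) ⟶ ⟨m⟩) = 0 :=
  ((tpowSeq A).neutralTower h).toFunctor.map_zero _ _

lemma pmap_addStrand {n m : ℕ} (g : (⟨n⟩ : Rep0 t) ⟶ ⟨m⟩) :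
    (tpowSucc A n).hom ≫ pmap h (addStrand g) = pmap h g ▷ A ≫ (tpowSucc A m).hom :=
  (congrArg ((tpowSucc A n).hom ≫ ·)
    (((tpowSeq A).neutralTower h).realizes_map g).up.map_eq).trans ((tpowSeq A).e_up _)

lemma pmap_fourLast (n : ℕ) : pmap h (fourLast t n) = tpowLast A n (i := 2) (j := 2) α :=
  (NeutralTower.Realizes.four (T := (tpowSeq A).neutralTower h) n).map_eq

lemma pmap_crossLast (n : ℕ) :
    pmap h (crossLast t n) = tpowLast A n (i := 2) (j := 2) (β_ A A).hom :=
  (NeutralTower.Realizes.cross (T := (tpowSeq A).neutralTower h) n).map_eq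

lemma pmap_capLast (n : ℕ) : pmap h (capLast t n) = tpowLast A n (i := 2) (j := 0) β :=
  (NeutralTower.Realizes.cap (T := (tpowSeq A).neutralTower h) n).map_eq

lemma pmap_cupLast (n : ℕ) : pmap h (cupLast t n) = tpowLast A n (i := 0) (j := 2) δ :=
  (NeutralTower.Realizes.cup (T := (tpowSeq A).neutralTower h) n).map_eq

/-- The associators and unitors of `Rep0` are such relabelings. Their images are the casts that
occur in the coherence of `tpowAdd`. -/
lemma pmap_perm_cast {m n : ℕ} (e : m = n) :
    pmap h (perm (X := ⟨m⟩) (Y := ⟨n⟩) (finCongr e)) = tpowCast A e := by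
  subst e
  exact pmap_id h _

lemma pmap_natural_left {n m : ℕ} (g : (⟨n⟩ : Rep0 t) ⟶ ⟨m⟩) : ∀ l : ℕ,
    pmap h g ▷ tpow A l ≫ (tpowAdd A m l).hom = (tpowAdd A n l).hom ≫ pmap h (strandsRight g l)
  | 0 => by
    rw [strandsRight_zero]
    exact rightUnitor_naturality _
  | l + 1 => by
    have ih := congrArg (· ▷ A) (pmap_natural_left g l)
    simp only [comp_whiskerRight] at ih
    have e : (tpowSucc A (n + l)).hom ≫ pmap h (addStrand (strandsRight g l)) =
        pmap h (strandsRight g l) ▷ A ≫ (tpowSucc A (m + l)).hom := pmap_addStrand h _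
    have h1 := tpowAdd_succ A n l
    have h2 := tpowAdd_succ A m l
    rw [strandsRight_succ, ← cancel_epi (tpow A n ◁ (tpowSucc A l).hom)]
    have h3 : (tpow A n ◁ (tpowSucc A l).hom ≫ (tpowAdd A n (l + 1)).hom) ≫
        pmap h (addStrand (strandsRight g l)) =
        (α_ _ _ _).inv ≫ (tpowAdd A n l).hom ▷ A ≫
          pmap h (strandsRight g l) ▷ A ≫ (tpowSucc A (m + l)).hom := by
      rw [h1, Category.assoc, Category.assoc, e]
    refine Eq.trans ?_ (h3.symm.trans (Category.assoc _ _ _))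
    rw [← reassoc_of% ih, ← associator_inv_naturality_left_assoc, ← h2, whisker_exchange_assoc]

lemma strict_conj {W X Y : C} {f : W ⟶ X} {g : X ⟶ Y} {p : X ⟶ X} {q : Y ⟶ Y} (hp : p = 𝟙 X)
    (hq : q = 𝟙 Y) : f ≫ p ≫ g ≫ q = f ≫ g := by
  rw [hp, hq, Category.id_comp, Category.comp_id]

/-- Strands on the right are iterated added strands, but strands on the left are not visible to the
recursion. Naturality is therefore checked on generators, which strands on the left merely shift to
a higher level. -/
lemma pmap_natural_right (k : ℕ) {n m : ℕ} (g : (⟨n⟩ : Rep0 t) ⟶ ⟨m⟩) :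
    tpow A k ◁ pmap h g ≫ (tpowAdd A k m).hom = (tpowAdd A k n).hom ≫ pmap h (strandsLeft k g) := by
  refine ((tpowSeq A).neutralTower h).hom_induction
    (M := fun {n m} g => tpow A k ◁ pmap h g ≫ (tpowAdd A k m).hom =
      (tpowAdd A k n).hom ≫ pmap h (strandsLeft k g)) (fun n => ?_) (fun n => ?_) (fun n => ?_)
    (fun n => ?_) (fun n => ?_) (fun {n m} g ih => ?_) (fun {n m l} g g' ih ih' => ?_) (fun n m => ?_)
    (fun {n m} g g' ih ih' => ?_) (fun {n m} r g ih => ?_) g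
  · have e : strandsLeft k (𝟙 (⟨n⟩ : Rep0 t)) = 𝟙 _ := tens_id_id k n
    rw [e, pmap_id, pmap_id, MonoidalCategory.whiskerLeft_id, Category.id_comp, Category.comp_id]
  · rw [strandsLeft_crossLast, pmap_crossLast]
    exact ((tpowAdd_tpowLast A k n _).trans (strict_conj (by rfl) (by rfl))).trans
      (congrArg (_ ≫ ·) (pmap_crossLast h (k + n)).symm)
  · rw [strandsLeft_fourLast, pmap_fourLast]
    exact ((tpowAdd_tpowLast A k n _).trans (strict_conj (by rfl) (by rfl))).trans
      (congrArg (_ ≫ ·) (pmap_fourLast h (k + n)).symm)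
  · rw [strandsLeft_capLast, pmap_capLast]
    exact ((tpowAdd_tpowLast A k n _).trans (strict_conj (by rfl) (by rfl))).trans
      (congrArg (_ ≫ ·) (pmap_capLast h (k + n)).symm)
  · rw [strandsLeft_cupLast, pmap_cupLast]
    exact ((tpowAdd_tpowLast A k n _).trans (strict_conj (by rfl) (by rfl))).trans
      (congrArg (_ ≫ ·) (pmap_cupLast h (k + n)).symm)
  · have e₁ := congrArg (tpow A k ◁ ·) (pmap_addStrand h g)
    have e₂ : (tpowSucc A (k + n)).hom ≫ pmap h (addStrand (strandsLeft k g)) =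
        pmap h (strandsLeft k g) ▷ A ≫ (tpowSucc A (k + m)).hom := pmap_addStrand h _
    have ih := congrArg (· ▷ A) ih
    simp only [comp_whiskerRight] at ih
    simp only [MonoidalCategory.whiskerLeft_comp] at e₁
    have h1 := tpowAdd_succ A k n
    have h2 := tpowAdd_succ A k m
    rw [strandsLeft_addStrand, ← cancel_epi (tpow A k ◁ (tpowSucc A n).hom), reassoc_of% e₁, h2]
    have h3 : (tpow A k ◁ (tpowSucc A n).hom ≫ (tpowAdd A k (n + 1)).hom) ≫
        pmap h (addStrand (strandsLeft k g)) = (α_ _ _ _).inv ≫ (tpowAdd A k n).hom ▷ A ≫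
          pmap h (strandsLeft k g) ▷ A ≫ (tpowSucc A (k + m)).hom := by
      rw [h1, Category.assoc, Category.assoc, e₂]
    refine Eq.trans ?_ (h3.symm.trans (Category.assoc _ _ _))
    rw [← reassoc_of% ih, associator_inv_naturality_middle_assoc]
  · have e : strandsLeft k (g ≫ g') = strandsLeft k g ≫ strandsLeft k g' :=
      MonoidalCategory.whiskerLeft_comp (C := Rep0 t) ⟨k⟩ g g'
    rw [e, pmap_comp, pmap_comp, MonoidalCategory.whiskerLeft_comp, Category.assoc, ih',
      reassoc_of% ih]
  · have e : strandsLeft k (0 : (⟨n⟩ : Rep0 t) ⟶ ⟨m⟩) = 0 := tens_zero _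
    rw [e, pmap_zero, pmap_zero, MonoidalPreadditive.whiskerLeft_zero, zero_comp, comp_zero]
  · have e : strandsLeft k (g + g') = strandsLeft k g + strandsLeft k g' := tens_add _ _ _
    rw [e, pmap_add, pmap_add, MonoidalPreadditive.whiskerLeft_add, Preadditive.add_comp,
      Preadditive.comp_add, ih, ih']
  · have e : strandsLeft k (r • g) = r • strandsLeft k g := tens_smul _ _ _
    rw [e, pmap_smul, pmap_smul, MonoidalLinear.whiskerLeft_smul, Linear.smul_comp,
      Linear.comp_smul, ih]

/-- The interpretation of `Rep₀(H_t)` on the tensor powers of `A`. -/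
def powFunctor : Rep0 t ⥤ C where
  obj X := tpow A X.n
  map f := pmap h f
  map_id X := pmap_id h X.n
  map_comp f g := pmap_comp h f g

instance : (powFunctor h).Additive where
  map_add := pmap_add h _ _

instance : (powFunctor h).Linear ℂ where
  map_smul f r := pmap_smul h r f

instance powFunctorMonoidal : (powFunctor h).Monoidal :=
  Functor.CoreMonoidal.toMonoidal
    { εIso := Iso.refl (𝟙_ C)
      μIso := fun X Y => tpowAdd A X.n Y.n
      μIso_hom_natural_left := fun f X => pmap_natural_left h f X.n
      μIso_hom_natural_right := fun X f => pmap_natural_right h X.n f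
      associativity := fun X Y Z =>
        (congrArg (_ ▷ _ ≫ _ ≫ ·) (pmap_perm_cast h (Nat.add_assoc X.n Y.n Z.n))).trans
          (tpowAdd_assoc A X.n Y.n Z.n)
      left_unitality := fun X => by
        have e := (congrArg (_ ≫ ·) (pmap_perm_cast h (Nat.zero_add X.n))).trans
          (tpowAdd_zero_left A X.n)
        have e' : 𝟙 (𝟙_ C) ▷ tpow A X.n ≫ (λ_ (tpow A X.n)).hom = (λ_ (tpow A X.n)).hom := by simp
        exact (e.trans e').symm.trans
          ((congrArg (· ≫ _) (id_whiskerRight (𝟙_ C) (tpow A X.n))).trans (Category.id_comp _)).symm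
      right_unitality := fun X => by
        have e := congrArg ((ρ_ (tpow A X.n)).hom ≫ ·) (pmap_perm_cast h (Nat.add_zero X.n))
        have e' : tpow A X.n ◁ 𝟙 (𝟙_ C) ≫ (ρ_ (tpow A X.n)).hom ≫ 𝟙 (tpow A X.n) =
          (ρ_ (tpow A X.n)).hom := by simp
        exact e'.symm.trans (congrArg (_ ≫ ·) e.symm) }

end PowFunctor


/-! ### Compatibility with the symmetries -/

section BraidCompat
open Functor.LaxMonoidal
variable {D : Type*} [Category D] [MonoidalCategory D] [SymmetricCategory D]
  {C : Type*} [Category C] [MonoidalCategory C] [SymmetricCategory C]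
  (F : D ⥤ C) [F.Monoidal]

/-- The functor is compatible with the symmetry of `X` and `Y`. -/
def BraidCompat (X Y : D) : Prop :=
  μ F X Y ≫ F.map (β_ X Y).hom = (β_ (F.obj X) (F.obj Y)).hom ≫ μ F Y X

variable {F}

lemma BraidCompat.symm {X Y : D} (h : BraidCompat F X Y) : BraidCompat F Y X := by
  have h : μ F X Y ≫ F.map (β_ X Y).hom = (β_ (F.obj X) (F.obj Y)).hom ≫ μ F Y X := h
  change _ = _
  rw [← cancel_epi (β_ (F.obj X) (F.obj Y)).hom, ← reassoc_of% h, ← F.map_comp,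
    SymmetricCategory.symmetry, F.map_id, SymmetricCategory.symmetry_assoc, Category.comp_id]

/-- A braiding with the unit is determined by the unitors, which a monoidal functor respects. -/
lemma braidCompat_unit (X : D) : BraidCompat F X (𝟙_ D) := by
  change _ = _
  have h := right_unitality F X
  have h' := left_unitality F X
  rw [← cancel_epi (F.obj X ◁ ε F), ← cancel_mono (F.map (λ_ X).hom), Category.assoc, Category.assoc,
    Category.assoc, Category.assoc, ← F.map_comp, braiding_leftUnitor, ← h,
    BraidedCategory.braiding_naturality_right_assoc, ← h', braiding_leftUnitor]

/-- The hexagons in both categories reduce the braiding with `Y ⊗ Z` to those with `Y` and `Z`;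
associativity of `μ` matches the bracketings. -/
lemma BraidCompat.tensor {X Y Z : D} (h : BraidCompat F X Y) (h' : BraidCompat F X Z) :
    BraidCompat F X (Y ⊗ Z) := by
  have h : μ F X Y ≫ F.map (β_ X Y).hom = (β_ (F.obj X) (F.obj Y)).hom ≫ μ F Y X := h
  have h' : μ F X Z ≫ F.map (β_ X Z).hom = (β_ (F.obj X) (F.obj Z)).hom ≫ μ F Z X := h'
  change _ = _
  have e1 := associativity F X Y Z
  have e2 := associativity F Y X Z
  have e3 := associativity F Y Z X
  have hex := congrArg F.map (BraidedCategory.hexagon_forward X Y Z)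
  have hex' := BraidedCategory.hexagon_forward (F.obj X) (F.obj Y) (F.obj Z)
  simp only [F.map_comp] at hex
  have hr := congrArg (· ▷ F.obj Z) h
  have hl := congrArg (F.obj Y ◁ ·) h'
  simp only [comp_whiskerRight, MonoidalCategory.whiskerLeft_comp] at hr hl
  rw [← cancel_epi (F.obj X ◁ μ F Y Z), ← cancel_epi (α_ (F.obj X) (F.obj Y) (F.obj Z)).hom,
    ← cancel_mono (F.map (α_ Y Z X).hom)]
  simp only [Category.assoc]
  rw [← reassoc_of% e1, hex, ← μ_natural_left_assoc, reassoc_of% hr, reassoc_of% e2,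
    ← μ_natural_right, reassoc_of% hl, BraidedCategory.braiding_naturality_right_assoc, e3,
    reassoc_of% hex']

end BraidCompat

/-! ### Equality of linear symmetric monoidal functors -/

section LinSymExt
open Functor.LaxMonoidal Functor.OplaxMonoidal
variable {D : Type*} [Category D] [Preadditive D] [Linear ℂ D] [MonoidalCategory D]
  [BraidedCategory D]
variable {C : Type*} [Category C] [Preadditive C] [Linear ℂ C] [MonoidalCategory C]
  [BraidedCategory C]

lemma laxMonoidal_ext {F : D ⥤ C} {i j : F.LaxMonoidal} (hε : i.ε = j.ε) (hμ : i.μ = j.μ) :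
    i = j := by
  cases i; cases j
  cases hε; cases hμ
  rfl

/-- The oplax constraints are inverse to the lax ones and hence determined by them. -/
lemma monoidal_ext {F : D ⥤ C} {i j : F.Monoidal} (hε : i.ε = j.ε) (hμ : i.μ = j.μ) :
    i = j := by
  have h1 : i.toLaxMonoidal = j.toLaxMonoidal := laxMonoidal_ext hε hμ
  have hη : i.η = j.η := by
    have h2 := i.η_ε
    have h3 := j.ε_η
    rw [hε] at h2
    calc i.η = i.η ≫ j.ε ≫ j.η := by rw [h3, Category.comp_id]
      _ = j.η := by rw [← Category.assoc, h2, Category.id_comp]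
  have hδ : i.δ = j.δ := by
    funext X Y
    have h2 := i.δ_μ X Y
    have h3 := j.μ_δ X Y
    rw [hμ] at h2
    calc i.δ X Y = i.δ X Y ≫ j.μ X Y ≫ j.δ X Y := by rw [h3, Category.comp_id]
      _ = j.δ X Y := by rw [← Category.assoc, h2, Category.id_comp]
  have h4 : i.toOplaxMonoidal = j.toOplaxMonoidal := by
    cases i with | @mk a b => cases j with | @mk c d =>
      cases b; cases d
      cases hη; cases hδ
      rfl
  cases i; cases j
  cases h1; cases h4
  rfl

lemma braided_ext {F : D ⥤ C} {i j : F.Braided} (hε : i.ε = j.ε) (hμ : i.μ = j.μ) : i = j := by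
  have h1 : i.toMonoidal = j.toMonoidal := monoidal_ext hε hμ
  cases i; cases j
  cases h1
  rfl

/-- Linear symmetric monoidal functors are equal if their values and structure constraints are. -/
lemma LinSymFunctor.ext' {F G : LinSymFunctor D C} (hF : F.toFunctor = G.toFunctor)
    (hε : ε F.toFunctor ≫ eqToHom (by rw [hF]) = ε G.toFunctor)
    (hμ : ∀ X Y, μ F.toFunctor X Y ≫ eqToHom (by rw [hF]) =
      (eqToHom (by rw [hF]) ⊗ₘ eqToHom (by rw [hF])) ≫ μ G.toFunctor X Y) : F = G := by
  obtain ⟨F, _, _, i⟩ := F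
  obtain ⟨G, _, _, j⟩ := G
  dsimp only at hF
  subst hF
  obtain rfl : i = j := braided_ext (by simpa using hε) (by
    funext X Y
    simpa using hμ X Y)
  rfl

end LinSymExt


/-! ### Existence and uniqueness of the strict realization -/

section Realization
open Rep0 NeutralTower Functor.LaxMonoidal
variable {C : Type u} [Category.{v} C] [Preadditive C] [Linear ℂ C] [MonoidalCategory C]
  [MonoidalPreadditive C] [MonoidalLinear ℂ C] [SymmetricCategory C] {t : ℂ} {A : C}
  {α : A ⊗ A ⟶ A ⊗ A} {β : A ⊗ A ⟶ 𝟙_ C} {δ : 𝟙_ C ⟶ A ⊗ A}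
  (h : IsSelfDualWithNeutralizer t A α β δ)

lemma tpowLast_zero {i j : ℕ} (g : tpow A i ⟶ tpow A j) :
    tpowLast A 0 g = tpowCast A (Nat.zero_add i) ≫ g ≫ tpowCast A (Nat.zero_add j).symm := by
  have h1 := tpowAdd_zero_left A i
  have h2 := tpowAdd_zero_left A j
  rw [tpowLast, Iso.inv_comp_eq, reassoc_of% h1, ← cancel_mono (tpowCast A (Nat.zero_add j))]
  simp only [Category.assoc, eqToHom_trans, eqToHom_refl, Category.comp_id]
  rw [h2, whisker_exchange_assoc]
  rw [leftUnitor_naturality]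

lemma strandsLeft_zero {n m : ℕ} (g : (⟨n⟩ : Rep0 t) ⟶ ⟨m⟩) :
    strandsLeft 0 g ≫ perm (X := ⟨0 + m⟩) (Y := ⟨m⟩) (finCongr (Nat.zero_add _)) =
      perm (X := ⟨0 + n⟩) (Y := ⟨n⟩) (finCongr (Nat.zero_add _)) ≫ g :=
  left_natural g

lemma crossLast_zero : crossLast t 0 = cross t := by
  rw [crossLast_eq]
  exact (Category.comp_id _).symm.trans ((strandsLeft_zero (cross t)).trans (Category.id_comp _))

lemma fourLast_zero : fourLast t 0 = fourLegs t := by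
  rw [fourLast_eq]
  exact (Category.comp_id _).symm.trans ((strandsLeft_zero (fourLegs t)).trans (Category.id_comp _))

lemma capLast_zero : capLast t 0 = cap t := by
  rw [capLast_eq]
  exact (Category.comp_id _).symm.trans ((strandsLeft_zero (cap t)).trans (Category.id_comp _))

lemma cupLast_zero : cupLast t 0 = cup t := by
  rw [cupLast_eq]
  exact (Category.comp_id _).symm.trans ((strandsLeft_zero (cup t)).trans (Category.id_comp _))

lemma pmap_fourLegs : pmap h (fourLegs t) = α := by
  rw [← fourLast_zero]
  exact (pmap_fourLast h 0).trans ((tpowLast_zero (A := A) (i := 2) (j := 2) α).trans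
    ((Category.id_comp _).trans (Category.comp_id _)))

lemma pmap_cross : pmap h (cross t) = (β_ A A).hom := by
  rw [← crossLast_zero]
  exact (pmap_crossLast h 0).trans ((tpowLast_zero (A := A) (i := 2) (j := 2) (β_ A A).hom).trans
    ((Category.id_comp _).trans (Category.comp_id _)))

lemma pmap_cap : pmap h (cap t) = β := by
  rw [← capLast_zero]
  exact (pmap_capLast h 0).trans ((tpowLast_zero (A := A) (i := 2) (j := 0) β).trans
    ((Category.id_comp _).trans (Category.comp_id _)))

lemma pmap_cup : pmap h (cup t) = δ := by
  rw [← cupLast_zero]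
  exact (pmap_cupLast h 0).trans ((tpowLast_zero (A := A) (i := 0) (j := 2) δ).trans
    ((Category.id_comp _).trans (Category.comp_id _)))

lemma cross_eq_braiding : (β_ (⟨1⟩ : Rep0 t) ⟨1⟩).hom = cross t := by
  refine congrArg (perm (X := ⟨2⟩) (Y := ⟨2⟩)) (Equiv.ext fun x => ?_)
  fin_cases x <;> rfl

lemma powFunctor_braidCompat_one :
    BraidCompat (powFunctor h) (⟨1⟩ : Rep0 t) (⟨1⟩ : Rep0 t) := by
  have e : (powFunctor h).map (β_ (⟨1⟩ : Rep0 t) ⟨1⟩).hom = (β_ A A).hom := by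
    rw [cross_eq_braiding]
    exact pmap_cross h
  exact (congrArg (μ (powFunctor h) (⟨1⟩ : Rep0 t) (⟨1⟩ : Rep0 t) ≫ ·) e).trans
    ((Category.id_comp _).trans (Category.comp_id (β_ A A).hom).symm)

/-- Since `[l + 1] = [l] ⊗ [1]`, induction in one variable, symmetry, and induction in the other
variable reach all pairs. -/
lemma braidCompat_of_one {F : Rep0 t ⥤ C} [F.Monoidal]
    (e : BraidCompat F (⟨1⟩ : Rep0 t) (⟨1⟩ : Rep0 t)) (X Y : Rep0 t) :
    BraidCompat F X Y := by
  have key : ∀ X : Rep0 t, BraidCompat F X (⟨1⟩ : Rep0 t) →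
      ∀ l : ℕ, BraidCompat F X (⟨l⟩ : Rep0 t) := by
    intro X hX l
    induction l with
    | zero => exact braidCompat_unit X
    | succ l ih => exact BraidCompat.tensor (Y := (⟨l⟩ : Rep0 t)) (Z := (⟨1⟩ : Rep0 t)) ih hX
  exact key X (key ⟨1⟩ e X.n).symm Y.n

/-- The functor `G'`. -/
def powLinSym : LinSymFunctor (Rep0 t) C where
  toFunctor := powFunctor h
  additive := inferInstance
  linear := inferInstance
  braided :=
    { toMonoidal := powFunctorMonoidal h
      braided := braidCompat_of_one (powFunctor_braidCompat_one h) }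

lemma isStrictRealization_powLinSym : IsStrictRealization A α β δ (powLinSym h) where
  obj_eq _ := rfl
  unit_eq := Category.comp_id (𝟙 (𝟙_ C))
  tensor_eq k l := (Category.comp_id _).trans
    ((congrArg (· ≫ _) (id_tensorHom_id (tpow A k) (tpow A l))).trans (Category.id_comp _)).symm
  map_fourLegs := (Category.id_comp _).trans ((Category.comp_id _).trans (pmap_fourLegs h))
  map_cap := (Category.id_comp _).trans ((Category.comp_id _).trans (pmap_cap h))
  map_cup := (Category.id_comp _).trans ((Category.comp_id _).trans (pmap_cup h))
  map_cross := (Category.id_comp _).trans ((Category.comp_id _).trans (pmap_cross h))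

namespace IsStrictRealization
variable {F : LinSymFunctor (Rep0 t) C} (hF : IsStrictRealization A α β δ F)

/-- The values of a strict realization, between the tensor powers. -/
def val {n m : ℕ} (g : (⟨n⟩ : Rep0 t) ⟶ ⟨m⟩) : tpow A n ⟶ tpow A m :=
  eqToHom (hF.obj_eq n).symm ≫ F.toFunctor.map g ≫ eqToHom (hF.obj_eq m)

lemma val_id (n : ℕ) : hF.val (𝟙 (⟨n⟩ : Rep0 t)) = 𝟙 _ := by simp [val]

lemma val_comp {n m k : ℕ} (g : (⟨n⟩ : Rep0 t) ⟶ ⟨m⟩) (g' : (⟨m⟩ : Rep0 t) ⟶ ⟨k⟩) :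
    hF.val (g ≫ g') = hF.val g ≫ hF.val g' := by simp [val]

/-- Strictness identifies the tensor constraint of `F` with `tpowAdd`, so its naturality controls
the values on diagrams with strands beside them. -/
lemma val_tens {n m p q : ℕ} (g : (⟨n⟩ : Rep0 t) ⟶ ⟨m⟩) (g' : (⟨p⟩ : Rep0 t) ⟶ ⟨q⟩) :
    (hF.val g ⊗ₘ hF.val g') ≫ (tpowAdd A m q).hom =
      (tpowAdd A n p).hom ≫ hF.val (n := n + p) (m := m + q) (tens g g') := by
  have h1 := hF.tensor_eq m q
  have h2 := hF.tensor_eq n p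
  have h3 := μ_natural F.toFunctor g g'
  have h4 : (eqToHom (hF.obj_eq n).symm ⊗ₘ eqToHom (hF.obj_eq p).symm) ≫
      (eqToHom (hF.obj_eq n) ⊗ₘ eqToHom (hF.obj_eq p)) = 𝟙 _ := by
    rw [tensorHom_comp_tensorHom]; simp
  rw [val, val, val, ← tensorHom_comp_tensorHom, ← tensorHom_comp_tensorHom, Category.assoc,
    Category.assoc, ← h1]
  have h5 : (tpowAdd A n p).hom = (eqToHom (hF.obj_eq n).symm ⊗ₘ eqToHom (hF.obj_eq p).symm) ≫
      μ F.toFunctor (⟨n⟩ : Rep0 t) ⟨p⟩ ≫ eqToHom (hF.obj_eq (n + p)) := by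
    rw [h2, reassoc_of% h4]
  rw [h5, reassoc_of% h3]
  simp only [Category.assoc, eqToHom_trans_assoc, eqToHom_refl, Category.id_comp]
  rfl

lemma val_addStrand {n m : ℕ} (g : (⟨n⟩ : Rep0 t) ⟶ ⟨m⟩) :
    (tpowSucc A n).hom ≫ hF.val (addStrand g) = hF.val g ▷ A ≫ (tpowSucc A m).hom := by
  have := hF.val_tens g (𝟙 (⟨1⟩ : Rep0 t))
  rw [val_id] at this
  refine (this.symm.trans ?_)
  exact congrArg (· ≫ (tpowSucc A m).hom) (tensorHom_id (hF.val g) A)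

lemma val_strandsLeft {n p q : ℕ} (g : (⟨p⟩ : Rep0 t) ⟶ ⟨q⟩) :
    hF.val (strandsLeft n g) = tpowLast A n (hF.val g) := by
  have := hF.val_tens (𝟙 (⟨n⟩ : Rep0 t)) g
  rw [val_id, id_tensorHom] at this
  rw [tpowLast, Iso.eq_inv_comp]
  exact this.symm

/-- Both sides agree on the generators and respect added strands, composition and linear
combinations. -/
lemma val_eq (hF : IsStrictRealization A α β δ F) {n m : ℕ} (g : (⟨n⟩ : Rep0 t) ⟶ ⟨m⟩) : hF.val g = pmap h g := by
  refine ((tpowSeq A).neutralTower h).hom_induction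
    (M := fun {n m} g => hF.val g = pmap h g) (fun n => ?_) (fun n => ?_) (fun n => ?_)
    (fun n => ?_) (fun n => ?_) (fun {n m} g ih => ?_) (fun {n m l} g g' ih ih' => ?_) (fun n m => ?_)
    (fun {n m} g g' ih ih' => ?_) (fun {n m} r g ih => ?_) g
  · rw [val_id, pmap_id]
  · rw [pmap_crossLast, crossLast_eq]
    exact (hF.val_strandsLeft _).trans (congrArg _ hF.map_cross)
  · rw [pmap_fourLast, fourLast_eq]
    exact (hF.val_strandsLeft _).trans (congrArg _ hF.map_fourLegs)
  · rw [pmap_capLast, capLast_eq]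
    exact (hF.val_strandsLeft _).trans (congrArg _ hF.map_cap)
  · rw [pmap_cupLast, cupLast_eq]
    exact (hF.val_strandsLeft _).trans (congrArg _ hF.map_cup)
  · rw [← cancel_epi (tpowSucc A n).hom, val_addStrand, pmap_addStrand, ih]
  · rw [val_comp, pmap_comp, ih, ih']
  · rw [pmap_zero, val, F.toFunctor.map_zero, zero_comp, comp_zero]
  · rw [pmap_add, ← ih, ← ih', val, F.toFunctor.map_add, Preadditive.add_comp,
      Preadditive.comp_add]
    rfl
  · rw [pmap_smul, ← ih, val, F.toFunctor.map_smul, Linear.smul_comp, Linear.comp_smul]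
    rfl

lemma eq_powLinSym (hF : IsStrictRealization A α β δ F) : F = powLinSym h := by
  have e : F.toFunctor = powFunctor h := by
    refine CategoryTheory.Functor.ext (fun X => hF.obj_eq X.n) fun X Y g => ?_
    have e := hF.val_eq h (n := X.n) (m := Y.n) g
    rw [val, eqToHom_comp_iff, comp_eqToHom_iff] at e
    exact e.trans (Category.assoc _ _ _)
  refine LinSymFunctor.ext' e ?_ fun X Y => ?_
  · exact hF.unit_eq
  · exact hF.tensor_eq X.n Y.n

end IsStrictRealization
end Realization


/-! ### Objects that are summands of finite sums -/

section Resolution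
variable {D : Type*} [Category D] [Preadditive D] {K : Type*} [Category K] [Preadditive K]

/-- An object of `K` is presented as a summand of a finite sum of values of `I`. -/
structure FiniteResolution (I : D ⥤ K) (P : K) where
  /-- The index set. -/
  ix : Type
  /-- It is finite. -/
  fin : Fintype ix
  /-- The summands. -/
  ob : ix → D
  /-- The coordinates. -/
  r : ∀ i, P ⟶ I.obj (ob i)
  /-- The insertions. -/
  s : ∀ i, I.obj (ob i) ⟶ P
  sum_r_s : ∑ i, r i ≫ s i = 𝟙 P

attribute [instance] FiniteResolution.fin

variable {I : D ⥤ K} {C : Type*} [Category C] [Preadditive C]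

namespace FiniteResolution

/-- The identity of `P` is a finite sum of morphisms through values of `I`, so testing on morphisms
from such values suffices. -/
lemma map_hom_ext {P : K} (R : FiniteResolution I P) (G : K ⥤ C) [G.Additive] {Y : C}
    {f g : G.obj P ⟶ Y}
    (h : ∀ (X : D) (s : I.obj X ⟶ P), G.map s ≫ f = G.map s ≫ g) : f = g := by
  rw [← Category.id_comp f, ← Category.id_comp g, ← G.map_id, ← R.sum_r_s, G.map_sum,
    Preadditive.sum_comp, Preadditive.sum_comp]
  refine Finset.sum_congr rfl fun i _ => ?_
  rw [G.map_comp, Category.assoc, Category.assoc, h]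

variable [MonoidalCategory C] [MonoidalPreadditive C]

lemma sum_tensor_map {P Q : K} (R : FiniteResolution I P) (S : FiniteResolution I Q) (G : K ⥤ C)
    [G.Additive] : ∑ i, ∑ j, (G.map (R.r i) ⊗ₘ G.map (S.r j)) ≫ (G.map (R.s i) ⊗ₘ G.map (S.s j)) =
      𝟙 (G.obj P ⊗ G.obj Q) := by
  simp only [tensorHom_comp_tensorHom, ← tensor_sum, ← sum_tensor, ← G.map_comp, ← G.map_sum,
    sum_r_s, G.map_id, id_tensorHom_id]

lemma tensor_map_hom_ext {P Q : K} (R : FiniteResolution I P) (S : FiniteResolution I Q)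
    (G : K ⥤ C) [G.Additive] {Y : C} {f g : G.obj P ⊗ G.obj Q ⟶ Y}
    (h : ∀ (X : D) (s : I.obj X ⟶ P) (X' : D) (s' : I.obj X' ⟶ Q),
      (G.map s ⊗ₘ G.map s') ≫ f = (G.map s ⊗ₘ G.map s') ≫ g) : f = g := by
  rw [← Category.id_comp f, ← Category.id_comp g, ← R.sum_tensor_map S G]
  simp only [Preadditive.sum_comp, Category.assoc, h]

lemma tensor_map_hom_ext' {P Q : K} (R : FiniteResolution I P) (S : FiniteResolution I Q)
    (G : K ⥤ C) [G.Additive] {Y : C} {f g : Y ⟶ G.obj P ⊗ G.obj Q}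
    (h : ∀ (X : D) (r : P ⟶ I.obj X) (X' : D) (r' : Q ⟶ I.obj X'),
      f ≫ (G.map r ⊗ₘ G.map r') = g ≫ (G.map r ⊗ₘ G.map r')) : f = g := by
  rw [← Category.comp_id f, ← Category.comp_id g, ← R.sum_tensor_map S G]
  simp only [Preadditive.comp_sum, reassoc_of% h]

lemma tensor_whisker_map_hom_ext {P Q V : K} (R : FiniteResolution I P) (S : FiniteResolution I Q)
    (T : FiniteResolution I V) (G : K ⥤ C) [G.Additive] {Y : C}
    {f g : (G.obj P ⊗ G.obj Q) ⊗ G.obj V ⟶ Y}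
    (h : ∀ (X : D) (s : I.obj X ⟶ P) (X' : D) (s' : I.obj X' ⟶ Q) (X'' : D) (s'' : I.obj X'' ⟶ V),
      ((G.map s ⊗ₘ G.map s') ⊗ₘ G.map s'') ≫ f = ((G.map s ⊗ₘ G.map s') ⊗ₘ G.map s'') ≫ g) :
    f = g := by
  have e : ∑ k, ∑ i, ∑ j, ((G.map (R.r i) ⊗ₘ G.map (S.r j)) ⊗ₘ G.map (T.r k)) ≫
      ((G.map (R.s i) ⊗ₘ G.map (S.s j)) ⊗ₘ G.map (T.s k)) =
      𝟙 ((G.obj P ⊗ G.obj Q) ⊗ G.obj V) := by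
    simp only [tensorHom_comp_tensorHom _ (G.map (T.r _)), ← sum_tensor, R.sum_tensor_map S G]
    simp only [← tensor_sum, ← G.map_comp, ← G.map_sum, sum_r_s, G.map_id, id_tensorHom_id]
  rw [← Category.id_comp f, ← Category.id_comp g, ← e]
  simp only [Preadditive.sum_comp, Category.assoc, h]

end FiniteResolution
end Resolution

/-! ### Extension of natural transformations -/

section ExtendIso
open Functor.LaxMonoidal Functor.OplaxMonoidal
variable {D : Type*} [Category D] [Preadditive D]
  {K : Type*} [Category K] [Preadditive K]
  {C : Type*} [Category C] [Preadditive C]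
  {I : D ⥤ K} [I.Full] (R : ∀ P, FiniteResolution I P)
  {G₁ G₂ : K ⥤ C} [G₁.Additive] [G₂.Additive]

/-- The extension of a natural transformation along a dense functor, at one object. -/
def extendApp (θ : I ⋙ G₁ ⟶ I ⋙ G₂) (P : K) : G₁.obj P ⟶ G₂.obj P :=
  ∑ i, G₁.map ((R P).r i) ≫ θ.app ((R P).ob i) ≫ G₂.map ((R P).s i)

/-- As `I` is full, `s` followed by a coordinate comes from `D`, where `θ` is natural; the sum then
collapses. By `map_hom_ext` this property characterizes the extension, and it frees later arguments
from the resolution. -/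
lemma map_extendApp (θ : I ⋙ G₁ ⟶ I ⋙ G₂) {P : K} {X : D} (s : I.obj X ⟶ P) :
    G₁.map s ≫ extendApp R θ P = θ.app X ≫ G₂.map s := by
  have key : ∀ i, G₁.map s ≫ G₁.map ((R P).r i) ≫ θ.app ((R P).ob i) ≫ G₂.map ((R P).s i) =
      θ.app X ≫ G₂.map (s ≫ (R P).r i ≫ (R P).s i) := fun i => by
    obtain ⟨g, hg⟩ := I.map_surjective (s ≫ (R P).r i)
    have := θ.naturality g
    simp only [Functor.comp_map, hg] at this
    rw [← G₁.map_comp_assoc, reassoc_of% this, ← G₂.map_comp, Category.assoc]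
  rw [extendApp, Preadditive.comp_sum, Finset.sum_congr rfl fun i _ => key i,
    ← Preadditive.comp_sum, ← G₂.map_sum, ← Preadditive.comp_sum, (R P).sum_r_s, Category.comp_id]

/-- The extension of a natural transformation along a dense functor. -/
def extendNatTrans (θ : I ⋙ G₁ ⟶ I ⋙ G₂) : G₁ ⟶ G₂ where
  app := extendApp R θ
  naturality P Q f := (R P).map_hom_ext G₁ fun X s => by
    rw [← G₁.map_comp_assoc, map_extendApp, ← Category.assoc, map_extendApp, Category.assoc,
      G₂.map_comp]

/-- The extension of a natural isomorphism along a dense functor. -/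
def extendNatIso (θ : I ⋙ G₁ ≅ I ⋙ G₂) : G₁ ≅ G₂ where
  hom := extendNatTrans R θ.hom
  inv := extendNatTrans R θ.inv
  hom_inv_id := NatTrans.ext (funext fun P => (R P).map_hom_ext G₁ fun X s => by
    have e1 := map_extendApp R θ.hom s
    have e2 := map_extendApp R θ.inv s
    have e3 := θ.hom_inv_id_app X
    change G₁.map s ≫ extendApp R θ.hom P ≫ extendApp R θ.inv P = G₁.map s ≫ 𝟙 _
    rw [reassoc_of% e1, e2, reassoc_of% e3, Category.comp_id])
  inv_hom_id := NatTrans.ext (funext fun P => (R P).map_hom_ext G₂ fun X s => by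
    have e1 := map_extendApp R θ.hom s
    have e2 := map_extendApp R θ.inv s
    have e3 := θ.inv_hom_id_app X
    change G₂.map s ≫ extendApp R θ.inv P ≫ extendApp R θ.hom P = G₂.map s ≫ 𝟙 _
    rw [reassoc_of% e2, e1, reassoc_of% e3, Category.comp_id])

variable [MonoidalCategory D] [MonoidalCategory K] [MonoidalCategory C] [MonoidalPreadditive C]
  [I.Monoidal] [G₁.Monoidal] [G₂.Monoidal]

/-- Tested on tensor products of morphisms from values of `I`, the condition becomes monoidality of
`θ`. -/
lemma extendNatTrans_isMonoidal (θ : I ⋙ G₁ ⟶ I ⋙ G₂) [NatTrans.IsMonoidal θ] :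
    NatTrans.IsMonoidal (extendNatTrans R θ) where
  unit := by
    have e := NatTrans.IsMonoidal.unit (τ := θ)
    have e2 := map_extendApp R θ (η I)
    rw [Functor.LaxMonoidal.comp_ε, Functor.LaxMonoidal.comp_ε] at e
    have e3 := congrArg (· ≫ G₂.map (η I)) e
    simp only [Category.assoc] at e3
    rw [← e2, ← G₁.map_comp_assoc, ← G₂.map_comp, Functor.Monoidal.ε_η, G₁.map_id, G₂.map_id,
      Category.id_comp, Category.comp_id] at e3
    exact e3
  tensor P Q := (R P).tensor_map_hom_ext (R Q) G₁ fun X s X' s' => by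
    have e := NatTrans.IsMonoidal.tensor (τ := θ) X X'
    rw [Functor.LaxMonoidal.comp_μ, Functor.LaxMonoidal.comp_μ] at e
    have e2 := map_extendApp R θ (δ I X X' ≫ (s ⊗ₘ s'))
    have e3 := congrArg (· ≫ G₂.map (δ I X X' ≫ (s ⊗ₘ s'))) e
    simp only [Category.assoc] at e3
    rw [← e2, ← G₁.map_comp_assoc, ← G₂.map_comp, Functor.Monoidal.μ_δ_assoc] at e3
    change _ ≫ _ ≫ extendApp R θ (P ⊗ Q) = _ ≫ (extendApp R θ P ⊗ₘ extendApp R θ Q) ≫ _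
    rw [μ_natural_assoc, tensorHom_comp_tensorHom_assoc, map_extendApp, map_extendApp, e3,
      ← tensorHom_comp_tensorHom_assoc, μ_natural]

end ExtendIso


/-! ### Extension of functors by splitting idempotents -/

section ExtendFunctor
variable {D : Type*} [Category D] [Preadditive D] {K : Type*} [Category K] [Preadditive K]
  {C : Type*} [Category C] [Preadditive C]
  (I : D ⥤ K) [I.Full] [I.Faithful] [I.Additive] (F : D ⥤ C) [F.Additive]

/-- The value of `F` at the preimage of a morphism between values of `I`. -/
def fullMap {X Y : D} (g : I.obj X ⟶ I.obj Y) : F.obj X ⟶ F.obj Y := F.map (I.preimage g)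

lemma fullMap_map {X Y : D} (g : X ⟶ Y) : fullMap I F (I.map g) = F.map g := by
  rw [fullMap, I.preimage_map]

lemma fullMap_id (X : D) : fullMap I F (𝟙 (I.obj X)) = 𝟙 _ := by
  rw [← I.map_id, fullMap_map, F.map_id]

lemma fullMap_comp {X Y Z : D} (g : I.obj X ⟶ I.obj Y) (g' : I.obj Y ⟶ I.obj Z) :
    fullMap I F (g ≫ g') = fullMap I F g ≫ fullMap I F g' := by
  obtain ⟨g, rfl⟩ := I.map_surjective g
  obtain ⟨g', rfl⟩ := I.map_surjective g'
  rw [← I.map_comp, fullMap_map, fullMap_map, fullMap_map, F.map_comp]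

lemma fullMap_add {X Y : D} (g g' : I.obj X ⟶ I.obj Y) :
    fullMap I F (g + g') = fullMap I F g + fullMap I F g' := by
  obtain ⟨g, rfl⟩ := I.map_surjective g
  obtain ⟨g', rfl⟩ := I.map_surjective g'
  rw [← I.map_add, fullMap_map, fullMap_map, fullMap_map, F.map_add]

lemma fullMap_smul [Linear ℂ D] [Linear ℂ K] [Linear ℂ C] [I.Linear ℂ] [F.Linear ℂ] {X Y : D}
    (c : ℂ) (g : I.obj X ⟶ I.obj Y) : fullMap I F (c • g) = c • fullMap I F g := by
  obtain ⟨g, rfl⟩ := I.map_surjective g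
  rw [← I.map_smul, fullMap_map, fullMap_map, F.map_smul]

lemma fullMap_sum {ι : Type*} (a : Finset ι) {X Y : D} (g : ι → (I.obj X ⟶ I.obj Y)) :
    fullMap I F (∑ i ∈ a, g i) = ∑ i ∈ a, fullMap I F (g i) :=
  map_sum (AddMonoidHom.mk' (fullMap I F (X := X) (Y := Y)) (fullMap_add I F)) g a

variable {I} (R : ∀ P, FiniteResolution I P)

/-- An image in `C` of the summand of a finite sum that is `P`. -/
structure Splitting (P : K) where
  /-- The image. -/
  o : C
  /-- The coordinates. -/
  b : ∀ i, o ⟶ F.obj ((R P).ob i)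
  /-- The insertions. -/
  a : ∀ i, F.obj ((R P).ob i) ⟶ o
  sum_b_a : ∑ i, b i ≫ a i = 𝟙 o
  -- This is the matrix of the idempotent that cuts `P` out of the sum, carried over to `C`.
  a_b : ∀ i j, a i ≫ b j = fullMap I F ((R P).s i ≫ (R P).r j)

/-- The evident splitting of a value of `I`. -/
def Splitting.std (X : D) : Splitting F R (I.obj X) where
  o := F.obj X
  b i := fullMap I F ((R _).r i)
  a i := fullMap I F ((R _).s i)
  sum_b_a := by
    simp only [← fullMap_comp]
    rw [← fullMap_sum, (R _).sum_r_s, fullMap_id]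
  a_b i j := (fullMap_comp I F _ _).symm

/-- The matrix with entries `s i ≫ r j` is idempotent because `∑ r i ≫ s i` is the identity. Its
image under `F` is an idempotent of a biproduct in `C`, which splits. -/
lemma exists_splitting [HasFiniteBiproducts C] [IsIdempotentComplete C] (P : K) :
    Nonempty (Splitting F R P) := by
  classical
  let B : C := ⨁ fun i => F.obj ((R P).ob i)
  let p : B ⟶ B := biproduct.matrix fun i j => fullMap I F ((R P).s i ≫ (R P).r j)
  have hp : p ≫ p = p := by
    refine biproduct.hom_ext' _ _ fun i => biproduct.hom_ext _ _ fun k => ?_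
    have e : biproduct.ι (fun i => F.obj ((R P).ob i)) i ≫ p =
        ∑ j, fullMap I F ((R P).s i ≫ (R P).r j) ≫ biproduct.ι (fun i => F.obj ((R P).ob i)) j := by
      refine biproduct.hom_ext _ _ fun j => ?_
      simp [p, Preadditive.sum_comp, biproduct.ι_π, comp_dite]
    have e' : p ≫ biproduct.π (fun i => F.obj ((R P).ob i)) k =
        biproduct.desc fun j => fullMap I F ((R P).s j ≫ (R P).r k) := biproduct.matrix_π _ _
    rw [Category.assoc, Category.assoc, Category.assoc, e', reassoc_of% e, Preadditive.sum_comp]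
    simp only [Category.assoc, biproduct.ι_desc, ← fullMap_comp]
    rw [← fullMap_sum]
    have := (R P).sum_r_s
    calc fullMap I F (∑ x, (R P).s i ≫ (R P).r x ≫ (R P).s x ≫ (R P).r k)
        = fullMap I F ((R P).s i ≫ (∑ x, (R P).r x ≫ (R P).s x) ≫ (R P).r k) := by
          simp only [Preadditive.sum_comp, Preadditive.comp_sum, Category.assoc]
      _ = _ := by rw [this, Category.id_comp]
  obtain ⟨o, ι, π, h1, h2⟩ := IsIdempotentComplete.idempotents_split B p hp
  refine ⟨⟨o, fun i => ι ≫ biproduct.π _ i, fun i => biproduct.ι (fun i => F.obj ((R P).ob i)) i ≫ π,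
    ?_, fun i j => ?_⟩⟩
  · have := biproduct.total (f := fun i => F.obj ((R P).ob i))
    calc ∑ i, (ι ≫ biproduct.π (fun i => F.obj ((R P).ob i)) i) ≫ biproduct.ι (fun i => F.obj ((R P).ob i)) i ≫ π
        = ι ≫ (∑ i, biproduct.π (fun i => F.obj ((R P).ob i)) i ≫
            biproduct.ι (fun i => F.obj ((R P).ob i)) i) ≫ π := by
          simp only [Preadditive.sum_comp, Preadditive.comp_sum, Category.assoc]
      _ = _ := by rw [this, Category.id_comp, h1]
  · rw [Category.assoc, reassoc_of% h2]
    simp [p]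

namespace Splitting
variable {F R}

/-- The action of the extended functor on morphisms. -/
def mapOf {P Q : K} (S : Splitting F R P) (T : Splitting F R Q) (f : P ⟶ Q) : S.o ⟶ T.o :=
  ∑ i, ∑ j, S.b i ≫ fullMap I F ((R P).s i ≫ f ≫ (R Q).r j) ≫ T.a j

/-- By `a_b` the sum over the coordinates of `P` collapses. With `hom_ext`, this formula gives
functoriality and linearity. -/
lemma a_mapOf {P Q : K} (S : Splitting F R P) (T : Splitting F R Q) (f : P ⟶ Q) (i) :
    S.a i ≫ mapOf S T f = ∑ j, fullMap I F ((R P).s i ≫ f ≫ (R Q).r j) ≫ T.a j := by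
  simp only [mapOf, Preadditive.comp_sum]
  rw [Finset.sum_comm]
  refine Finset.sum_congr rfl fun j _ => ?_
  simp only [← Category.assoc, S.a_b]
  rw [← Preadditive.sum_comp]
  simp only [← fullMap_comp]
  rw [← fullMap_sum]
  simp only [Category.assoc]
  rw [← Preadditive.comp_sum]
  simp only [← Category.assoc]
  rw [← Preadditive.sum_comp, ← Preadditive.sum_comp, (R P).sum_r_s, Category.id_comp,
    Category.assoc]

lemma hom_ext {P : K} (S : Splitting F R P) {Y : C} {f g : S.o ⟶ Y}
    (h : ∀ i, S.a i ≫ f = S.a i ≫ g) : f = g := by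
  rw [← Category.id_comp f, ← Category.id_comp g, ← S.sum_b_a]
  simp only [Preadditive.sum_comp, Category.assoc, h]

lemma mapOf_id {P : K} (S : Splitting F R P) : mapOf S S (𝟙 P) = 𝟙 _ := S.hom_ext fun i => by
  rw [a_mapOf]
  simp only [Category.id_comp, ← S.a_b, Category.assoc]
  rw [← Preadditive.comp_sum, S.sum_b_a]

lemma mapOf_comp {P Q V : K} (S : Splitting F R P) (T : Splitting F R Q) (U : Splitting F R V)
    (f : P ⟶ Q) (g : Q ⟶ V) : mapOf S U (f ≫ g) = mapOf S T f ≫ mapOf T U g :=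
  S.hom_ext fun i => by
    rw [a_mapOf, ← Category.assoc, a_mapOf, Preadditive.sum_comp]
    simp only [Category.assoc, a_mapOf, Preadditive.comp_sum]
    rw [Finset.sum_comm]
    refine Finset.sum_congr rfl fun k _ => ?_
    simp only [← Category.assoc]
    rw [← Preadditive.sum_comp]
    simp only [← fullMap_comp]
    rw [← fullMap_sum]
    simp only [Category.assoc]
    rw [← Preadditive.comp_sum, ← Preadditive.comp_sum]
    simp only [← Category.assoc ((R Q).r _)]
    rw [← Preadditive.sum_comp, (R Q).sum_r_s, Category.id_comp]

lemma mapOf_add {P Q : K} (S : Splitting F R P) (T : Splitting F R Q) (f g : P ⟶ Q) :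
    mapOf S T (f + g) = mapOf S T f + mapOf S T g := S.hom_ext fun i => by
  rw [Preadditive.comp_add, a_mapOf, a_mapOf, a_mapOf, ← Finset.sum_add_distrib]
  refine Finset.sum_congr rfl fun j _ => ?_
  rw [Preadditive.add_comp, Preadditive.comp_add, fullMap_add, Preadditive.add_comp]

lemma mapOf_smul [Linear ℂ D] [Linear ℂ K] [Linear ℂ C] [I.Linear ℂ] [F.Linear ℂ] {P Q : K}
    (S : Splitting F R P) (T : Splitting F R Q) (c : ℂ) (f : P ⟶ Q) :
    mapOf S T (c • f) = c • mapOf S T f := S.hom_ext fun i => by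
  rw [Linear.comp_smul, a_mapOf, a_mapOf, Finset.smul_sum]
  refine Finset.sum_congr rfl fun j _ => ?_
  rw [Linear.smul_comp, Linear.comp_smul, fullMap_smul, Linear.smul_comp]

lemma mapOf_std {X Y : D} (g : X ⟶ Y) : mapOf (std F R X) (std F R Y) (I.map g) = F.map g := by
  refine (std F R X).hom_ext fun i => ?_
  rw [a_mapOf]
  change ∑ j, fullMap I F _ ≫ fullMap I F _ = fullMap I F _ ≫ F.map g
  simp only [← fullMap_comp, Category.assoc]
  rw [← fullMap_sum, ← Preadditive.comp_sum, ← Preadditive.comp_sum, (R _).sum_r_s,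
    Category.comp_id, fullMap_comp, fullMap_map]

variable (S : ∀ P, Splitting F R P)

/-- The extension of a functor along a dense functor, from chosen splittings. -/
def extend : K ⥤ C where
  obj P := (S P).o
  map f := mapOf (S _) (S _) f
  map_id P := mapOf_id (S P)
  map_comp f g := mapOf_comp _ _ _ f g

instance : (extend S).Additive where
  map_add := mapOf_add _ _ _ _

instance [Linear ℂ D] [Linear ℂ K] [Linear ℂ C] [I.Linear ℂ] [F.Linear ℂ] :
    (extend S).Linear ℂ where
  map_smul f c := mapOf_smul _ _ c f

lemma comp_extend (h : ∀ X, S (I.obj X) = std F R X) : I ⋙ extend S = F := by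
  refine CategoryTheory.Functor.ext (fun X => congrArg Splitting.o (h X)) fun X Y g => ?_
  have : ∀ (S : Splitting F R (I.obj X)) (T : Splitting F R (I.obj Y)) (hS : S = std F R X)
      (hT : T = std F R Y), mapOf S T (I.map g) =
        eqToHom (congrArg Splitting.o hS) ≫ F.map g ≫ eqToHom (congrArg Splitting.o hT.symm) := by
    rintro S T rfl rfl
    rw [mapOf_std]
    exact ((Category.id_comp _).trans (Category.comp_id _)).symm
  exact this _ _ (h X) (h Y)

end Splitting

/-- Injectivity on objects allows the standard splitting to be chosen at every value of `I`. The
extension then restricts to `F` on the nose, not just up to isomorphism. -/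
lemma exists_extend [HasFiniteBiproducts C] [IsIdempotentComplete C]
    (hI : Function.Injective I.obj) :
    ∃ S : ∀ P, Splitting F R P, ∀ X, S (I.obj X) = Splitting.std F R X := by
  classical
  refine ⟨fun P => if h : ∃ X, I.obj X = P then h.choose_spec ▸ Splitting.std F R h.choose else
    (exists_splitting F R P).some, fun X => ?_⟩
  have h : ∃ Y, I.obj Y = I.obj X := ⟨X, rfl⟩
  have key : ∀ (Y : D) (e : I.obj Y = I.obj X), Y = X →
      (e ▸ Splitting.std F R Y : Splitting F R (I.obj X)) = Splitting.std F R X := by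
    rintro Y e rfl
    rfl
  exact (dif_pos h).trans (key _ h.choose_spec (hI h.choose_spec))

end ExtendFunctor


/-! ### Monoidal structure of an extension -/

section ExtendMonoidal
open Functor.LaxMonoidal Functor.OplaxMonoidal
variable {D : Type*} [Category D] [Preadditive D] [MonoidalCategory D]
  {K : Type*} [Category K] [Preadditive K] [MonoidalCategory K] [MonoidalPreadditive K]
  {C : Type*} [Category C] [Preadditive C] [MonoidalCategory C] [MonoidalPreadditive C]
  (I : D ⥤ K) (G : K ⥤ C) [(I ⋙ G).Monoidal]

/-- The unit constraint of `I ⋙ G`. -/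
def compUnit : 𝟙_ C ⟶ G.obj (I.obj (𝟙_ D)) := ε (I ⋙ G)

/-- The tensor constraint of `I ⋙ G`. -/
def compTensor (X Y : D) : G.obj (I.obj X) ⊗ G.obj (I.obj Y) ⟶ G.obj (I.obj (X ⊗ Y)) :=
  μ (I ⋙ G) X Y

/-- The inverse of the tensor constraint of `I ⋙ G`. -/
def compTensorInv (X Y : D) : G.obj (I.obj (X ⊗ Y)) ⟶ G.obj (I.obj X) ⊗ G.obj (I.obj Y) :=
  δ (I ⋙ G) X Y

lemma compTensor_inv (X Y : D) : compTensor I G X Y ≫ compTensorInv I G X Y = 𝟙 _ :=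
  Functor.Monoidal.μ_δ (I ⋙ G) X Y

lemma compTensorInv_comp (X Y : D) : compTensorInv I G X Y ≫ compTensor I G X Y = 𝟙 _ :=
  Functor.Monoidal.δ_μ (I ⋙ G) X Y

lemma compTensor_natural {X Y X' Y' : D} (g : X ⟶ X') (g' : Y ⟶ Y') :
    (G.map (I.map g) ⊗ₘ G.map (I.map g')) ≫ compTensor I G X' Y' =
      compTensor I G X Y ≫ G.map (I.map (g ⊗ₘ g')) :=
  μ_natural (I ⋙ G) g g'

lemma compTensor_assoc (X Y Z : D) :
    (compTensor I G X Y ▷ G.obj (I.obj Z)) ≫ compTensor I G (X ⊗ Y) Z ≫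
        G.map (I.map (α_ X Y Z).hom) =
      (α_ (G.obj (I.obj X)) (G.obj (I.obj Y)) (G.obj (I.obj Z))).hom ≫
        (G.obj (I.obj X) ◁ compTensor I G Y Z) ≫ compTensor I G X (Y ⊗ Z) :=
  associativity (I ⋙ G) X Y Z

lemma compTensor_left (X : D) : (λ_ (G.obj (I.obj X))).hom =
    compUnit I G ▷ G.obj (I.obj X) ≫ compTensor I G (𝟙_ D) X ≫ G.map (I.map (λ_ X).hom) :=
  left_unitality (I ⋙ G) X

lemma compTensor_right (X : D) : (ρ_ (G.obj (I.obj X))).hom =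
    G.obj (I.obj X) ◁ compUnit I G ≫ compTensor I G X (𝟙_ D) ≫ G.map (I.map (ρ_ X).hom) :=
  right_unitality (I ⋙ G) X

variable {I} [I.Monoidal] [I.Full] [G.Additive] (R : ∀ P, FiniteResolution I P)

/-- The tensor constraint of the extension. -/
def extendTensor (P Q : K) : G.obj P ⊗ G.obj Q ⟶ G.obj (P ⊗ Q) :=
  ∑ i, ∑ j, (G.map ((R P).r i) ⊗ₘ G.map ((R Q).r j)) ≫ compTensor I G _ _ ≫
    G.map (δ I _ _ ≫ ((R P).s i ⊗ₘ (R Q).s j))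

/-- The analogue of `map_extendApp` in two variables; fullness of `I` and naturality of the
constraint of `I ⋙ G` make the double sum collapse. -/
lemma map_extendTensor {P Q : K} {X Y : D} (s : I.obj X ⟶ P) (s' : I.obj Y ⟶ Q) :
    (G.map s ⊗ₘ G.map s') ≫ extendTensor G R P Q =
      compTensor I G X Y ≫ G.map (δ I X Y ≫ (s ⊗ₘ s')) := by
  have key : ∀ i j, (G.map s ⊗ₘ G.map s') ≫ (G.map ((R P).r i) ⊗ₘ G.map ((R Q).r j)) ≫
      compTensor I G _ _ ≫ G.map (δ I _ _ ≫ ((R P).s i ⊗ₘ (R Q).s j)) =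
      compTensor I G X Y ≫ G.map (δ I X Y ≫
        ((s ≫ (R P).r i ≫ (R P).s i) ⊗ₘ (s' ≫ (R Q).r j ≫ (R Q).s j))) := fun i j => by
    obtain ⟨g, hg⟩ := I.map_surjective (s ≫ (R P).r i)
    obtain ⟨g', hg'⟩ := I.map_surjective (s' ≫ (R Q).r j)
    have e := compTensor_natural I G g g'
    have e' := δ_natural I g g'
    rw [tensorHom_comp_tensorHom_assoc, ← G.map_comp, ← G.map_comp, ← hg, ← hg', reassoc_of% e,
      ← G.map_comp, ← reassoc_of% e', tensorHom_comp_tensorHom, hg, hg', Category.assoc,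
      Category.assoc]
  simp only [extendTensor, Preadditive.comp_sum, key]
  simp only [← Preadditive.comp_sum, ← G.map_sum, ← tensor_sum, ← sum_tensor,
    FiniteResolution.sum_r_s, Category.comp_id]

/-- The inverse of the tensor constraint of the extension. -/
def extendTensorInv (P Q : K) : G.obj (P ⊗ Q) ⟶ G.obj P ⊗ G.obj Q :=
  ∑ i, ∑ j, G.map (((R P).r i ⊗ₘ (R Q).r j) ≫ μ I _ _) ≫ compTensorInv I G _ _ ≫
    (G.map ((R P).s i) ⊗ₘ G.map ((R Q).s j))

lemma extendTensorInv_map {P Q : K} {X Y : D} (r : P ⟶ I.obj X) (r' : Q ⟶ I.obj Y) :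
    extendTensorInv G R P Q ≫ (G.map r ⊗ₘ G.map r') =
      G.map ((r ⊗ₘ r') ≫ μ I X Y) ≫ compTensorInv I G X Y := by
  have key : ∀ i j, (G.map (((R P).r i ⊗ₘ (R Q).r j) ≫ μ I _ _) ≫ compTensorInv I G _ _ ≫
    (G.map ((R P).s i) ⊗ₘ G.map ((R Q).s j))) ≫ (G.map r ⊗ₘ G.map r') =
      G.map ((((R P).r i ≫ (R P).s i ≫ r) ⊗ₘ ((R Q).r j ≫ (R Q).s j ≫ r')) ≫ μ I X Y) ≫
        compTensorInv I G X Y := fun i j => by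
    obtain ⟨g, hg⟩ := I.map_surjective ((R P).s i ≫ r)
    obtain ⟨g', hg'⟩ := I.map_surjective ((R Q).s j ≫ r')
    have e := compTensor_natural I G g g'
    have e' := μ_natural I g g'
    have e2 : compTensorInv I G _ _ ≫ (G.map (I.map g) ⊗ₘ G.map (I.map g')) =
        G.map (I.map (g ⊗ₘ g')) ≫ compTensorInv I G _ _ := by
      rw [← Category.comp_id (compTensorInv I G _ _ ≫ _), ← compTensor_inv, Category.assoc,
        reassoc_of% e, ← Category.assoc (compTensorInv I G _ _), compTensorInv_comp,
        Category.id_comp]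
    rw [Category.assoc, Category.assoc, tensorHom_comp_tensorHom, ← G.map_comp, ← G.map_comp, ← hg,
      ← hg', e2, ← G.map_comp_assoc, Category.assoc, ← e', tensorHom_comp_tensorHom_assoc]
  simp only [extendTensorInv, Preadditive.sum_comp, key]
  simp only [← Category.assoc ((R P).r _), ← Category.assoc ((R Q).r _), ← Preadditive.sum_comp,
    ← G.map_sum, ← tensor_sum, ← sum_tensor, FiniteResolution.sum_r_s, Category.id_comp]

/-- The tensor constraint of the extension, as an isomorphism. -/
def extendTensorIso (P Q : K) : G.obj P ⊗ G.obj Q ≅ G.obj (P ⊗ Q) where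
  hom := extendTensor G R P Q
  inv := extendTensorInv G R P Q
  -- Tested on insertions from the left and on coordinates from the right, the composite reduces to
  -- the mutually inverse constraints of `I ⋙ G`.
  hom_inv_id := (R P).tensor_map_hom_ext (R Q) G fun X s X' s' =>
    (R P).tensor_map_hom_ext' (R Q) G fun Y r Y' r' => by
      obtain ⟨g, hg⟩ := I.map_surjective (s ≫ r)
      obtain ⟨g', hg'⟩ := I.map_surjective (s' ≫ r')
      have e1 := map_extendTensor G R s s'
      have e2 := extendTensorInv_map G R r r'
      have e := compTensor_natural I G g g'
      have e3 := compTensor_inv I G Y Y'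
      rw [Category.assoc, Category.assoc, e2, reassoc_of% e1, ← G.map_comp_assoc, Category.assoc,
        tensorHom_comp_tensorHom_assoc, ← hg, ← hg', δ_natural_assoc, Functor.Monoidal.δ_μ,
        Category.comp_id, ← reassoc_of% e, e3, Category.comp_id, Category.comp_id,
        tensorHom_comp_tensorHom, ← G.map_comp, ← G.map_comp, hg, hg']
  inv_hom_id := by
    simp only [extendTensorInv, Preadditive.sum_comp, Category.assoc, map_extendTensor]
    simp only [← Category.assoc (compTensorInv I G _ _), compTensorInv_comp, Category.id_comp,
      ← G.map_comp, Functor.Monoidal.μ_δ_assoc, Category.assoc, tensorHom_comp_tensorHom,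
      ← G.map_sum, ← tensor_sum, ← sum_tensor, FiniteResolution.sum_r_s, id_tensorHom_id, G.map_id]

lemma extendTensor_natural {P Q P' Q' : K} (f : P ⟶ P') (g : Q ⟶ Q') :
    (G.map f ⊗ₘ G.map g) ≫ extendTensor G R P' Q' = extendTensor G R P Q ≫ G.map (f ⊗ₘ g) :=
  (R P).tensor_map_hom_ext (R Q) G fun X s X' s' => by
    have e := map_extendTensor G R s s'
    rw [tensorHom_comp_tensorHom_assoc, ← G.map_comp, ← G.map_comp, map_extendTensor,
      reassoc_of% e, ← G.map_comp, Category.assoc, tensorHom_comp_tensorHom]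

/-- On morphisms from values of `I` this becomes associativity of the constraint of `I ⋙ G` combined
with that of the oplax constraint of `I`. -/
lemma extendTensor_assoc (P Q V : K) :
    extendTensor G R P Q ▷ G.obj V ≫ extendTensor G R (P ⊗ Q) V ≫ G.map (α_ P Q V).hom =
      (α_ (G.obj P) (G.obj Q) (G.obj V)).hom ≫ G.obj P ◁ extendTensor G R Q V ≫
        extendTensor G R P (Q ⊗ V) :=
  (R P).tensor_whisker_map_hom_ext (R Q) (R V) G fun X s X' s' X'' s'' => by
    have e1 := map_extendTensor G R (δ I X X' ≫ (s ⊗ₘ s')) s''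
    have e2 := map_extendTensor G R s (δ I X' X'' ≫ (s' ⊗ₘ s''))
    have e3 := compTensor_assoc I G X X' X''
    have e4 := Functor.OplaxMonoidal.associativity I X X' X''
    have e5 : (δ I X X' ≫ (s ⊗ₘ s')) ⊗ₘ s'' = (δ I X X' ▷ _) ≫ ((s ⊗ₘ s') ⊗ₘ s'') := by
      rw [← tensorHom_id, tensorHom_comp_tensorHom, Category.id_comp]
    have e6 : s ⊗ₘ (δ I X' X'' ≫ (s' ⊗ₘ s'')) = (_ ◁ δ I X' X'') ≫ (s ⊗ₘ (s' ⊗ₘ s'')) := by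
      rw [← id_tensorHom, tensorHom_comp_tensorHom, Category.id_comp]
    have e7 : ((G.map s ⊗ₘ G.map s') ⊗ₘ G.map s'') ≫ extendTensor G R P Q ▷ G.obj V =
        (compTensor I G X X' ▷ _) ≫ (G.map (δ I X X' ≫ (s ⊗ₘ s')) ⊗ₘ G.map s'') := by
      rw [← tensorHom_id, ← tensorHom_id, tensorHom_comp_tensorHom, tensorHom_comp_tensorHom,
        map_extendTensor, Category.comp_id, Category.id_comp]
    have e8 : (G.map s ⊗ₘ (G.map s' ⊗ₘ G.map s'')) ≫ G.obj P ◁ extendTensor G R Q V =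
        (_ ◁ compTensor I G X' X'') ≫ (G.map s ⊗ₘ G.map (δ I X' X'' ≫ (s' ⊗ₘ s''))) := by
      rw [← id_tensorHom, ← id_tensorHom, tensorHom_comp_tensorHom, tensorHom_comp_tensorHom,
        map_extendTensor, Category.comp_id, Category.id_comp]
    rw [reassoc_of% e7, reassoc_of% e1, ← G.map_comp, associator_naturality_assoc, reassoc_of% e8,
      e2, e5, e6]
    simp only [Category.assoc]
    rw [associator_naturality, reassoc_of% e4, G.map_comp, reassoc_of% e3]

lemma extendTensor_left (P : K) : (λ_ (G.obj P)).hom =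
    (compUnit I G ≫ G.map (η I)) ▷ G.obj P ≫ extendTensor G R (𝟙_ K) P ≫ G.map (λ_ P).hom := by
  rw [← cancel_epi (λ_ (G.obj P)).inv]
  refine (R P).map_hom_ext G fun X s => ?_
  have e1 := map_extendTensor G R (η I) s
  have e2 := compTensor_left I G X
  have e3 := left_unitality_hom I X
  have e4 : 𝟙_ C ◁ G.map s ≫ (compUnit I G ≫ G.map (η I)) ▷ G.obj P =
      (compUnit I G ▷ _) ≫ (G.map (η I) ⊗ₘ G.map s) := by
    rw [comp_whiskerRight, whisker_exchange_assoc, MonoidalCategory.tensorHom_def']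
  rw [leftUnitor_inv_naturality_assoc, leftUnitor_inv_naturality_assoc, reassoc_of% e4,
    reassoc_of% e1, ← G.map_comp, leftUnitor_naturality, e2,
    MonoidalCategory.tensorHom_def]
  simp only [Category.assoc]
  rw [leftUnitor_naturality, reassoc_of% e3, G.map_comp]

lemma extendTensor_right (P : K) : (ρ_ (G.obj P)).hom =
    G.obj P ◁ (compUnit I G ≫ G.map (η I)) ≫ extendTensor G R P (𝟙_ K) ≫ G.map (ρ_ P).hom := by
  rw [← cancel_epi (ρ_ (G.obj P)).inv]
  refine (R P).map_hom_ext G fun X s => ?_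
  have e1 := map_extendTensor G R s (η I)
  have e2 := compTensor_right I G X
  have e3 := right_unitality_hom I X
  have e4 : G.map s ▷ 𝟙_ C ≫ G.obj P ◁ (compUnit I G ≫ G.map (η I)) =
      (_ ◁ compUnit I G) ≫ (G.map s ⊗ₘ G.map (η I)) := by
    rw [MonoidalCategory.whiskerLeft_comp, ← whisker_exchange_assoc, MonoidalCategory.tensorHom_def]
  rw [rightUnitor_inv_naturality_assoc, rightUnitor_inv_naturality_assoc, reassoc_of% e4,
    reassoc_of% e1, ← G.map_comp, rightUnitor_naturality, e2,
    MonoidalCategory.tensorHom_def']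
  simp only [Category.assoc]
  rw [rightUnitor_naturality, reassoc_of% e3, G.map_comp]

/-- The monoidal structure of the extension. -/
@[reducible] def extendMonoidal : G.Monoidal :=
  Functor.CoreMonoidal.toMonoidal
    { εIso := Functor.Monoidal.εIso (I ⋙ G) ≪≫ G.mapIso (Functor.Monoidal.εIso I).symm
      μIso := extendTensorIso G R
      μIso_hom_natural_left := fun f P => by
        have := extendTensor_natural G R f (𝟙 P)
        rwa [G.map_id, tensorHom_id, tensorHom_id] at this
      μIso_hom_natural_right := fun P f => by
        have := extendTensor_natural G R (𝟙 P) f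
        rwa [G.map_id, id_tensorHom, id_tensorHom] at this
      associativity := extendTensor_assoc G R
      left_unitality := extendTensor_left G R
      right_unitality := extendTensor_right G R }

end ExtendMonoidal


/-! ### Extension of linear symmetric monoidal functors -/

section ExtendLinSym
open Functor.LaxMonoidal Functor.OplaxMonoidal
variable {D : Type*} [Category D] [Preadditive D] [Linear ℂ D] [MonoidalCategory D]
    [SymmetricCategory D]
  {K : Type*} [Category K] [Preadditive K] [Linear ℂ K] [MonoidalCategory K]
    [MonoidalPreadditive K] [SymmetricCategory K]
  {C : Type*} [Category C] [Preadditive C] [Linear ℂ C] [MonoidalCategory C]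
    [MonoidalPreadditive C] [SymmetricCategory C]

/-- The extension is compatible with the symmetries. -/
@[reducible] def extendBraided {I : D ⥤ K} [I.Braided] [I.Full] (G : K ⥤ C) [G.Additive] [(I ⋙ G).Braided]
    (R : ∀ P, FiniteResolution I P) : G.Braided where
  toMonoidal := extendMonoidal G R
  braided P Q := (R P).tensor_map_hom_ext (R Q) G fun X s X' s' => by
    have e1 := map_extendTensor G R s s'
    have e2 := map_extendTensor G R s' s
    have e3 : compTensor I G X X' ≫ G.map (I.map (β_ X X').hom) =
      (β_ (G.obj (I.obj X)) (G.obj (I.obj X'))).hom ≫ compTensor I G X' X :=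
        Functor.Braided.braided (F := I ⋙ G) X X'
    have e4 : μ I X X' ≫ I.map (β_ X X').hom = (β_ (I.obj X) (I.obj X')).hom ≫ μ I X' X :=
      Functor.Braided.braided X X'
    have e5 : δ I X X' ≫ (β_ (I.obj X) (I.obj X')).hom = I.map (β_ X X').hom ≫ δ I X' X := by
      rw [← cancel_epi (μ I X X'), Functor.Monoidal.μ_δ_assoc, reassoc_of% e4,
        Functor.Monoidal.μ_δ, Category.comp_id]
    change _ ≫ extendTensor G R P Q ≫ _ = _ ≫ _ ≫ extendTensor G R Q P
    rw [reassoc_of% e1, ← G.map_comp, Category.assoc, BraidedCategory.braiding_naturality,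
      reassoc_of% e5, BraidedCategory.braiding_naturality_assoc, e2, ← reassoc_of% e3, ← G.map_comp]

/-- A linear symmetric monoidal functor extends along a dense one if its underlying functor does. -/
lemma exists_comp_eq_of_comp_toFunctor_eq (I : LinSymFunctor D K) [I.toFunctor.Full]
    (R : ∀ P, FiniteResolution I.toFunctor P) (F : LinSymFunctor D C) (G : K ⥤ C) [G.Additive]
    [G.Linear ℂ] (h : I.toFunctor ⋙ G = F.toFunctor) :
    ∃ H : LinSymFunctor K C, I.comp H = F := by
  obtain ⟨F, _, _, i⟩ := F
  dsimp only at h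
  subst h
  -- A braided structure is determined by `ε` and `μ`. In the composite, the constraints of `I`
  -- cancel against their inverses in the extended constraints, which leaves those of `i`.
  have key : (I.comp ⟨G, inferInstance, inferInstance, extendBraided G R⟩).braided = i := by
    refine braided_ext ?_ (funext fun X => funext fun Y => ?_)
    · change (compUnit I.toFunctor G ≫ G.map (η I.toFunctor)) ≫ G.map (ε I.toFunctor) =
        compUnit _ _
      rw [Category.assoc, ← G.map_comp, Functor.Monoidal.η_ε, G.map_id, Category.comp_id]
    · have e := map_extendTensor G R (𝟙 (I.toFunctor.obj X)) (𝟙 (I.toFunctor.obj Y))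
      rw [G.map_id, G.map_id, id_tensorHom_id, id_tensorHom_id, Category.id_comp,
        Category.comp_id] at e
      change extendTensor G R _ _ ≫ G.map (μ I.toFunctor X Y) = compTensor _ _ X Y
      rw [e, Category.assoc, ← G.map_comp, Functor.Monoidal.δ_μ, G.map_id, Category.comp_id]
  exact ⟨⟨G, inferInstance, inferInstance, extendBraided G R⟩, congrArg (LinSymFunctor.mk _ _ _) key⟩

lemma LinSymFunctor.isIso_of_eq {F G : LinSymFunctor D C} (h : F = G) : F.IsIso G := by
  subst h
  exact ⟨Iso.refl _, inferInstanceAs (NatTrans.IsMonoidal (𝟙 F.toFunctor))⟩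

lemma LinSymFunctor.isIso_of_comp_isIso {I : LinSymFunctor D K} [I.toFunctor.Full]
    (R : ∀ P, FiniteResolution I.toFunctor P) {G₁ G₂ : LinSymFunctor K C}
    (h : (I.comp G₁).IsIso (I.comp G₂)) : G₁.IsIso G₂ := by
  obtain ⟨θ, hθ⟩ := h
  have : NatTrans.IsMonoidal (F₁ := I.toFunctor ⋙ G₁.toFunctor)
    (F₂ := I.toFunctor ⋙ G₂.toFunctor) θ.hom := hθ
  exact ⟨extendNatIso R (G₁ := G₁.toFunctor) (G₂ := G₂.toFunctor) θ,
    extendNatTrans_isMonoidal R (G₁ := G₁.toFunctor) (G₂ := G₂.toFunctor) θ.hom⟩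

/-- Linear symmetric monoidal functors extend along dense ones, uniquely up to isomorphism. -/
lemma LinSymFunctor.exists_extension [HasFiniteBiproducts C] [IsIdempotentComplete C]
    (I : LinSymFunctor D K) [I.toFunctor.Full] [I.toFunctor.Faithful]
    (R : ∀ P, FiniteResolution I.toFunctor P) (hI : Function.Injective I.toFunctor.obj)
    (F : LinSymFunctor D C) : ∃ G : LinSymFunctor K C, I.comp G = F ∧
      ∀ G₁ : LinSymFunctor K C, I.comp G₁ = F → G₁.IsIso G := by
  obtain ⟨S, hS⟩ := exists_extend (C := C) F.toFunctor R hI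
  obtain ⟨G, hG⟩ := exists_comp_eq_of_comp_toFunctor_eq I R F (Splitting.extend S)
    (Splitting.comp_extend S hS)
  exact ⟨G, hG, fun G₁ hG₁ => isIso_of_comp_isIso R (isIso_of_eq (hG₁.trans hG.symm))⟩

end ExtendLinSym

/-! ### The embedding into the Karoubian envelope -/

section Envelope
open KarEnv Idempotents
variable {D : Type*} [Category D] [Preadditive D] [Linear ℂ D] [MonoidalCategory D]
    [MonoidalPreadditive D] [MonoidalLinear ℂ D] [SymmetricCategory D]

instance : (karEmbedding D).toFunctor.Full :=
  inferInstanceAs (Mat_.embedding D ⋙ toKaroubi (Mat_ D)).Full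

instance : (karEmbedding D).toFunctor.Faithful :=
  inferInstanceAs (Mat_.embedding D ⋙ toKaroubi (Mat_ D)).Faithful

lemma karEmbedding_obj_injective : Function.Injective (karEmbedding D).toFunctor.obj := by
  intro X Y h
  have h' : matOne X = matOne Y := congrArg Karoubi.X h
  simp only [matOne, Mat_.mk.injEq, heq_eq_eq, true_and] at h'
  exact congrFun h' PUnit.unit

open scoped Classical in
/-- The projection of a finite family to one of its members. -/
def matProj (M : Mat_ D) (i : M.ι) : M ⟶ matOne (M.X i) :=
  mkMat fun j _ => if h : j = i then eqToHom (congrArg M.X h) else 0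

open scoped Classical in
/-- The inclusion of one of the members of a finite family. -/
def matIncl (M : Mat_ D) (i : M.ι) : matOne (M.X i) ⟶ M :=
  mkMat fun _ j => if h : i = j then eqToHom (congrArg M.X h) else 0

lemma sum_matProj_matIncl (M : Mat_ D) : ∑ i, matProj M i ≫ matIncl M i = 𝟙 M := by
  classical
  have entry_sum : ∀ (f : M.ι → (M ⟶ M)) (j k : M.ι),
      entry (∑ i, f i) j k = ∑ i, entry (f i) j k := fun f j k =>
    map_sum (AddMonoidHom.mk' (fun f : M ⟶ M => entry f j k) fun _ _ => rfl) f _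
  refine mat_ext fun j k => ?_
  rw [entry_sum, Finset.sum_eq_single j]
  · rw [entry_comp]
    have e : entry (𝟙 M) j k = if h : j = k then eqToHom (congrArg M.X h) else 0 :=
      Mat_.id_apply M j k
    rw [e]
    change ∑ _ : PUnit, _ = _
    simp [matProj, matIncl]
  · intro i _ hi
    rw [entry_comp]
    change ∑ _ : PUnit, _ = _
    simp [matProj, hi.symm]
  · simp

/-- An object of the Karoubian envelope is a summand of a finite sum. -/
def karResolution (P : KarEnvelope D) : FiniteResolution (karEmbedding D).toFunctor P where
  ix := P.X.ι
  fin := inferInstance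
  ob := P.X.X
  r i := ⟨P.p ≫ matProj P.X i, by
    change P.p ≫ (P.p ≫ matProj P.X i) ≫ 𝟙 _ = _
    exact (congrArg (P.p ≫ ·) (Category.comp_id (P.p ≫ matProj P.X i))).trans (P.idem_assoc _)⟩
  s i := ⟨matIncl P.X i ≫ P.p, by
    change 𝟙 _ ≫ (matIncl P.X i ≫ P.p) ≫ P.p = _
    exact (Category.id_comp _).trans
      ((Category.assoc _ _ _).trans (congrArg (matIncl P.X i ≫ ·) P.idem))⟩
  sum_r_s := Karoubi.hom_ext _ _ (by
    rw [Karoubi.sum_hom]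
    change ∑ i, (P.p ≫ matProj P.X i) ≫ matIncl P.X i ≫ P.p = P.p
    have e := sum_matProj_matIncl P.X
    calc ∑ i, (P.p ≫ matProj P.X i) ≫ matIncl P.X i ≫ P.p
        = P.p ≫ (∑ i, matProj P.X i ≫ matIncl P.X i) ≫ P.p := by
          simp only [Preadditive.sum_comp, Preadditive.comp_sum, Category.assoc]
      _ = P.p := by rw [e, Category.id_comp, P.idem])

end Envelope

end

/-! ### The universal property -/

theorem mainTheorem4 (t : ℂ) {C : Type u} [Category.{v} C] [Preadditive C] [Linear ℂ C]
    [MonoidalCategory C] [MonoidalPreadditive C] [MonoidalLinear ℂ C] [SymmetricCategory C]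
    (A : C) (α : A ⊗ A ⟶ A ⊗ A) (β : A ⊗ A ⟶ 𝟙_ C) (δ : 𝟙_ C ⟶ A ⊗ A)
    (h : IsSelfDualWithNeutralizer t A α β δ) :
    ∃ G' : LinSymFunctor (Rep0 t) C,
      (IsStrictRealization A α β δ G' ∧
        ∀ F : LinSymFunctor (Rep0 t) C, IsStrictRealization A α β δ F → F = G') ∧
      (HasFiniteBiproducts C → IsIdempotentComplete C →
        ∃ G : LinSymFunctor (RepH t) C, (karEmbedding (Rep0 t)).comp G = G' ∧
          ∀ G₁ : LinSymFunctor (RepH t) C, (karEmbedding (Rep0 t)).comp G₁ = G' → G₁.IsIso G) := by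
  refine ⟨powLinSym h, ⟨isStrictRealization_powLinSym h, fun F hF => hF.eq_powLinSym h⟩,
    fun _ _ => ?_⟩
  exact LinSymFunctor.exists_extension (karEmbedding (Rep0 t)) karResolution
    karEmbedding_obj_injective (powLinSym h)
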